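/- **Setting.** A linear binary constraint system (LBCS) $\mathcal F$ consists of equations $C_l:\ \sum_{x_i\in S_l}x_i=b_l$ over $\mathbb F_2$; its homogenization $\mathcal F_0$ is obtained by replacing every $b_l$ by $0$. The graph $\mathcal G(\mathcal F)$ has as vertices the pairs $(l,f)$, where $f:S_l\to\mathbb F_2$ satisfies $C_l$, and $(l,f)$, $(k,g)$ are adjacent iff $f(x_i)\neq g(x_i)$ for some $x_i\in S_l\cap S_k$. Let $\mathcal F$ be the LBCS of the Mermin–Peres magic square game, $$x_1+x_2+x_3=0,\quad x_4+x_5+x_6=0,\quad x_7+x_8+x_9=0,\quad x_1+x_4+x_7=0,\quad x_2+x_5+x_8=0,\quad x_3+x_6+x_9=1,$$ and let $\Gamma$ be the directed graph with $48$ vertices obtained from the disjoint union $\mathcal G(\mathcal F)\cup\mathcal G(\mathcal F_0)$ by replacing each edge by the two directed edges with the same end points. Write $D=(d_{ij})$ for its adjacency matrix, and $s(e)$, $t(e)$ for the source and target of an edge $e$. *Graph algebra.* $C^*(\Gamma)$ is the universal unital C*-algebra generated by mutually orthogonal projections $p_v$ ($v$ a vertex) with $\sum_v p_v=1$ and partial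 isometries $S_e$ ($e$ an edge) with $S_e^*S_e=p_{t(e)}$ and $\sum_{s(e)=v}S_eS_e^*=p_v$. For a path $\mu=e_1\cdots e_n$ (that is, $t(e_i)=s(e_{i+1})$) of length $|\mu|=n\ge1$ put $S_\mu=S_{e_1}\cdots S_{e_n}$; for a path of length $0$, i.e. a vertex $v$, put $S_v=p_v$. *Quantum symmetry.* $Q^{\rm aut}_{\rm Ban}(\Gamma)$ is the universal unital C*-algebra generated by elements $u_{ij}$, indexed by pairs of vertices, with $u_{ij}=u_{ij}^*=u_{ij}^2$, $\sum_j u_{ij}=1=\sum_i u_{ij}$ and $\sum_k u_{ik}d_{kj}=\sum_k d_{ik}u_{kj}$. It acts on $C^*(\Gamma)$ by the unital $*$-homomorphism $\alpha:C^*(\Gamma)\to C^*(\Gamma)\otimes_{\min}Q^{\rm aut}_{\rm Ban}(\Gamma)$, $$\alpha(p_i)=\sum_k p_k\otimes u_{ki},\qquad \alpha(S_e)=\sum_f S_f\otimes u_{s(f)s(e)}u_{t(f)t(e)}.$$ A state $\tau$ on $C^*(\Gamma)$ is $Q^{\rm aut}_{\rm Ban}(\Gamma)$-invariant if $(\tau\otimes{\rm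 id})\alpha(a)=\tau(a)1$ for all $a$. The classical group ${\rm Aut}(\Gamma)$ acts by $p_v\mapsto p_{g(v)}$, $S_e\mapsto S_{g(e)}$, and $\tau$ is ${\rm Aut}(\Gamma)$-invariant if it is invariant under all these homomorphisms. *KMS states.* Let $\sigma_t$ ($t\in\mathbb R$) be the gauge dynamics, $\sigma_t(p_v)=p_v$, $\sigma_t(S_e)=e^{it}S_e$. For $\beta\in\mathbb R$, a state $\tau$ is a KMS state at inverse temperature $\beta$ if $\tau(ab)=\tau(b\,\sigma_{i\beta}(a))$ for all analytic elements $a,b$ (those $a$ for which $t\mapsto\sigma_t(a)$ extends to an entire function $z\mapsto\sigma_z(a)$). **Theorem.** 1. If $C^*(\Gamma)$ has a KMS state at inverse temperature $\beta\in\mathbb R$, then $\beta=\ln 9$. 2. $C^*(\Gamma)$ has exactly one $Q^{\rm aut}_{\rm Ban}(\Gamma)$-invariant KMS state $\tau$. It is a KMS state at inverse temperature $\ln 9$, and for all paths $\mu,\nu$ $$\tau(S_\mu S_\nu^*)=\delta_{\mu,\nu}\,\frac1{48\cdot 9^{|\mu|}}.$$ 3. By contrast, $C^*(\Gamma)$ has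 infinitely many KMS states at inverse temperature $\ln 9$, and every KMS state of $C^*(\Gamma)$ is ${\rm Aut}(\Gamma)$-invariant. -/

import Mathlib

open scoped TensorProduct ComplexOrder

noncomputable section

set_option linter.unusedSectionVars false

/-! ### C⋆-seminorms and completions -/

/-- A C⋆-seminorm on a complex ⋆-algebra. The inequality `p x ^ 2 ≤ p (star x * x)` together with
submultiplicativity forces `p (star x) = p x` and the C⋆-identity. -/
structure CStarSeminorm (F : Type*) [Ring F] [StarRing F] [Algebra ℂ F] extends Seminorm ℂ F where
  mul_le' : ∀ x y, toFun (x * y) ≤ toFun x * toFun y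
  sq_le' : ∀ x, toFun x ^ 2 ≤ toFun (star x * x)

namespace CStarSeminorm

section basic

variable {F : Type*} [Ring F] [StarRing F] [Algebra ℂ F]

instance : CoeFun (CStarSeminorm F) (fun _ => F → ℝ) := ⟨fun p => p.toSeminorm⟩

theorem nonneg (p : CStarSeminorm F) (x : F) : 0 ≤ p x := apply_nonneg p.toSeminorm x
theorem mul_le (p : CStarSeminorm F) (x y : F) : p (x * y) ≤ p x * p y := p.mul_le' x y
theorem sq_le (p : CStarSeminorm F) (x : F) : p x ^ 2 ≤ p (star x * x) := p.sq_le' x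

theorem le_star (p : CStarSeminorm F) (x : F) : p x ≤ p (star x) := by
  have h := (p.sq_le x).trans (p.mul_le _ _)
  rcases (p.nonneg x).eq_or_lt with h0 | h0
  · rw [← h0]; exact p.nonneg _
  · rw [sq] at h; exact le_of_mul_le_mul_right h h0

theorem star_eq (p : CStarSeminorm F) (x : F) : p (star x) = p x :=
  le_antisymm (by simpa using p.le_star (star x)) (p.le_star x)

/-- The supremum of a pointwise bounded family of C⋆-seminorms. -/
def sup (P : Set (CStarSeminorm F)) (hP : ∀ x, ∃ C : ℝ, ∀ p ∈ P, p x ≤ C) : CStarSeminorm F where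
  toFun x := ⨆ p : P, p.1 x
  map_zero' := by simp
  add_le' x y := by
    have hb : ∀ x, BddAbove (Set.range fun p : P => p.1 x) := fun x => by
      obtain ⟨C, hC⟩ := hP x
      exact ⟨C, by rintro _ ⟨p, rfl⟩; exact hC _ p.2⟩
    refine Real.iSup_le (fun p => (map_add_le_add p.1.toSeminorm x y).trans
      (add_le_add (le_ciSup (hb x) p) (le_ciSup (hb y) p))) ?_
    exact add_nonneg (Real.iSup_nonneg fun p => p.1.nonneg _)
      (Real.iSup_nonneg fun p => p.1.nonneg _)
  neg' x := by simp
  smul' a x := by simp [map_smul_eq_mul, Real.mul_iSup_of_nonneg (norm_nonneg a)]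
  mul_le' x y := by
    have hb : ∀ x, BddAbove (Set.range fun p : P => p.1 x) := fun x => by
      obtain ⟨C, hC⟩ := hP x
      exact ⟨C, by rintro _ ⟨p, rfl⟩; exact hC _ p.2⟩
    refine Real.iSup_le (fun p => (p.1.mul_le x y).trans
      (mul_le_mul (le_ciSup (hb x) p) (le_ciSup (hb y) p) (p.1.nonneg _) ?_)) ?_
    · exact Real.iSup_nonneg fun p => p.1.nonneg _
    · exact mul_nonneg (Real.iSup_nonneg fun p => p.1.nonneg _)
        (Real.iSup_nonneg fun p => p.1.nonneg _)
  sq_le' x := by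
    have hb : ∀ x, BddAbove (Set.range fun p : P => p.1 x) := fun x => by
      obtain ⟨C, hC⟩ := hP x
      exact ⟨C, by rintro _ ⟨p, rfl⟩; exact hC _ p.2⟩
    have h0 : 0 ≤ ⨆ p : P, p.1 (star x * x) := Real.iSup_nonneg fun p => p.1.nonneg _
    have : (⨆ p : P, p.1 x) ≤ Real.sqrt (⨆ p : P, p.1 (star x * x)) := by
      refine Real.iSup_le (fun p => Real.le_sqrt_of_sq_le ?_) (Real.sqrt_nonneg _)
      exact (p.1.sq_le x).trans (le_ciSup (hb (star x * x)) p)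
    calc (⨆ p : P, p.1 x) ^ 2 ≤ Real.sqrt (⨆ p : P, p.1 (star x * x)) ^ 2 :=
          pow_le_pow_left₀ (Real.iSup_nonneg fun p => p.1.nonneg _) this 2
      _ = _ := Real.sq_sqrt h0

theorem sup_apply (P : Set (CStarSeminorm F)) (hP) (x : F) :
    sup P hP x = ⨆ p : P, p.1 x := rfl

theorem le_sup {P : Set (CStarSeminorm F)} (hP) {p : CStarSeminorm F} (hp : p ∈ P) (x : F) :
    p x ≤ sup P hP x := by
  obtain ⟨C, hC⟩ := hP x
  exact le_ciSup (f := fun p : P => p.1 x) ⟨C, by rintro _ ⟨p, rfl⟩; exact hC _ p.2⟩ ⟨p, hp⟩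

theorem sup_le {P : Set (CStarSeminorm F)} (hP) {x : F} {C : ℝ} (hC : 0 ≤ C)
    (h : ∀ p ∈ P, p x ≤ C) : sup P hP x ≤ C :=
  Real.iSup_le (fun p => h p.1 p.2) hC

end basic

section completion

variable {F : Type*} [Ring F] [StarRing F] [Algebra ℂ F]

/-- The ⋆-algebra `F` regarded as a seminormed ring through `p`. -/

def Pre (_ : CStarSeminorm F) : Type _ := F

variable (p : CStarSeminorm F)

instance : Ring p.Pre := inferInstanceAs (Ring F)
instance : StarRing p.Pre := inferInstanceAs (StarRing F)
instance : Algebra ℂ p.Pre := inferInstanceAs (Algebra ℂ F)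
instance [StarModule ℂ F] : StarModule ℂ p.Pre := inferInstanceAs (StarModule ℂ F)

/-- The identity map of `F` as a map to the seminormed ring. -/
def toPre : F →⋆ₐ[ℂ] p.Pre := StarAlgHom.id ℂ F

instance : SeminormedRing p.Pre where
  __ := (inferInstance : Ring p.Pre)
  __ := (p.toSeminorm.toAddGroupSeminorm.toSeminormedAddCommGroup : SeminormedAddCommGroup F)
  norm_mul_le x y := p.mul_le x y

theorem norm_toPre (x : F) : ‖p.toPre x‖ = p x := rfl

instance : NormedSpace ℂ p.Pre where
  norm_smul_le a x := (map_smul_eq_mul p.toSeminorm a x).le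

instance : NormedStarGroup p.Pre where
  norm_star_le x := (p.star_eq x).le

/-- The C⋆-algebra obtained from `F` by separation and completion with respect to `p`. -/
abbrev Compl : Type _ := UniformSpace.Completion p.Pre

open UniformSpace

instance : Star p.Compl := ⟨Completion.map star⟩

theorem uc_star : UniformContinuous (star : p.Pre → p.Pre) := star_isometry.uniformContinuous

theorem continuous_star_compl : Continuous (star : p.Compl → p.Compl) :=
  Completion.continuous_map

theorem coe_star (x : p.Pre) : ((star x : p.Pre) : p.Compl) = star (x : p.Compl) :=
  (Completion.map_coe p.uc_star x).symm

instance : StarRing p.Compl where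
  star_involutive x := by
    induction x using Completion.induction_on with
    | hp => exact isClosed_eq (p.continuous_star_compl.comp p.continuous_star_compl) continuous_id
    | ih x => rw [← coe_star, ← coe_star, star_star]
  star_mul x y := by
    have := p.continuous_star_compl
    induction x, y using Completion.induction_on₂ with
    | hp => exact isClosed_eq (by fun_prop) (by fun_prop)
    | ih x y => rw [← Completion.coe_mul, ← coe_star, star_mul, Completion.coe_mul, coe_star,
        coe_star]
  star_add x y := by
    have := p.continuous_star_compl
    induction x, y using Completion.induction_on₂ with
    | hp => exact isClosed_eq (by fun_prop) (by fun_prop)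
    | ih x y => rw [← Completion.coe_add, ← coe_star, star_add, Completion.coe_add, coe_star,
        coe_star]

instance : CStarRing p.Compl where
  norm_mul_self_le x := by
    have := p.continuous_star_compl
    induction x using Completion.induction_on with
    | hp => exact isClosed_le (by fun_prop) (by fun_prop)
    | ih x =>
      rw [← coe_star, ← Completion.coe_mul, Completion.norm_coe, Completion.norm_coe, ← sq]
      exact p.sq_le x

variable [StarModule ℂ F]

instance : StarModule ℂ p.Compl where
  star_smul a x := by
    have := p.continuous_star_compl
    induction x using Completion.induction_on with
    | hp => exact isClosed_eq (this.comp (continuous_const_smul a)) (this.const_smul (star a))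
    | ih x => rw [← Completion.coe_smul, ← coe_star, star_smul, Completion.coe_smul, coe_star]

instance : NormedAlgebra ℂ p.Compl where
  norm_smul_le := norm_smul_le

instance : CStarAlgebra p.Compl where

/-- The canonical ⋆-homomorphism from `F`, with dense range. -/
def ofAlg : F →⋆ₐ[ℂ] p.Compl where
  toFun x := ((p.toPre x : p.Pre) : p.Compl)
  map_one' := rfl
  map_mul' x y := by rw [map_mul, Completion.coe_mul]
  map_zero' := rfl
  map_add' x y := by rw [map_add, Completion.coe_add]
  commutes' r := rfl
  map_star' x := by rw [map_star, coe_star]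

theorem norm_ofAlg (x : F) : ‖p.ofAlg x‖ = p x := by
  change ‖((p.toPre x : p.Pre) : p.Compl)‖ = p x
  rw [Completion.norm_coe, norm_toPre]

theorem denseRange_ofAlg : DenseRange p.ofAlg :=
  Completion.denseRange_coe (α := p.Pre)

/-- The identity map, as a linear map from the seminormed ring. -/
def ofPre : p.Pre →ₗ[ℂ] F := LinearMap.id (R := ℂ) (M := F)

/-- The bounded linear extension of a linear map that is bounded with respect to `p`. -/
def extendL {B : Type*} [NormedAddCommGroup B] [NormedSpace ℂ B] [CompleteSpace B]
    (φ : F →ₗ[ℂ] B) (h : ∃ C : ℝ, ∀ x, ‖φ x‖ ≤ C * p x) : p.Compl →L[ℂ] B :=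
  (LinearMap.mkContinuousOfExistsBound (φ ∘ₗ p.ofPre) h).fromCompletion

theorem extendL_ofAlg {B : Type*} [NormedAddCommGroup B] [NormedSpace ℂ B] [CompleteSpace B]
    (φ : F →ₗ[ℂ] B) (h : ∃ C : ℝ, ∀ x, ‖φ x‖ ≤ C * p x) (x : F) :
    p.extendL φ h (p.ofAlg x) = φ x :=
  ContinuousLinearMap.fromCompletion_apply_coe
    (LinearMap.mkContinuousOfExistsBound (φ ∘ₗ p.ofPre) h) (p.toPre x)

/-- The extension of a ⋆-homomorphism that is contractive with respect to `p`. -/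
def extend {B : Type*} [CStarAlgebra B] (φ : F →⋆ₐ[ℂ] B) (h : ∀ x, ‖φ x‖ ≤ p x) :
    p.Compl →⋆ₐ[ℂ] B :=
  let L := p.extendL (φ : F →ₐ[ℂ] B).toLinearMap ⟨1, by simpa using h⟩
  have hL : ∀ x : F, L (p.ofAlg x) = φ x := p.extendL_ofAlg _ _
  { toFun := L
    map_one' := by simpa using hL 1
    map_zero' := map_zero L
    map_add' := map_add L
    map_mul' := fun x y => by
      refine p.denseRange_ofAlg.induction_on₂ (p := fun x y => L (x * y) = L x * L y)
        (isClosed_eq (by fun_prop) (by fun_prop)) (fun x y => ?_) x y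
      rw [← map_mul, hL, hL, hL, map_mul]
    commutes' := fun r => by
      rw [Algebra.algebraMap_eq_smul_one, map_smul, Algebra.algebraMap_eq_smul_one]
      simpa using congrArg (r • ·) (hL 1)
    map_star' := fun x => by
      have := p.continuous_star_compl
      refine p.denseRange_ofAlg.induction_on (p := fun x => L (star x) = star (L x)) x
        (isClosed_eq (by fun_prop) (by fun_prop)) (fun x => ?_)
      rw [← map_star, hL, hL, map_star] }

theorem extend_ofAlg {B : Type*} [CStarAlgebra B] (φ : F →⋆ₐ[ℂ] B) (h : ∀ x, ‖φ x‖ ≤ p x)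
    (x : F) : p.extend φ h (p.ofAlg x) = φ x :=
  p.extendL_ofAlg _ _ x

end completion

/-- The C⋆-seminorm `x ↦ ‖φ x‖` defined by a ⋆-homomorphism to a C⋆-algebra. -/
def ofHom {F : Type*} [Ring F] [StarRing F] [Algebra ℂ F] {B : Type*} [CStarAlgebra B]
    (φ : F →⋆ₐ[ℂ] B) : CStarSeminorm F where
  toFun x := ‖φ x‖
  map_zero' := by simp
  add_le' x y := by simpa using norm_add_le (φ x) (φ y)
  neg' x := by simp
  smul' a x := by simp [norm_smul]
  mul_le' x y := by simpa using norm_mul_le (φ x) (φ y)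
  sq_le' x := by rw [map_mul, map_star, CStarRing.norm_star_mul_self, sq]

theorem ofHom_apply {F : Type*} [Ring F] [StarRing F] [Algebra ℂ F] {B : Type*} [CStarAlgebra B]
    (φ : F →⋆ₐ[ℂ] B) (x : F) : ofHom φ x = ‖φ x‖ := rfl

end CStarSeminorm

/-! ### Free ⋆-algebras and universal C⋆-algebras -/

/-- The free unital complex ⋆-algebra on a set `X`: noncommutative polynomials in the letters
`x = (x, false)` and `x⋆ = (x, true)`. -/
def FreeStarAlg (X : Type*) : Type _ := FreeAlgebra ℂ (X × Bool)

namespace FreeStarAlg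

variable {X : Type*}

instance : Ring (FreeStarAlg X) := inferInstanceAs (Ring (FreeAlgebra ℂ (X × Bool)))
instance : Algebra ℂ (FreeStarAlg X) := inferInstanceAs (Algebra ℂ (FreeAlgebra ℂ (X × Bool)))

/-- The letters `x` and `x⋆`. -/
def letter (x : X × Bool) : FreeStarAlg X := FreeAlgebra.ι ℂ x

/-- The opposite algebra with conjugated scalars, used to define the involution. -/
def ConjOp (X : Type*) : Type _ := (FreeStarAlg X)ᵐᵒᵖ

instance : Ring (ConjOp X) := inferInstanceAs (Ring (FreeStarAlg X)ᵐᵒᵖ)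
instance : Algebra ℂ (ConjOp X) :=
  RingHom.toAlgebra' ((algebraMap ℂ (FreeStarAlg X)ᵐᵒᵖ).comp (starRingEnd ℂ))
    fun c x => Algebra.commutes (R := ℂ) (A := (FreeStarAlg X)ᵐᵒᵖ) (starRingEnd ℂ c) x

/-- The homomorphism to the conjugate opposite algebra that exchanges `x` and `x⋆`. -/
def starHom : FreeStarAlg X →ₐ[ℂ] ConjOp X :=
  FreeAlgebra.lift ℂ fun x => (MulOpposite.op (letter (x.1, !x.2)) : (FreeStarAlg X)ᵐᵒᵖ)

/-- The involution: antilinear, antimultiplicative, exchanging `x` and `x⋆`. -/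
instance : Star (FreeStarAlg X) := ⟨fun a => MulOpposite.unop (starHom a : (FreeStarAlg X)ᵐᵒᵖ)⟩

theorem star_letter (x : X × Bool) : star (letter x) = letter (x.1, !x.2) :=
  congrArg MulOpposite.unop (FreeAlgebra.lift_ι_apply (A := ConjOp X) _ x)

theorem star_algebraMap' (c : ℂ) :
    star (algebraMap ℂ (FreeStarAlg X) c) = algebraMap ℂ (FreeStarAlg X) (star c) :=
  congrArg MulOpposite.unop (starHom.commutes c)

theorem star_mul' (a b : FreeStarAlg X) : star (a * b) = star b * star a :=
  congrArg MulOpposite.unop (map_mul starHom a b)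

theorem star_add' (a b : FreeStarAlg X) : star (a + b) = star a + star b :=
  congrArg MulOpposite.unop (map_add starHom a b)

theorem induction {C : FreeStarAlg X → Prop} (h1 : ∀ c, C (algebraMap ℂ _ c))
    (h2 : ∀ x, C (letter x)) (h3 : ∀ a b, C a → C b → C (a * b))
    (h4 : ∀ a b, C a → C b → C (a + b)) (a : FreeStarAlg X) : C a :=
  FreeAlgebra.induction (R := ℂ) (X := X × Bool) (motive := C) h1 h2 h3 h4 a

instance : StarRing (FreeStarAlg X) where
  star_involutive a := by
    induction a using induction with
    | h1 c => rw [star_algebraMap', star_algebraMap', star_star]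
    | h2 x => rw [star_letter, star_letter]; simp
    | h3 a b ha hb => rw [star_mul', star_mul', ha, hb]
    | h4 a b ha hb => rw [star_add', star_add', ha, hb]
  star_mul := star_mul'
  star_add := star_add'

instance : StarModule ℂ (FreeStarAlg X) where
  star_smul c a := by
    rw [Algebra.smul_def, star_mul, star_algebraMap', Algebra.smul_def, Algebra.commutes]

/-- The generator `x`. -/
def gen (x : X) : FreeStarAlg X := letter (x, false)

/-- The ⋆-homomorphism determined by its values on the generators. -/
def lift {B : Type*} [Ring B] [StarRing B] [Algebra ℂ B] [StarModule ℂ B] (f : X → B) :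
    FreeStarAlg X →⋆ₐ[ℂ] B where
  __ := (FreeAlgebra.lift ℂ fun x : X × Bool => if x.2 then star (f x.1) else f x.1 :
    FreeStarAlg X →ₐ[ℂ] B)
  map_star' a := by
    set g : FreeStarAlg X →ₐ[ℂ] B :=
      FreeAlgebra.lift ℂ fun x : X × Bool => if x.2 then star (f x.1) else f x.1 with hg
    have hl : ∀ x, g (letter x) = if x.2 then star (f x.1) else f x.1 :=
      fun x => FreeAlgebra.lift_ι_apply _ x
    change g (star a) = star (g a)
    induction a using induction with
    | h1 c => rw [star_algebraMap', AlgHom.commutes, AlgHom.commutes, algebraMap_star_comm]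
    | h2 x => rw [star_letter, hl, hl]; rcases x with ⟨x, _ | _⟩ <;> simp
    | h3 a b ha hb => rw [star_mul, map_mul, map_mul, ha, hb, star_mul]
    | h4 a b ha hb => rw [star_add, map_add, map_add, ha, hb, star_add]

theorem lift_gen {B : Type*} [Ring B] [StarRing B] [Algebra ℂ B] [StarModule ℂ B] (f : X → B)
    (x : X) : lift f (gen x) = f x :=
  FreeAlgebra.lift_ι_apply (R := ℂ)
    (fun x : X × Bool => if x.2 then star (f x.1) else f x.1) (x, false)

theorem hom_ext {B : Type*} [Ring B] [StarRing B] [Algebra ℂ B]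
    {φ ψ : FreeStarAlg X →⋆ₐ[ℂ] B} (h : ∀ x, φ (gen x) = ψ (gen x)) : φ = ψ := by
  refine StarAlgHom.ext fun a => ?_
  induction a using induction with
  | h1 c => rw [AlgHomClass.commutes, AlgHomClass.commutes]
  | h2 x =>
    rcases x with ⟨x, _ | _⟩
    · exact h x
    · have : letter (x, true) = star (gen x) := by rw [gen, star_letter]; rfl
      rw [this, map_star, map_star, h]
  | h3 a b ha hb => rw [map_mul, map_mul, ha, hb]
  | h4 a b ha hb => rw [map_add, map_add, ha, hb]

end FreeStarAlg

/-- The C⋆-seminorms on the free ⋆-algebra that respect the relations `r = 0`, `r ∈ R`. -/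
def admissible {X : Type*} (R : Set (FreeStarAlg X)) : Set (CStarSeminorm (FreeStarAlg X)) :=
  {p | ∀ r ∈ R, p r = 0}

/-- The relations `R` bound the norms of the generators. This is the condition under which a
universal C⋆-algebra on generators `X` and relations `R` exists. -/
def BoundedRel {X : Type*} (R : Set (FreeStarAlg X)) : Prop :=
  ∀ x, ∃ C : ℝ, ∀ p ∈ admissible R, p (FreeStarAlg.gen x) ≤ C

theorem BoundedRel.bounded {X : Type*} {R : Set (FreeStarAlg X)} (hR : BoundedRel R)
    (a : FreeStarAlg X) : ∃ C : ℝ, ∀ p ∈ admissible R, p a ≤ C := by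
  induction a using FreeStarAlg.induction with
  | h1 c =>
    refine ⟨‖c‖, fun p _ => ?_⟩
    have h1 : p (1 : FreeStarAlg X) ≤ 1 := by
      have h := p.sq_le 1
      rw [star_one, mul_one] at h
      nlinarith [p.nonneg 1]
    rw [Algebra.algebraMap_eq_smul_one, map_smul_eq_mul p.toSeminorm]
    exact mul_le_of_le_one_right (norm_nonneg c) h1
  | h2 x =>
    obtain ⟨C, hC⟩ := hR x.1
    refine ⟨C, fun p hp => ?_⟩
    rcases x with ⟨x, _ | _⟩
    · exact hC p hp
    · have : FreeStarAlg.letter (x, true) = star (FreeStarAlg.gen x) := by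
        rw [FreeStarAlg.gen, FreeStarAlg.star_letter]; rfl
      rw [this, p.star_eq]; exact hC p hp
  | h3 a b ha hb =>
    obtain ⟨C, hC⟩ := ha
    obtain ⟨D, hD⟩ := hb
    refine ⟨|C| * |D|, fun p hp => (p.mul_le a b).trans ?_⟩
    exact mul_le_mul ((hC p hp).trans (le_abs_self C)) ((hD p hp).trans (le_abs_self D))
      (p.nonneg b) (abs_nonneg C)
  | h4 a b ha hb =>
    obtain ⟨C, hC⟩ := ha
    obtain ⟨D, hD⟩ := hb
    exact ⟨C + D, fun p hp =>
      (map_add_le_add p.toSeminorm a b).trans (add_le_add (hC p hp) (hD p hp))⟩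

/-- The largest C⋆-seminorm on the free ⋆-algebra that respects the relations. -/
def univSeminorm {X : Type*} (R : Set (FreeStarAlg X)) (hR : BoundedRel R) :
    CStarSeminorm (FreeStarAlg X) :=
  CStarSeminorm.sup (admissible R) hR.bounded

/-- The universal unital C⋆-algebra with generators `X` and relations `r = 0`, `r ∈ R`. -/
def UnivCStar {X : Type*} (R : Set (FreeStarAlg X)) (hR : BoundedRel R) : Type _ :=
  (univSeminorm R hR).Compl

namespace UnivCStar

variable {X : Type*} {R : Set (FreeStarAlg X)} {hR : BoundedRel R}

instance : CStarAlgebra (UnivCStar R hR) := inferInstanceAs (CStarAlgebra (univSeminorm R hR).Compl)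

instance : PartialOrder (UnivCStar R hR) := CStarAlgebra.spectralOrder _
instance : StarOrderedRing (UnivCStar R hR) := CStarAlgebra.spectralOrderedRing _

/-- The canonical homomorphism from the free ⋆-algebra. -/
def ofFree : FreeStarAlg X →⋆ₐ[ℂ] UnivCStar R hR := (univSeminorm R hR).ofAlg

/-- The canonical generators. -/
def gen (x : X) : UnivCStar R hR := ofFree (FreeStarAlg.gen x)

theorem ofFree_rel {r : FreeStarAlg X} (hr : r ∈ R) : (ofFree r : UnivCStar R hR) = 0 := by
  have h : ‖(ofFree r : UnivCStar R hR)‖ = univSeminorm R hR r :=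
    CStarSeminorm.norm_ofAlg (univSeminorm R hR) r
  rw [← norm_le_zero_iff, h]
  exact CStarSeminorm.sup_le _ le_rfl fun p hp => (hp r hr).le

theorem denseRange_ofFree : DenseRange (ofFree : FreeStarAlg X → UnivCStar R hR) :=
  (univSeminorm R hR).denseRange_ofAlg

/-- The universal property: a family in a C⋆-algebra that satisfies the relations extends to a
⋆-homomorphism. -/
def lift {B : Type*} [CStarAlgebra B] (f : X → B) (hf : ∀ r ∈ R, FreeStarAlg.lift f r = 0) :
    UnivCStar R hR →⋆ₐ[ℂ] B :=
  (univSeminorm R hR).extend (FreeStarAlg.lift f) fun x =>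
    CStarSeminorm.le_sup (p := CStarSeminorm.ofHom (FreeStarAlg.lift f)) hR.bounded
      (fun r hr => by rw [CStarSeminorm.ofHom_apply, hf r hr, norm_zero]) x

theorem lift_gen {B : Type*} [CStarAlgebra B] (f : X → B)
    (hf : ∀ r ∈ R, FreeStarAlg.lift f r = 0) (x : X) :
    lift (hR := hR) f hf (gen x) = f x :=
  ((univSeminorm R hR).extend_ofAlg _ _ _).trans (FreeStarAlg.lift_gen f x)

open scoped CStarAlgebra in
theorem hom_ext {B : Type*} [CStarAlgebra B] {φ ψ : UnivCStar R hR →⋆ₐ[ℂ] B}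
    (h : ∀ x, φ (gen x) = ψ (gen x)) : φ = ψ := by
  have h' : φ.comp ofFree = ψ.comp ofFree := FreeStarAlg.hom_ext h
  have hc : ∀ χ : UnivCStar R hR →⋆ₐ[ℂ] B, Continuous χ := fun χ => map_continuous χ
  refine StarAlgHom.ext fun a => ?_
  refine denseRange_ofFree.induction_on (p := fun a => φ a = ψ a) a
    (isClosed_eq (hc φ) (hc ψ)) fun a => ?_
  exact DFunLike.congr_fun h' a

end UnivCStar

/-! ### The minimal tensor product of C⋆-algebras -/

section spatial

open UniformSpace

variable {A B H K : Type*} [CStarAlgebra A] [CStarAlgebra B]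
  [NormedAddCommGroup H] [InnerProductSpace ℂ H] [NormedAddCommGroup K] [InnerProductSpace ℂ K]

variable (H K) in
/-- The Hilbert space tensor product. -/
def HilbertTensor : Type _ := Completion (H ⊗[ℂ] K)

instance : NormedAddCommGroup (HilbertTensor H K) :=
  inferInstanceAs (NormedAddCommGroup (Completion (H ⊗[ℂ] K)))
instance : InnerProductSpace ℂ (HilbertTensor H K) :=
  inferInstanceAs (InnerProductSpace ℂ (Completion (H ⊗[ℂ] K)))
instance : CompleteSpace (HilbertTensor H K) :=
  inferInstanceAs (CompleteSpace (Completion (H ⊗[ℂ] K)))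

/-- Elementary tensors in the Hilbert space tensor product. -/
def htmul (h : H) (k : K) : HilbertTensor H K := ((h ⊗ₜ[ℂ] k : H ⊗[ℂ] K) : Completion (H ⊗[ℂ] K))

/-- The operator `S ⊗ T` on the Hilbert space tensor product. -/
def opTensor (S : H →L[ℂ] H) (T : K →L[ℂ] K) : HilbertTensor H K →L[ℂ] HilbertTensor H K :=
  (TensorProduct.mapL S T).completion

theorem opTensor_htmul (S : H →L[ℂ] H) (T : K →L[ℂ] K) (h : H) (k : K) :
    opTensor S T (htmul h k) = htmul (S h) (T k) :=
  ContinuousLinearMap.completion_apply_coe _ _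

theorem hilbertTensor_induction {C : HilbertTensor H K → Prop} (hc : IsClosed {x | C x})
    (h0 : C 0) (ht : ∀ h k, C (htmul h k)) (ha : ∀ x y, C x → C y → C (x + y))
    (x : HilbertTensor H K) : C x := by
  induction x using Completion.induction_on with
  | hp => exact hc
  | ih x =>
    induction x using TensorProduct.induction_on with
    | zero => rw [Completion.coe_zero]; exact h0
    | tmul h k => exact ht h k
    | add x y hx hy => rw [Completion.coe_add]; exact ha _ _ hx hy

theorem hilbertTensor_ext {S T : HilbertTensor H K →L[ℂ] HilbertTensor H K}
    (h : ∀ u v, S (htmul u v) = T (htmul u v)) : S = T := by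
  ext x
  induction x using hilbertTensor_induction with
  | hc => exact isClosed_eq S.continuous T.continuous
  | h0 => simp
  | ht u v => exact h u v
  | ha x y hx hy => rw [map_add, map_add, hx, hy]

theorem inner_htmul (h h' : H) (k k' : K) :
    inner ℂ (htmul h k) (htmul h' k') = inner ℂ h h' * inner ℂ k k' :=
  (Completion.inner_coe (h ⊗ₜ[ℂ] k) (h' ⊗ₜ[ℂ] k')).trans (TensorProduct.inner_tmul ..)

theorem norm_htmul (h : H) (k : K) : ‖htmul h k‖ = ‖h‖ * ‖k‖ :=
  (Completion.norm_coe (h ⊗ₜ[ℂ] k)).trans (TensorProduct.norm_tmul ..)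

theorem htmul_add_left (h h' : H) (k : K) : htmul (h + h') k = htmul h k + htmul h' k := by
  rw [htmul, TensorProduct.add_tmul, Completion.coe_add]; rfl

theorem htmul_add_right (h : H) (k k' : K) : htmul h (k + k') = htmul h k + htmul h k' := by
  rw [htmul, TensorProduct.tmul_add, Completion.coe_add]; rfl

theorem htmul_smul_left (c : ℂ) (h : H) (k : K) : htmul (c • h) k = c • htmul h k := by
  rw [htmul, ← TensorProduct.smul_tmul', Completion.coe_smul]; rfl

theorem htmul_smul_right (c : ℂ) (h : H) (k : K) : htmul h (c • k) = c • htmul h k := by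
  rw [htmul, TensorProduct.tmul_smul, Completion.coe_smul]; rfl

theorem norm_opTensor_le (S : H →L[ℂ] H) (T : K →L[ℂ] K) : ‖opTensor S T‖ ≤ ‖S‖ * ‖T‖ := by
  refine ContinuousLinearMap.opNorm_le_bound _ (by positivity) fun x => ?_
  induction x using Completion.induction_on with
  | hp => exact isClosed_le (by fun_prop) (by fun_prop)
  | ih x =>
    have e1 : ‖opTensor S T (x : Completion (H ⊗[ℂ] K))‖ = ‖TensorProduct.mapL S T x‖ :=
      (congrArg norm (ContinuousLinearMap.completion_apply_coe _ _)).trans (Completion.norm_coe _)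
    have e2 : ‖(show HilbertTensor H K from (x : Completion (H ⊗[ℂ] K)))‖ = ‖x‖ :=
      Completion.norm_coe _
    refine e1.trans_le (le_of_le_of_eq ?_ (congrArg (‖S‖ * ‖T‖ * ·) e2.symm))
    exact ((TensorProduct.mapL S T).le_opNorm x).trans
      (mul_le_mul_of_nonneg_right (TensorProduct.norm_mapL_le S T) (norm_nonneg _))

theorem opTensor_mul (S S' : H →L[ℂ] H) (T T' : K →L[ℂ] K) :
    opTensor S T * opTensor S' T' = opTensor (S * S') (T * T') :=
  hilbertTensor_ext fun u v => by
    rw [mul_apply_eq_comp, opTensor_htmul, opTensor_htmul, opTensor_htmul]; rfl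

theorem opTensor_one : opTensor (1 : H →L[ℂ] H) (1 : K →L[ℂ] K) = 1 :=
  hilbertTensor_ext fun u v => by rw [opTensor_htmul]; rfl

variable [CompleteSpace H] [CompleteSpace K]

theorem star_opTensor (S : H →L[ℂ] H) (T : K →L[ℂ] K) :
    star (opTensor S T) = opTensor (star S) (star T) := by
  rw [ContinuousLinearMap.star_eq_adjoint]
  symm
  rw [ContinuousLinearMap.eq_adjoint_iff]
  intro x y
  induction x using hilbertTensor_induction with
  | hc => exact isClosed_eq (by fun_prop) (by fun_prop)
  | h0 => simp
  | ha x y hx hy => rw [map_add, inner_add_left, inner_add_left, hx, hy]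
  | ht u v =>
    induction y using hilbertTensor_induction with
    | hc => exact isClosed_eq (by fun_prop) (by fun_prop)
    | h0 => simp
    | ha x y hx hy => rw [map_add, inner_add_right, inner_add_right, hx, hy]
    | ht u' v' =>
      rw [opTensor_htmul, opTensor_htmul, inner_htmul, inner_htmul,
        ContinuousLinearMap.star_eq_adjoint, ContinuousLinearMap.star_eq_adjoint,
        ContinuousLinearMap.adjoint_inner_left, ContinuousLinearMap.adjoint_inner_left]

variable (π : A →⋆ₐ[ℂ] (H →L[ℂ] H)) (ρ : B →⋆ₐ[ℂ] (K →L[ℂ] K))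

/-- The representation `π ⊗ 1`. -/
def tensorRepLeft (K : Type*) [NormedAddCommGroup K] [InnerProductSpace ℂ K] :
    A →ₐ[ℂ] (HilbertTensor H K →L[ℂ] HilbertTensor H K) :=
  AlgHom.ofLinearMap
    { toFun := fun a => opTensor (π a) 1
      map_add' := fun a b => hilbertTensor_ext fun u v => by
        rw [add_apply, opTensor_htmul, opTensor_htmul, opTensor_htmul, map_add, add_apply,
          htmul_add_left]
      map_smul' := fun c a => hilbertTensor_ext fun u v => by
        rw [RingHom.id_apply, smul_apply, opTensor_htmul, opTensor_htmul, map_smul, smul_apply,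
          htmul_smul_left] }
    (by change opTensor (π 1) 1 = 1; rw [map_one, opTensor_one])
    (fun a b => by
      change opTensor (π (a * b)) 1 = opTensor (π a) 1 * opTensor (π b) 1
      rw [opTensor_mul, map_mul, mul_one])

/-- The representation `1 ⊗ ρ`. -/
def tensorRepRight (H : Type*) [NormedAddCommGroup H] [InnerProductSpace ℂ H] :
    B →ₐ[ℂ] (HilbertTensor H K →L[ℂ] HilbertTensor H K) :=
  AlgHom.ofLinearMap
    { toFun := fun b => opTensor 1 (ρ b)
      map_add' := fun a b => hilbertTensor_ext fun u v => by
        rw [add_apply, opTensor_htmul, opTensor_htmul, opTensor_htmul, map_add, add_apply,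
          htmul_add_right]
      map_smul' := fun c a => hilbertTensor_ext fun u v => by
        rw [RingHom.id_apply, smul_apply, opTensor_htmul, opTensor_htmul, map_smul, smul_apply,
          htmul_smul_right] }
    (by change opTensor 1 (ρ 1) = 1; rw [map_one, opTensor_one])
    (fun a b => by
      change opTensor 1 (ρ (a * b)) = opTensor 1 (ρ a) * opTensor 1 (ρ b)
      rw [opTensor_mul, map_mul, mul_one])

theorem tensorRep_commute (a : A) (b : B) :
    Commute (tensorRepLeft π K a) (tensorRepRight ρ H b) := by
  change opTensor (π a) 1 * opTensor 1 (ρ b) = opTensor 1 (ρ b) * opTensor (π a) 1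
  rw [opTensor_mul, opTensor_mul, one_mul, mul_one, one_mul, mul_one]

theorem tensorRep_lift_tmul (a : A) (b : B) :
    Algebra.TensorProduct.lift (tensorRepLeft π K) (tensorRepRight ρ H) (tensorRep_commute π ρ)
      (a ⊗ₜ b) = opTensor (π a) (ρ b) := by
  rw [Algebra.TensorProduct.lift_tmul]
  change opTensor (π a) 1 * opTensor 1 (ρ b) = opTensor (π a) (ρ b)
  rw [opTensor_mul, mul_one, one_mul]

/-- The tensor product `π ⊗ ρ` of two representations, on the Hilbert space tensor product. -/
def tensorRep : A ⊗[ℂ] B →⋆ₐ[ℂ] (HilbertTensor H K →L[ℂ] HilbertTensor H K) where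
  __ := Algebra.TensorProduct.lift (tensorRepLeft π K) (tensorRepRight ρ H)
    (tensorRep_commute π ρ)
  map_star' x := by
    set φ := Algebra.TensorProduct.lift (tensorRepLeft π K) (tensorRepRight ρ H)
      (tensorRep_commute π ρ) with hφ
    change φ (star x) = star (φ x)
    induction x using TensorProduct.induction_on with
    | zero => rw [star_zero, map_zero, star_zero]
    | tmul a b =>
      rw [TensorProduct.star_tmul, hφ, tensorRep_lift_tmul, tensorRep_lift_tmul, star_opTensor,
        map_star, map_star]
    | add x y hx hy => rw [star_add, map_add, map_add, hx, hy, star_add]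

theorem tensorRep_tmul (a : A) (b : B) :
    tensorRep π ρ (a ⊗ₜ b) = opTensor (π a) (ρ b) :=
  tensorRep_lift_tmul π ρ a b

open scoped CStarAlgebra in
theorem norm_tensorRep_tmul_le (a : A) (b : B) : ‖tensorRep π ρ (a ⊗ₜ b)‖ ≤ ‖a‖ * ‖b‖ := by
  rw [tensorRep_tmul]
  refine (norm_opTensor_le _ _).trans ?_
  exact mul_le_mul (NonUnitalStarAlgHom.norm_apply_le π a)
    (NonUnitalStarAlgHom.norm_apply_le ρ b) (norm_nonneg _) (norm_nonneg _)

theorem norm_inner_tensorRep_le (x : A ⊗[ℂ] B) (h : H) (k : K) :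
    ‖inner ℂ (htmul h k) (tensorRep π ρ x (htmul h k))‖ ≤
      ‖h‖ ^ 2 * ‖tensorRep π ρ x‖ * ‖k‖ ^ 2 := by
  refine (norm_inner_le_norm _ _).trans ?_
  have h1 := (tensorRep π ρ x).le_opNorm (htmul h k)
  rw [norm_htmul] at h1 ⊢
  calc ‖h‖ * ‖k‖ * ‖tensorRep π ρ x (htmul h k)‖
      ≤ ‖h‖ * ‖k‖ * (‖tensorRep π ρ x‖ * (‖h‖ * ‖k‖)) :=
        mul_le_mul_of_nonneg_left h1 (by positivity)
    _ = _ := by ring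

end spatial

section minTensor

variable {A B : Type*} [CStarAlgebra A] [PartialOrder A] [StarOrderedRing A]
  [CStarAlgebra B] [PartialOrder B] [StarOrderedRing B]

/-- The C⋆-seminorm `x ↦ ‖(π_f ⊗ π_g)(x)‖` of the GNS representations of `f` and `g`. -/
def gnsTensorSeminorm (f : A →ₚ[ℂ] ℂ) (g : B →ₚ[ℂ] ℂ) : CStarSeminorm (A ⊗[ℂ] B) :=
  CStarSeminorm.ofHom (B := HilbertTensor f.GNS g.GNS →L[ℂ] HilbertTensor f.GNS g.GNS)
    (tensorRep f.gnsStarAlgHom g.gnsStarAlgHom)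

theorem gnsTensor_bounded (x : A ⊗[ℂ] B) : ∃ C : ℝ,
    ∀ p ∈ {p | ∃ (f : A →ₚ[ℂ] ℂ) (g : B →ₚ[ℂ] ℂ), p = gnsTensorSeminorm f g}, p x ≤ C := by
  induction x using TensorProduct.induction_on with
  | zero => exact ⟨0, fun p _ => by simp⟩
  | tmul a b =>
    refine ⟨‖a‖ * ‖b‖, ?_⟩
    rintro _ ⟨f, g, rfl⟩
    exact norm_tensorRep_tmul_le f.gnsStarAlgHom g.gnsStarAlgHom a b
  | add x y hx hy =>
    obtain ⟨C, hC⟩ := hx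
    obtain ⟨D, hD⟩ := hy
    exact ⟨C + D, fun p hp =>
      (map_add_le_add p.toSeminorm x y).trans (add_le_add (hC p hp) (hD p hp))⟩

variable (A B) in
/-- The minimal (spatial) C⋆-norm on the algebraic tensor product: the norm of `x` in the tensor
product of the universal representations, that is, the supremum of `‖(π_f ⊗ π_g)(x)‖` over all
positive functionals `f`, `g`. -/
def minSeminorm : CStarSeminorm (A ⊗[ℂ] B) :=
  CStarSeminorm.sup {p | ∃ (f : A →ₚ[ℂ] ℂ) (g : B →ₚ[ℂ] ℂ), p = gnsTensorSeminorm f g}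
    gnsTensor_bounded

variable (A B) in
/-- The minimal tensor product of two unital C⋆-algebras. -/
def MinTensor : Type _ := (minSeminorm A B).Compl

instance : CStarAlgebra (MinTensor A B) := inferInstanceAs (CStarAlgebra (minSeminorm A B).Compl)

variable (A B) in
/-- The inclusion of the algebraic tensor product. -/
def MinTensor.ofAlg : A ⊗[ℂ] B →⋆ₐ[ℂ] MinTensor A B := (minSeminorm A B).ofAlg

/-- The elementary tensor `a ⊗ b`. -/
def MinTensor.tmul (a : A) (b : B) : MinTensor A B := MinTensor.ofAlg A B (a ⊗ₜ b)

/-! #### Slice maps -/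

/-- The complexification of a real functional that is nonnegative on positive elements. -/
def complexify (h : B →L[ℝ] ℝ) (hh : ∀ x, 0 ≤ x → 0 ≤ h x) : B →ₚ[ℂ] ℂ :=
  PositiveLinearMap.mk₀
    { toFun := fun x => (h (realPart x : B) : ℂ) + Complex.I * (h (imaginaryPart x : B) : ℂ)
      map_add' := fun x y => by
        have h1 : (realPart (x + y) : B) = realPart x + realPart y := by rw [map_add]; rfl
        have h2 : (imaginaryPart (x + y) : B) = imaginaryPart x + imaginaryPart y := by
          rw [map_add]; rfl
        rw [h1, h2, map_add, map_add]
        push_cast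
        ring
      map_smul' := fun c x => by
        have h1 : (realPart (c • x) : B) = c.re • (realPart x : B) - c.im • (imaginaryPart x : B) := by
          rw [realPart_smul]; rfl
        have h2 : (imaginaryPart (c • x) : B) =
            c.re • (imaginaryPart x : B) + c.im • (realPart x : B) := by
          rw [imaginaryPart_smul]; rfl
        rw [h1, h2]
        simp only [map_sub, map_add, map_smul, smul_eq_mul, RingHom.id_apply]
        conv_rhs => rw [← Complex.re_add_im c]
        push_cast
        ring_nf
        simp only [Complex.I_sq]
        ring }
    (fun x hx => by
      have h1 : (realPart x : B) = x := (IsSelfAdjoint.of_nonneg hx).coe_realPart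
      have h2 : imaginaryPart x = 0 := (IsSelfAdjoint.of_nonneg hx).imaginaryPart
      change (0 : ℂ) ≤ (h (realPart x : B) : ℂ) + Complex.I * (h (imaginaryPart x : B) : ℂ)
      rw [h1, h2]
      simpa using hh x hx)

theorem complexify_apply_of_isSelfAdjoint (h : B →L[ℝ] ℝ) (hh : ∀ x, 0 ≤ x → 0 ≤ h x) {x : B}
    (hx : IsSelfAdjoint x) : complexify h hh x = h x := by
  have h1 : (realPart x : B) = x := hx.coe_realPart
  have h2 : imaginaryPart x = 0 := hx.imaginaryPart
  change (h (realPart x : B) : ℂ) + Complex.I * (h (imaginaryPart x : B) : ℂ) = _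
  rw [h1, h2]
  simp

theorem nonneg_of_forall_posFunctional {b : B} (hb : IsSelfAdjoint b)
    (h : ∀ g : B →ₚ[ℂ] ℂ, 0 ≤ (g b).re) : 0 ≤ b := by
  by_contra hn
  obtain ⟨f, hf, hf0⟩ := ProperCone.hyperplane_separation_point
    (ProperCone.positive ℝ B) (x₀ := b) (by simpa using hn)
  have hf' : ∀ x : B, 0 ≤ x → 0 ≤ f x := fun x hx => hf x (by simpa using hx)
  have := h (complexify f hf')
  rw [complexify_apply_of_isSelfAdjoint f hf' hb] at this
  simp at this
  linarith

theorem norm_le_of_forall_posFunctional_sa {b : B} (hb : IsSelfAdjoint b) {M : ℝ} (hM : 0 ≤ M)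
    (h : ∀ g : B →ₚ[ℂ] ℂ, |(g b).re| ≤ M * (g 1).re) : ‖b‖ ≤ M := by
  have hsm : IsSelfAdjoint (algebraMap ℝ B M) := IsSelfAdjoint.algebraMap B (IsSelfAdjoint.all M)
  have hg : ∀ g : B →ₚ[ℂ] ℂ, (g (algebraMap ℝ B M)).re = M * (g 1).re := fun g => by
    rw [Algebra.algebraMap_eq_smul_one, ← Complex.coe_smul, map_smul]
    simp
  have h1 : 0 ≤ algebraMap ℝ B M - b := by
    refine nonneg_of_forall_posFunctional (hsm.sub hb) fun g => ?_
    rw [map_sub, Complex.sub_re, hg]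
    linarith [(abs_le.1 (h g)).2]
  have h2 : 0 ≤ b - (-algebraMap ℝ B M) := by
    refine nonneg_of_forall_posFunctional (hb.sub hsm.neg) fun g => ?_
    rw [sub_neg_eq_add, map_add, Complex.add_re, hg]
    linarith [(abs_le.1 (h g)).1]
  by_cases hB : Nontrivial B
  · have h3 : ∀ r ∈ spectrum ℝ b, r ≤ M := (le_algebraMap_iff_spectrum_le hb).1 (sub_nonneg.1 h1)
    have h4 : ∀ r ∈ spectrum ℝ b, -M ≤ r :=
      (algebraMap_le_iff_le_spectrum hb).1 (by rw [map_neg]; exact sub_nonneg.1 h2)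
    rcases CStarAlgebra.norm_or_neg_norm_mem_spectrum hb with h5 | h5
    · exact h3 _ h5
    · linarith [h4 _ h5]
  · rw [not_nontrivial_iff_subsingleton] at hB
    rw [Subsingleton.elim b 0, norm_zero]; exact hM

/-- Positive functionals detect the norm up to the factor `2`. -/
theorem norm_le_of_forall_posFunctional {b : B} {M : ℝ} (hM : 0 ≤ M)
    (h : ∀ g : B →ₚ[ℂ] ℂ, ‖g b‖ ≤ M * (g 1).re) : ‖b‖ ≤ 2 * M := by
  have hre : ∀ g : B →ₚ[ℂ] ℂ, ∀ x : B, IsSelfAdjoint x → (g x).im = 0 := fun g x hx => by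
    have : star (g x) = g x := by rw [← map_star g, hx.star_eq]
    exact Complex.conj_eq_iff_im.1 this
  have key : ∀ g : B →ₚ[ℂ] ℂ, g b = g (realPart b : B) + Complex.I * g (imaginaryPart b : B) :=
    fun g => by
      conv_lhs => rw [← realPart_add_I_smul_imaginaryPart b]
      rw [map_add, map_smul, smul_eq_mul]
  have h1 : ‖(realPart b : B)‖ ≤ M := by
    refine norm_le_of_forall_posFunctional_sa (realPart b).2 hM fun g => ?_
    have e : (g b).re = (g (realPart b : B)).re := by
      rw [key g]; simp [hre g _ (imaginaryPart b).2]
    rw [← e]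
    exact (Complex.abs_re_le_norm _).trans (h g)
  have h2 : ‖(imaginaryPart b : B)‖ ≤ M := by
    refine norm_le_of_forall_posFunctional_sa (imaginaryPart b).2 hM fun g => ?_
    have e : (g b).im = (g (imaginaryPart b : B)).re := by
      rw [key g]; simp [hre g _ (realPart b).2]
    rw [← e]
    exact (Complex.abs_im_le_norm _).trans (h g)
  calc ‖b‖ = ‖(realPart b : B) + Complex.I • (imaginaryPart b : B)‖ := by
        rw [realPart_add_I_smul_imaginaryPart]
    _ ≤ ‖(realPart b : B)‖ + ‖Complex.I • (imaginaryPart b : B)‖ := norm_add_le _ _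
    _ ≤ 2 * M := by rw [norm_smul, Complex.norm_I]; linarith

/-- The algebraic slice map `a ⊗ b ↦ τ(a) b`. -/
def sliceAlg (τ : A →ₚ[ℂ] ℂ) : A ⊗[ℂ] B →ₗ[ℂ] B :=
  (TensorProduct.lid ℂ B).toLinearMap ∘ₗ TensorProduct.map τ.toLinearMap LinearMap.id

theorem sliceAlg_tmul (τ : A →ₚ[ℂ] ℂ) (a : A) (b : B) :
    sliceAlg τ (a ⊗ₜ[ℂ] b) = τ a • b := by
  simp [sliceAlg]

/-- The canonical cyclic vector of the GNS space. -/
def gnsVec (f : A →ₚ[ℂ] ℂ) : f.GNS := ((f.toPreGNS 1 : f.PreGNS) : f.GNS)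

theorem gns_inner (f : A →ₚ[ℂ] ℂ) (a : A) :
    inner ℂ (gnsVec f) (f.gnsStarAlgHom a (gnsVec f)) = f a := by
  change inner ℂ ((f.toPreGNS 1 : f.PreGNS) : f.GNS)
    (f.gnsNonUnitalStarAlgHom a ((f.toPreGNS 1 : f.PreGNS) : f.GNS)) = f a
  rw [PositiveLinearMap.gnsNonUnitalStarAlgHom_apply_coe, UniformSpace.Completion.inner_coe,
    PositiveLinearMap.preGNS_inner_def]
  simp

theorem norm_gnsVec_sq (f : A →ₚ[ℂ] ℂ) : ‖gnsVec f‖ ^ 2 = (f 1).re := by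
  have := gns_inner f 1
  rw [map_one, one_apply_eq_self, inner_self_eq_norm_sq_to_K] at this
  rw [← this]
  norm_cast

theorem norm_sliceAlg_le (τ : A →ₚ[ℂ] ℂ) :
    ∃ C : ℝ, ∀ x : A ⊗[ℂ] B, ‖sliceAlg τ x‖ ≤ C * minSeminorm A B x := by
  refine ⟨2 * (τ 1).re, fun x => ?_⟩
  have hτ : 0 ≤ (τ 1).re := by rw [← norm_gnsVec_sq]; positivity
  rw [mul_assoc]
  refine norm_le_of_forall_posFunctional (mul_nonneg hτ ((minSeminorm A B).nonneg x)) fun g => ?_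
  have key : g (sliceAlg τ x) = inner ℂ (htmul (gnsVec τ) (gnsVec g))
      (tensorRep τ.gnsStarAlgHom g.gnsStarAlgHom x (htmul (gnsVec τ) (gnsVec g))) := by
    induction x using TensorProduct.induction_on with
    | zero => simp
    | add x y hx hy => simp [hx, hy]
    | tmul a b =>
      rw [tensorRep_tmul, opTensor_htmul, inner_htmul, gns_inner, gns_inner,
        sliceAlg_tmul, map_smul, smul_eq_mul]
  rw [key]
  refine (norm_inner_tensorRep_le τ.gnsStarAlgHom g.gnsStarAlgHom x _ _).trans ?_
  rw [norm_gnsVec_sq, norm_gnsVec_sq]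
  have h2 : gnsTensorSeminorm τ g x ≤ minSeminorm A B x :=
    CStarSeminorm.le_sup (p := gnsTensorSeminorm τ g) gnsTensor_bounded ⟨τ, g, rfl⟩ x
  have hg : 0 ≤ (g 1).re := by rw [← norm_gnsVec_sq]; positivity
  exact mul_le_mul_of_nonneg_right (mul_le_mul_of_nonneg_left h2 hτ) hg

/-- The slice map `τ ⊗ id : A ⊗ B → B` on the minimal tensor product: the continuous linear
extension of `a ⊗ b ↦ τ(a) b`. -/
def slice (τ : A →ₚ[ℂ] ℂ) : MinTensor A B →L[ℂ] B :=
  (minSeminorm A B).extendL (sliceAlg τ) (norm_sliceAlg_le τ)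

theorem slice_tmul (τ : A →ₚ[ℂ] ℂ) (a : A) (b : B) :
    slice τ (MinTensor.tmul a b) = τ a • b :=
  ((minSeminorm A B).extendL_ofAlg _ _ _).trans (sliceAlg_tmul τ a b)

end minTensor

/-! ### Graph C⋆-algebras -/

theorem proj_mul_eq_zero {A ι : Type*} [CStarAlgebra A] [Fintype ι] {r : ι → A}
    (hsa : ∀ i, star (r i) = r i) (hid : ∀ i, r i * r i = r i) (hsum : ∑ i, r i = 1)
    {i j : ι} (hij : i ≠ j) : r i * r j = 0 := by
  classical
  let _ := CStarAlgebra.spectralOrder A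
  have := CStarAlgebra.spectralOrderedRing A
  have h1 : ∑ k, star (r k * r j) * (r k * r j) = r j := by
    have : ∀ k, star (r k * r j) * (r k * r j) = r j * r k * r j := fun k => by
      rw [star_mul, hsa, hsa, mul_assoc, ← mul_assoc (r k), hid, mul_assoc]
    simp_rw [this]
    rw [← Finset.sum_mul, ← Finset.mul_sum, hsum, mul_one, hid]
  rw [← Finset.add_sum_erase _ _ (Finset.mem_univ j), star_mul, hsa, hid, hid] at h1
  have h2 := (Finset.sum_eq_zero_iff_of_nonneg fun k _ => star_mul_self_nonneg (r k * r j)).1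
    (add_eq_left.1 h1) i (by simp [hij])
  exact (CStarRing.star_mul_self_eq_zero_iff _).1 h2

theorem mul_star_mul_of_idem {A : Type*} [CStarAlgebra A] {t p : A} (h : star t * t = p)
    (hp : p * p = p) : t * star t * t = t := by
  have hs : star p = p := by rw [← h, star_mul, star_star]
  have : star (t * p - t) * (t * p - t) = 0 := by
    have e1 : star t * (t * p) = p := by rw [← mul_assoc, h, hp]
    rw [star_sub, star_mul, hs, mul_sub, sub_mul, sub_mul, mul_assoc p, mul_assoc p, e1, h, hp]
    simp
  rw [mul_assoc, h]
  exact sub_eq_zero.1 ((CStarRing.star_mul_self_eq_zero_iff _).1 this)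

theorem CStarSeminorm.le_one_of_proj {F : Type*} [Ring F] [StarRing F] [Algebra ℂ F]
    (p : CStarSeminorm F) {x : F} (h1 : p (star x - x) = 0) (h2 : p (x * x - x) = 0) :
    p x ≤ 1 := by
  have h3 : p (star x * x) ≤ p x := by
    have e : star x * x = (star x - x) * x + ((x * x - x) + x) := by noncomm_ring
    rw [e]
    have a1 := map_add_le_add p.toSeminorm ((star x - x) * x) ((x * x - x) + x)
    have a2 := map_add_le_add p.toSeminorm (x * x - x) x
    have a3 := p.mul_le (star x - x) x
    rw [h1, zero_mul] at a3
    linarith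
  nlinarith [p.sq_le x, p.nonneg x]

section graph

variable {V : Type*} (Γ : Digraph V)

/-- The edges of a digraph, as pairs (source, target). -/
abbrev Digraph.Edge : Type _ := {e : V × V // Γ.Adj e.1 e.2}

variable {Γ}

/-- The source of an edge. -/
abbrev Digraph.Edge.src (e : Γ.Edge) : V := e.1.1
/-- The target of an edge. -/
abbrev Digraph.Edge.tgt (e : Γ.Edge) : V := e.1.2

variable (Γ) [Fintype V] [DecidableEq V] [DecidableRel Γ.Adj]

/-- Cuntz–Krieger families: the `p v` are mutually orthogonal projections with sum `1`, the `S e`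
are partial isometries, `S_e⋆ S_e = p_{t(e)}`, and `p_v = ∑_{s(e) = v} S_e S_e⋆`. -/
structure IsCKFamily {A : Type*} [Ring A] [StarRing A] (p : V → A) (S : Γ.Edge → A) : Prop where
  star_p : ∀ v, star (p v) = p v
  p_mul : ∀ v, p v * p v = p v
  p_orth : ∀ v w, v ≠ w → p v * p w = 0
  p_sum : ∑ v, p v = 1
  pisom : ∀ e, S e * star (S e) * S e = S e
  tgt : ∀ e, star (S e) * S e = p e.tgt
  src : ∀ v, ∑ e with e.src = v, S e * star (S e) = p v

/-- The elements of a ⋆-algebra that must vanish for `p`, `S` to be a Cuntz–Krieger family. -/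
inductive CKRel {A : Type*} [Ring A] [StarRing A] (p : V → A) (S : Γ.Edge → A) : A → Prop
  | star_p (v : V) : CKRel p S (star (p v) - p v)
  | p_mul (v : V) : CKRel p S (p v * p v - p v)
  | p_orth (v w : V) (h : v ≠ w) : CKRel p S (p v * p w)
  | p_sum : CKRel p S (∑ v, p v - 1)
  | pisom (e : Γ.Edge) : CKRel p S (S e * star (S e) * S e - S e)
  | tgt (e : Γ.Edge) : CKRel p S (star (S e) * S e - p e.tgt)
  | src (v : V) : CKRel p S (∑ e with e.src = v, S e * star (S e) - p v)

/-- The defining relations of the graph C⋆-algebra, on the generators `p_v` and `S_e`. -/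
def ckRelations : Set (FreeStarAlg (V ⊕ Γ.Edge)) :=
  {r | CKRel Γ (fun v => FreeStarAlg.gen (.inl v)) (fun e => FreeStarAlg.gen (.inr e)) r}

theorem boundedRel_ckRelations : BoundedRel (ckRelations Γ) := by
  have hp : ∀ v, ∀ p ∈ admissible (ckRelations Γ), p (FreeStarAlg.gen (.inl v)) ≤ 1 :=
    fun v p hp => p.le_one_of_proj (hp _ (CKRel.star_p v)) (hp _ (CKRel.p_mul v))
  rintro (v | e)
  · exact ⟨1, hp v⟩
  · refine ⟨1, fun p h => ?_⟩
    have h1 := hp e.tgt p h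
    have h2 := h _ (CKRel.tgt e)
    have h3 := map_add_le_add p.toSeminorm
      (star (FreeStarAlg.gen (.inr e)) * FreeStarAlg.gen (.inr e) - FreeStarAlg.gen (.inl e.tgt))
      (FreeStarAlg.gen (.inl e.tgt))
    rw [sub_add_cancel] at h3
    have h4 := p.sq_le (FreeStarAlg.gen (.inr e))
    nlinarith [p.nonneg (FreeStarAlg.gen (.inr e))]

/-- The graph C⋆-algebra `C⋆(Γ)`. -/
abbrev CGraph : Type _ := UnivCStar (ckRelations Γ) (boundedRel_ckRelations Γ)

namespace CGraph

variable {Γ}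

/-- The vertex projections. -/
def p (v : V) : CGraph Γ := UnivCStar.gen (.inl v)

/-- The edge partial isometries. -/
def S (e : Γ.Edge) : CGraph Γ := UnivCStar.gen (.inr e)

theorem isCKFamily : IsCKFamily Γ (p : V → CGraph Γ) S := by
  have key : ∀ r ∈ ckRelations Γ,
      (UnivCStar.ofFree r : CGraph Γ) = 0 := fun r hr => UnivCStar.ofFree_rel hr
  refine ⟨fun v => ?_, fun v => ?_, fun v w h => ?_, ?_, fun e => ?_, fun e => ?_, fun v => ?_⟩
  · have := key _ (CKRel.star_p v)
    rw [map_sub, map_star] at this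
    exact sub_eq_zero.1 this
  · have := key _ (CKRel.p_mul v)
    rw [map_sub, map_mul] at this
    exact sub_eq_zero.1 this
  · have := key _ (CKRel.p_orth v w h)
    rw [map_mul] at this
    exact this
  · have := key _ CKRel.p_sum
    rw [map_sub, map_sum, map_one] at this
    exact sub_eq_zero.1 this
  · have := key _ (CKRel.pisom e)
    rw [map_sub, map_mul, map_mul, map_star] at this
    exact sub_eq_zero.1 this
  · have := key _ (CKRel.tgt e)
    rw [map_sub, map_mul, map_star] at this
    exact sub_eq_zero.1 this
  · have := key _ (CKRel.src v)
    simp only [map_sub, map_sum, map_mul, map_star] at this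
    exact sub_eq_zero.1 this

/-- The universal property of `C⋆(Γ)`. -/
def lift {B : Type*} [CStarAlgebra B] (P : V → B) (T : Γ.Edge → B) (h : IsCKFamily Γ P T) :
    CGraph Γ →⋆ₐ[ℂ] B :=
  UnivCStar.lift (Sum.elim P T) fun r hr => by
    have hP : ∀ v, FreeStarAlg.lift (Sum.elim P T) (FreeStarAlg.gen (.inl v)) = P v :=
      fun v => FreeStarAlg.lift_gen _ _
    have hT : ∀ e, FreeStarAlg.lift (Sum.elim P T) (FreeStarAlg.gen (.inr e)) = T e :=
      fun e => FreeStarAlg.lift_gen _ _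
    cases hr with
    | star_p v => rw [map_sub, map_star, hP, h.star_p, sub_self]
    | p_mul v => rw [map_sub, map_mul, hP, h.p_mul, sub_self]
    | p_orth v w hvw => rw [map_mul, hP, hP, h.p_orth v w hvw]
    | p_sum => rw [map_sub, map_sum, map_one]; simp_rw [hP]; rw [h.p_sum, sub_self]
    | pisom e => rw [map_sub, map_mul, map_mul, map_star, hT, h.pisom, sub_self]
    | tgt e => rw [map_sub, map_mul, map_star, hT, hP, h.tgt, sub_self]
    | src v => simp only [map_sub, map_sum, map_mul, map_star, hT, hP]; rw [h.src, sub_self]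

theorem lift_p {B : Type*} [CStarAlgebra B] (P : V → B) (T : Γ.Edge → B)
    (h : IsCKFamily Γ P T) (v : V) : lift P T h (p v) = P v :=
  UnivCStar.lift_gen _ _ _

theorem lift_S {B : Type*} [CStarAlgebra B] (P : V → B) (T : Γ.Edge → B)
    (h : IsCKFamily Γ P T) (e : Γ.Edge) : lift P T h (S e) = T e :=
  UnivCStar.lift_gen _ _ _

end CGraph

/-! ### Quantum automorphism groups -/

/-- The entries of the adjacency matrix. -/
def adjEntry (i j : V) : ℂ := if Γ.Adj i j then 1 else 0

/-- Magic unitaries commuting with the adjacency matrix `D`: the `u i j` are projections, all rows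
and columns sum to `1`, and `u D = D u`. -/
structure IsMagic {B : Type*} [Ring B] [StarRing B] [Algebra ℂ B] (u : V → V → B) : Prop where
  star_u : ∀ i j, star (u i j) = u i j
  u_mul : ∀ i j, u i j * u i j = u i j
  row : ∀ i, ∑ j, u i j = 1
  col : ∀ j, ∑ i, u i j = 1
  comm : ∀ i j, ∑ k, adjEntry Γ k j • u i k = ∑ k, adjEntry Γ i k • u k j

/-- The elements that must vanish for `u` to be a magic unitary commuting with the adjacency
matrix. -/
inductive MagicRel {B : Type*} [Ring B] [StarRing B] [Algebra ℂ B] (u : V → V → B) : B → Prop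
  | star_u (i j : V) : MagicRel u (star (u i j) - u i j)
  | u_mul (i j : V) : MagicRel u (u i j * u i j - u i j)
  | row (i : V) : MagicRel u (∑ j, u i j - 1)
  | col (j : V) : MagicRel u (∑ i, u i j - 1)
  | comm (i j : V) :
      MagicRel u (∑ k, adjEntry Γ k j • u i k - ∑ k, adjEntry Γ i k • u k j)

/-- The defining relations of the quantum automorphism group, on the generators `u_{ij}`. -/
def magicRelations : Set (FreeStarAlg (V × V)) :=
  {r | MagicRel Γ (fun i j => FreeStarAlg.gen (i, j)) r}

theorem boundedRel_magicRelations : BoundedRel (magicRelations Γ) := fun x =>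
  ⟨1, fun p h => p.le_one_of_proj (h _ (MagicRel.star_u x.1 x.2)) (h _ (MagicRel.u_mul x.1 x.2))⟩

/-- The C⋆-algebra of the quantum automorphism group of `Γ` in the sense of Banica. -/
abbrev QAut : Type _ := UnivCStar (magicRelations Γ) (boundedRel_magicRelations Γ)

namespace QAut

variable {Γ}

/-- The generators of the quantum automorphism group. -/
def u (i j : V) : QAut Γ := UnivCStar.gen (i, j)

theorem isMagic : IsMagic Γ (u : V → V → QAut Γ) := by
  have key : ∀ r ∈ magicRelations Γ,
      (UnivCStar.ofFree r : QAut Γ) = 0 := fun r hr => UnivCStar.ofFree_rel hr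
  refine ⟨fun i j => ?_, fun i j => ?_, fun i => ?_, fun j => ?_, fun i j => ?_⟩
  · have := key _ (MagicRel.star_u i j)
    rw [map_sub, map_star] at this
    exact sub_eq_zero.1 this
  · have := key _ (MagicRel.u_mul i j)
    rw [map_sub, map_mul] at this
    exact sub_eq_zero.1 this
  · have := key _ (MagicRel.row i)
    rw [map_sub, map_sum, map_one] at this
    exact sub_eq_zero.1 this
  · have := key _ (MagicRel.col j)
    rw [map_sub, map_sum, map_one] at this
    exact sub_eq_zero.1 this
  · have := key _ (MagicRel.comm i j)
    simp only [map_sub, map_sum, map_smul] at this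
    exact sub_eq_zero.1 this

end QAut

end graph

/-! ### The action of the quantum automorphism group -/

section families

variable {V : Type*} {Γ : Digraph V} [Fintype V] [DecidableEq V] [DecidableRel Γ.Adj]

namespace IsCKFamily

variable {A : Type*} [CStarAlgebra A] {p : V → A} {S : Γ.Edge → A}

theorem sum_range (h : IsCKFamily Γ p S) : ∑ e, S e * star (S e) = 1 := by
  rw [← h.p_sum, ← Finset.sum_fiberwise Finset.univ (fun e : Γ.Edge => e.src)]
  exact Finset.sum_congr rfl fun v _ => h.src v

theorem range_mul (h : IsCKFamily Γ p S) (e : Γ.Edge) : S e * star (S e) * (S e * star (S e)) = S e * star (S e) := by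
  rw [← mul_assoc, h.pisom]

theorem star_mul_of_ne (h : IsCKFamily Γ p S) {e f : Γ.Edge} (hef : e ≠ f) : star (S e) * S f = 0 := by
  have h1 : S e * star (S e) * (S f * star (S f)) = 0 :=
    proj_mul_eq_zero (r := fun e => S e * star (S e)) (fun e => by rw [star_mul, star_star])
      h.range_mul h.sum_range hef
  have h2 : star (S e) * (S e * star (S e)) = star (S e) := by
    have := congrArg star (h.pisom e)
    rwa [star_mul, star_mul, star_star] at this
  rw [← h2, ← h.pisom f, mul_assoc, ← mul_assoc _ _ (S f), h1, zero_mul, mul_zero]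

theorem S_mul_p (h : IsCKFamily Γ p S) (e : Γ.Edge) : S e * p e.tgt = S e := by
  rw [← h.tgt, ← mul_assoc, h.pisom]

theorem mul_star_of_ne (h : IsCKFamily Γ p S) {e f : Γ.Edge} (hef : e.tgt ≠ f.tgt) : S e * star (S f) = 0 := by
  rw [← h.S_mul_p e, ← h.S_mul_p f, star_mul, h.star_p, mul_assoc, ← mul_assoc (p _),
    h.p_orth _ _ hef, zero_mul, mul_zero]

theorem p_mul_p (h : IsCKFamily Γ p S) (v w : V) : p v * p w = if v = w then p v else 0 := by
  split_ifs with hvw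
  · rw [← hvw, h.p_mul]
  · exact h.p_orth v w hvw

end IsCKFamily

namespace IsMagic

variable {B : Type*} [CStarAlgebra B] {u : V → V → B}

theorem row_mul (h : IsMagic Γ u) (i j k : V) : u i j * u i k = if j = k then u i j else 0 := by
  split_ifs with hjk
  · rw [← hjk, h.u_mul]
  · exact proj_mul_eq_zero (r := u i) (h.star_u i) (h.u_mul i) (h.row i) hjk

theorem col_mul (h : IsMagic Γ u) (i j k : V) : u i k * u j k = if i = j then u i k else 0 := by
  split_ifs with hij
  · rw [← hij, h.u_mul]
  · exact proj_mul_eq_zero (r := fun i => u i k) (fun i => h.star_u i k) (fun i => h.u_mul i k)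
      (h.col k) hij

theorem adj_mul (h : IsMagic Γ u) (v w i j : V) :
    adjEntry Γ i j • (u v i * u w j) = adjEntry Γ v w • (u v i * u w j) := by
  have e := congrArg (fun x => u v i * x * u w j) (h.comm v j)
  simp only [Finset.mul_sum, Finset.sum_mul, mul_smul_comm, smul_mul_assoc, h.row_mul] at e
  simp only [mul_assoc, h.col_mul] at e
  simpa using e

theorem mul_eq_zero_left (h : IsMagic Γ u) {v w i j : V} (h1 : Γ.Adj i j) (h2 : ¬ Γ.Adj v w) :
    u v i * u w j = 0 := by
  have := h.adj_mul v w i j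
  rwa [adjEntry, adjEntry, if_pos h1, if_neg h2, one_smul, zero_smul] at this

theorem mul_eq_zero_right (h : IsMagic Γ u) {v w i j : V} (h1 : ¬ Γ.Adj i j) (h2 : Γ.Adj v w) :
    u v i * u w j = 0 := by
  have := h.adj_mul v w i j
  rw [adjEntry, adjEntry, if_neg h1, if_pos h2, one_smul, zero_smul] at this
  exact this.symm

theorem sum_src (h : IsMagic Γ u) {i j k : V} (hij : Γ.Adj i j) :
    ∑ v with Γ.Adj v k, u k j * (u v i * u k j) = u k j := by
  have : ∑ v with Γ.Adj v k, u k j * (u v i * u k j) = ∑ v, u k j * (u v i * u k j) := by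
    refine Finset.sum_subset (Finset.filter_subset _ _) fun v _ hv => ?_
    rw [h.mul_eq_zero_left hij (by simpa using hv), mul_zero]
  rw [this, ← Finset.mul_sum, ← Finset.sum_mul, h.col, one_mul, h.u_mul]

theorem sum_tgt (h : IsMagic Γ u) {i v w k : V} (hvk : Γ.Adj v k) :
    ∑ m with Γ.Adj i m, u v i * u k m * (u k m * u w i) = if v = w then u v i else 0 := by
  have : ∑ m with Γ.Adj i m, u v i * u k m * (u k m * u w i) =
      ∑ m, u v i * u k m * (u k m * u w i) := by
    refine Finset.sum_subset (Finset.filter_subset _ _) fun m _ hm => ?_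
    rw [h.mul_eq_zero_right (by simpa using hm) hvk, zero_mul]
  have e : ∀ m, u v i * u k m * (u k m * u w i) = u v i * u k m * u w i := fun m => by
    rw [mul_assoc, ← mul_assoc (u k m), h.u_mul, mul_assoc]
  rw [this]
  simp_rw [e]
  rw [← Finset.sum_mul, ← Finset.mul_sum, h.row, mul_one, h.col_mul]

end IsMagic

/-- Sums over edges with given source are sums over the out-neighbours. -/
theorem sum_edge_src {M : Type*} [AddCommMonoid M] (i : V) (f : V → V → M) :
    ∑ e : Γ.Edge with e.src = i, f e.src e.tgt = ∑ m with Γ.Adj i m, f i m := by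
  refine Finset.sum_bij' (fun e _ => e.tgt)
    (fun m hm => ⟨(i, m), (Finset.mem_filter.1 hm).2⟩) ?_ ?_ ?_ ?_ ?_
  · rintro ⟨⟨a, b⟩, hab⟩ he
    simp only [Finset.mem_filter, Finset.mem_univ, true_and] at he ⊢
    subst he; exact hab
  · intro m hm; simp
  · rintro ⟨⟨a, b⟩, hab⟩ he
    simp only [Finset.mem_filter, Finset.mem_univ, true_and] at he
    subst he; rfl
  · intro m hm; rfl
  · rintro ⟨⟨a, b⟩, hab⟩ he
    simp only [Finset.mem_filter, Finset.mem_univ, true_and] at he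
    subst he; rfl

/-- Sums over edges, ordered by target. -/
theorem sum_edge_tgt {M : Type*} [AddCommMonoid M] (f : V → V → M) :
    ∑ e : Γ.Edge, f e.src e.tgt = ∑ k, ∑ v with Γ.Adj v k, f v k := by
  rw [← Finset.sum_fiberwise Finset.univ (fun e : Γ.Edge => e.tgt)]
  refine Finset.sum_congr rfl fun k _ => ?_
  refine Finset.sum_bij' (fun e _ => e.src)
    (fun m hm => ⟨(m, k), (Finset.mem_filter.1 hm).2⟩) ?_ ?_ ?_ ?_ ?_
  · rintro ⟨⟨a, b⟩, hab⟩ he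
    simp only [Finset.mem_filter, Finset.mem_univ, true_and] at he ⊢
    subst he; exact hab
  · intro m hm; simp
  · rintro ⟨⟨a, b⟩, hab⟩ he
    simp only [Finset.mem_filter, Finset.mem_univ, true_and] at he
    subst he; rfl
  · intro m hm; rfl
  · rintro ⟨⟨a, b⟩, hab⟩ he
    simp only [Finset.mem_filter, Finset.mem_univ, true_and] at he
    subst he; rfl

variable {A B T : Type*} [CStarAlgebra A] [CStarAlgebra B] [CStarAlgebra T]
  {p : V → A} {S : Γ.Edge → A} {u : V → V → B}

/-- A Cuntz–Krieger family twisted by a magic unitary is a Cuntz–Krieger family. -/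
theorem isCKFamily_twist (hA : IsCKFamily Γ p S) (hB : IsMagic Γ u)
    (φ : A ⊗[ℂ] B →⋆ₐ[ℂ] T) :
    IsCKFamily Γ (fun i => ∑ k, φ (p k ⊗ₜ u k i))
      (fun j => ∑ l, φ (S l ⊗ₜ (u l.src j.src * u l.tgt j.tgt))) := by
  have hmul : ∀ i j, (∑ k, φ (p k ⊗ₜ[ℂ] u k i)) * (∑ k, φ (p k ⊗ₜ u k j)) =
      if i = j then ∑ k, φ (p k ⊗ₜ u k i) else 0 := fun i j => by
    simp only [Finset.sum_mul_sum, ← map_mul, Algebra.TensorProduct.tmul_mul_tmul, hA.p_mul_p,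
      TensorProduct.ite_tmul, apply_ite φ, map_zero, Finset.sum_ite_eq, Finset.mem_univ, if_true,
      hB.row_mul, TensorProduct.tmul_ite]
    split_ifs <;> simp
  have htgt : ∀ j : Γ.Edge, star (∑ l, φ (S l ⊗ₜ[ℂ] (u l.src j.src * u l.tgt j.tgt))) *
      (∑ l, φ (S l ⊗ₜ (u l.src j.src * u l.tgt j.tgt))) = ∑ k, φ (p k ⊗ₜ u k j.tgt) := fun j => by
    have e1 : ∀ l l', φ (star (S l) ⊗ₜ[ℂ] star (u l.src j.src * u l.tgt j.tgt)) *
        φ (S l' ⊗ₜ (u l'.src j.src * u l'.tgt j.tgt)) = if l = l' then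
          φ (p l.tgt ⊗ₜ (u l.tgt j.tgt * (u l.src j.src * u l.tgt j.tgt))) else 0 := fun l l' => by
      rw [← map_mul, Algebra.TensorProduct.tmul_mul_tmul]
      split_ifs with hl
      · subst hl
        rw [hA.tgt, star_mul, hB.star_u, hB.star_u, mul_assoc, ← mul_assoc (u l.src j.src) _ _,
          hB.u_mul]
      · rw [hA.star_mul_of_ne hl, TensorProduct.zero_tmul, map_zero]
    simp only [star_sum, ← map_star, TensorProduct.star_tmul, Finset.sum_mul_sum, e1,
      Finset.sum_ite_eq, Finset.mem_univ, if_true]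
    rw [sum_edge_tgt (fun v k => φ (p k ⊗ₜ[ℂ] (u k j.tgt * (u v j.src * u k j.tgt))))]
    refine Finset.sum_congr rfl fun k _ => ?_
    rw [← map_sum, ← TensorProduct.tmul_sum, hB.sum_src j.2]
  refine ⟨fun i => ?_, fun i => ?_, fun i j hij => ?_, ?_, fun j => ?_, htgt, fun i => ?_⟩
  · simp only [star_sum, ← map_star, TensorProduct.star_tmul, hA.star_p, hB.star_u]
  · rw [hmul, if_pos rfl]
  · rw [hmul, if_neg hij]
  · rw [Finset.sum_comm]
    simp only [← map_sum, ← TensorProduct.tmul_sum, hB.row, ← TensorProduct.sum_tmul, hA.p_sum]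
    exact map_one φ
  · exact mul_star_mul_of_idem (htgt j) (by rw [hmul, if_pos rfl])
  · have e1 : ∀ l l' j : Γ.Edge, φ (S l ⊗ₜ[ℂ] (u l.src j.src * u l.tgt j.tgt)) *
        φ (star (S l') ⊗ₜ star (u l'.src j.src * u l'.tgt j.tgt)) =
          φ ((S l * star (S l')) ⊗ₜ
            (u l.src j.src * u l.tgt j.tgt * (u l'.tgt j.tgt * u l'.src j.src))) := fun l l' j => by
      rw [← map_mul, Algebra.TensorProduct.tmul_mul_tmul, star_mul, hB.star_u, hB.star_u]
    have e2 : ∀ l l' : Γ.Edge, ∑ j : Γ.Edge with j.src = i, φ ((S l * star (S l')) ⊗ₜ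
            (u l.src j.src * u l.tgt j.tgt * (u l'.tgt j.tgt * u l'.src j.src))) =
        if l = l' then φ ((S l * star (S l)) ⊗ₜ u l.src i) else 0 := fun l l' => by
      by_cases ht : l.tgt = l'.tgt
      · rw [← map_sum, ← TensorProduct.tmul_sum, ← ht,
          sum_edge_src i (fun a b => u l.src a * u l.tgt b * (u l.tgt b * u l'.src a)),
          hB.sum_tgt l.2]
        by_cases hs : l.src = l'.src
        · have hl : l = l' := Subtype.ext (Prod.ext hs ht)
          subst hl
          rw [if_pos rfl, if_pos rfl]
        · have hl : l ≠ l' := fun hl => hs (congrArg Digraph.Edge.src hl)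
          rw [if_neg hs, if_neg hl, TensorProduct.tmul_zero, map_zero]
      · have hl : l ≠ l' := fun hl => ht (congrArg Digraph.Edge.tgt hl)
        rw [if_neg hl]
        simp only [hA.mul_star_of_ne ht, TensorProduct.zero_tmul, map_zero, Finset.sum_const_zero]
    simp only [star_sum, ← map_star, TensorProduct.star_tmul, Finset.sum_mul_sum, e1]
    rw [Finset.sum_comm]
    simp_rw [Finset.sum_comm (s := Finset.univ.filter fun j : Γ.Edge => j.src = i), e2]
    simp only [Finset.sum_ite_eq, Finset.mem_univ, if_true]
    rw [← Finset.sum_fiberwise Finset.univ (fun e : Γ.Edge => e.src)]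
    refine Finset.sum_congr rfl fun v _ => ?_
    rw [← hA.src v, TensorProduct.sum_tmul, map_sum]
    refine Finset.sum_congr rfl fun e he => ?_
    rw [(Finset.mem_filter.1 he).2]

end families

section dynamics

variable {V : Type*} (Γ : Digraph V) [Fintype V] [DecidableEq V] [DecidableRel Γ.Adj]

/-- The action of the quantum automorphism group on the graph C⋆-algebra:
`α(p_i) = ∑_k p_k ⊗ u_{ki}` and `α(S_j) = ∑_l S_l ⊗ u_{s(l)s(j)} u_{t(l)t(j)}`. -/
def qAction : CGraph Γ →⋆ₐ[ℂ] MinTensor (CGraph Γ) (QAut Γ) :=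
  CGraph.lift
    (fun i => ∑ k, MinTensor.tmul (CGraph.p k) (QAut.u k i))
    (fun j => ∑ l, MinTensor.tmul (CGraph.S l) (QAut.u l.src j.src * QAut.u l.tgt j.tgt))
    (isCKFamily_twist CGraph.isCKFamily QAut.isMagic (MinTensor.ofAlg (CGraph Γ) (QAut Γ)))

variable {Γ}

/-- The gauge action: `γ_z(p_v) = p_v`, `γ_z(S_e) = z S_e`. -/
def CGraph.gauge (z : Circle) : CGraph Γ →⋆ₐ[ℂ] CGraph Γ :=
  CGraph.lift CGraph.p (fun e => (z : ℂ) • CGraph.S e) <| by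
    have h := CGraph.isCKFamily (Γ := Γ)
    have hz : star (z : ℂ) * (z : ℂ) = 1 := by
      rw [mul_comm]; exact (Complex.mul_conj _).trans (by simp)
    have hz' : (z : ℂ) * star (z : ℂ) = 1 := by rw [mul_comm]; exact hz
    refine ⟨h.star_p, h.p_mul, h.p_orth, h.p_sum, fun e => ?_, fun e => ?_, fun v => ?_⟩
    · rw [star_smul, smul_mul_smul_comm, smul_mul_smul_comm, hz', one_mul, h.pisom]
    · rw [star_smul, smul_mul_smul_comm, hz, one_smul, h.tgt]
    · simp only [star_smul, smul_mul_smul_comm, hz', one_smul, h.src]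

/-- The automorphism of the edge set induced by an automorphism of the digraph. -/
def edgeMap (g : Γ.Adj ≃r Γ.Adj) (e : Γ.Edge) : Γ.Edge :=
  ⟨(g e.src, g e.tgt), g.map_rel_iff.2 e.2⟩

theorem sum_edgeMap {M : Type*} [AddCommMonoid M] (g : Γ.Adj ≃r Γ.Adj) (v : V) (f : Γ.Edge → M) :
    ∑ e with e.src = v, f (edgeMap g e) = ∑ e with e.src = g v, f e := by
  refine Finset.sum_bij' (fun e _ => edgeMap g e) (fun e _ => edgeMap g.symm e) ?_ ?_ ?_ ?_ ?_
  · intro e he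
    simp only [Finset.mem_filter, Finset.mem_univ, true_and] at he ⊢
    exact congrArg g he
  · intro e he
    simp only [Finset.mem_filter, Finset.mem_univ, true_and] at he ⊢
    exact (congrArg g.symm he).trans (g.symm_apply_apply v)
  · intro e _; exact Subtype.ext (Prod.ext (g.symm_apply_apply _) (g.symm_apply_apply _))
  · intro e _; exact Subtype.ext (Prod.ext (g.apply_symm_apply _) (g.apply_symm_apply _))
  · intro e _; rfl

/-- The action of the automorphism group on the graph C⋆-algebra: `p_v ↦ p_{g(v)}`,
`S_e ↦ S_{g(e)}`. -/
def autAction (g : Γ.Adj ≃r Γ.Adj) : CGraph Γ →⋆ₐ[ℂ] CGraph Γ :=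
  CGraph.lift (fun v => CGraph.p (g v)) (fun e => CGraph.S (edgeMap g e)) <| by
    have h := CGraph.isCKFamily (Γ := Γ)
    refine ⟨fun v => h.star_p _, fun v => h.p_mul _, fun v w hvw => h.p_orth _ _ ?_, ?_,
      fun e => h.pisom _, fun e => h.tgt _, fun v => ?_⟩
    · exact fun e => hvw (g.injective e)
    · rw [← h.p_sum]; exact Equiv.sum_comp g.toEquiv CGraph.p
    · rw [← h.src, sum_edgeMap g v (fun e => CGraph.S e * star (CGraph.S e))]

/-- `F` is the entire extension of the orbit map `t ↦ σ_t(a) = γ_{e^{it}}(a)`. An element `a` is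
analytic if it has such an extension `F`, and then `σ_z(a) = F z`. -/
structure IsAnalyticOrbit (a : CGraph Γ) (F : ℂ → CGraph Γ) : Prop where
  differentiable : Differentiable ℂ F
  eq_gauge : ∀ t : ℝ, F t = CGraph.gauge (Circle.exp t) a

/-- `τ` is a KMS state at inverse temperature `β` for the gauge dynamics: a positive functional
with `τ(1) = 1` and `τ(ab) = τ(b σ_{iβ}(a))` for all analytic elements `a`, `b`. -/
structure IsKMS (β : ℝ) (τ : CGraph Γ →ₚ[ℂ] ℂ) : Prop where
  map_one : τ 1 = 1
  kms : ∀ (a b : CGraph Γ) (F G : ℂ → CGraph Γ), IsAnalyticOrbit a F → IsAnalyticOrbit b G →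
    τ (a * b) = τ (b * F (Complex.I * β))

/-- Invariance under the quantum automorphism group: `(τ ⊗ id)(α(a)) = τ(a) 1`. -/
def QAutInvariant (τ : CGraph Γ →ₚ[ℂ] ℂ) : Prop :=
  ∀ a, slice τ (qAction Γ a) = τ a • (1 : QAut Γ)

/-- Invariance under the automorphism group. -/
def AutInvariant (τ : CGraph Γ →ₚ[ℂ] ℂ) : Prop :=
  ∀ (g : Γ.Adj ≃r Γ.Adj) (a : CGraph Γ), τ (autAction g a) = τ a

variable (Γ) in
/-- Directed paths: a starting vertex and a list of consecutive edges, the first of which starts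
there. Paths of length `0` are vertices. -/
structure DiPath where
  start : V
  edges : List Γ.Edge
  head_src : ∀ e ∈ edges.head?, e.src = start
  chain : edges.IsChain fun e f => e.tgt = f.src

/-- The length of a path. -/
def DiPath.length (μ : DiPath Γ) : ℕ := μ.edges.length

/-- `S_μ = S_{e_1} ⋯ S_{e_n}` for `μ = e_1 ⋯ e_n`, and `S_v = p_v` for a vertex `v`. -/
def CGraph.path (μ : DiPath Γ) : CGraph Γ :=
  match μ.edges with
  | [] => CGraph.p μ.start
  | e :: es => ((e :: es).map CGraph.S).prod

end dynamics

/-! ### Linear binary constraint systems -/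

/-- A linear binary constraint system: `m` equations over `𝔽₂` in `n` variables, the `l`-th being
`∑ i ∈ supp l, x i = rhs l`. -/
structure LBCS (n m : ℕ) where
  supp : Fin m → Finset (Fin n)
  rhs : Fin m → ZMod 2

namespace LBCS

variable {n m : ℕ} (F : LBCS n m)

/-- The homogeneous system. -/
def homogeneous : LBCS n m := ⟨F.supp, 0⟩

/-- The vertices of the graph of `F`: an equation together with one of its solutions. -/
abbrev Vertex : Type := Σ l : Fin m, {f : F.supp l → ZMod 2 // ∑ i, f i = F.rhs l}

/-- The graph of `F`: two vertices are adjacent if their assignments are inconsistent, that is,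
differ at a common variable. -/
def graph : SimpleGraph F.Vertex where
  Adj v w := ∃ (i : Fin n) (h : i ∈ F.supp v.1) (h' : i ∈ F.supp w.1), v.2.1 ⟨i, h⟩ ≠ w.2.1 ⟨i, h'⟩
  symm := ⟨fun _ _ ⟨i, h, h', hne⟩ => ⟨i, h', h, hne.symm⟩⟩
  loopless := ⟨fun _ ⟨_, _, _, hne⟩ => hne rfl⟩

instance : DecidableRel F.graph.Adj := fun v w =>
  inferInstanceAs (Decidable (∃ (i : Fin n) (h : i ∈ F.supp v.1) (h' : i ∈ F.supp w.1),
    v.2.1 ⟨i, h⟩ ≠ w.2.1 ⟨i, h'⟩))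

/-- The system of the Mermin–Peres magic square game. -/
def magicSquare : LBCS 9 6 where
  supp := ![{0, 1, 2}, {3, 4, 5}, {6, 7, 8}, {0, 3, 6}, {1, 4, 7}, {2, 5, 8}]
  rhs := ![0, 0, 0, 0, 0, 1]

end LBCS

/-- The directed version of a simple graph: each edge is replaced by two opposite directed ones. -/
def SimpleGraph.directed {V : Type*} (G : SimpleGraph V) : Digraph V := ⟨G.Adj⟩

/-- The directed version of the disjoint union of the graph of the magic square system and the
graph of its homogeneous version. -/
def magicSquareDigraph : Digraph (LBCS.magicSquare.Vertex ⊕ LBCS.magicSquare.homogeneous.Vertex) :=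
  (LBCS.magicSquare.graph ⊕g LBCS.magicSquare.homogeneous.graph).directed

instance : DecidableRel magicSquareDigraph.Adj := fun
  | .inl v, .inl w => inferInstanceAs (Decidable (LBCS.magicSquare.graph.Adj v w))
  | .inr v, .inr w => inferInstanceAs (Decidable (LBCS.magicSquare.homogeneous.graph.Adj v w))
  | .inl _, .inr _ => isFalse (by simp [magicSquareDigraph, SimpleGraph.directed])
  | .inr _, .inl _ => isFalse (by simp [magicSquareDigraph, SimpleGraph.directed])

end

open scoped ENNReal

noncomputable section

/-! ### Positive functionals -/

section positive

variable {A : Type*} [CStarAlgebra A] [PartialOrder A] [StarOrderedRing A]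

/-! Write x_v = τ(p_v). For a KMS state at β, τ(S_e a) = e^{-β} τ(a S_e), so S_e S_e⋆ has weight
e^{-β} x_{t(e)} and x = e^{-β} D x. Every column of D sums to 9 and the x_v sum to 1, hence e^β = 9
(`IsKMS.eq_log`). Then x is harmonic on a 9-regular graph, so it is constant on each of the two
connected components. Moreover x determines τ (`IsKMS.ext`): the elements S_l p_v S_m⋆ span a dense
subspace, τ kills those of nonzero degree because β ≠ 0, and for words of equal length the KMS
condition leads to p_v S_m⋆ S_l, where S_m⋆ S_l is a sum, possibly empty, of vertex projections. So
a KMS state is determined by the mass s ∈ [0, 1] of the first component.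

Every s occurs. The unital positive map T(a) = 9⁻¹ ∑_e S_e⋆ a S_e fixes the projection of each
component, and a T-invariant state satisfies the KMS condition on the generators
(`mul_S_of_transfer`), which implies the full one (`isKMS_of_mul_S`). Averaging any state along T
(`exists_invariant_positive`) gives an invariant state with the same masses of the components.
Vector states on ℓ² of the infinite paths have mass 0 or 1, and convex combinations give the rest.

The two kinds of symmetry differ in whether they can exchange the components. Classical
automorphisms cannot (`isLeft_automorphism`): the six zero assignments are pairwise nonadjacent in
the homogeneous component, while six pairwise nonadjacent vertices in the other one would glue to a
solution of the unsatisfiable magic square system. Hence they preserve x, and by uniqueness τ. The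
quantum group can: the Pauli observables of the Mermin–Peres square solve the system in operators,
and their joint spectral projections form a magic unitary of 4 × 4 matrices that maps each component
to the other (`isMagic_squareMagic`). Invariance of τ at p_v, read in this representation, equates
the two weights (`QAutInvariant.apply_p_eq`), so x_v = 1/48.

Conversely, constant weights give an invariant state (`IsKMS.qAutInvariant`). The statement that can
be proved by induction on words is the localised formula (τ ⊗ id)(α(a)(p_v ⊗ 1)) = ∑_s τ(p_s a)
u_{vs} (`slice_qAction_words`); summing it over v yields invariance. -/

theorem PositiveLinearMap.norm_apply_le_four_mul (g : A →ₚ[ℂ] ℂ) (a : A) :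
    ‖g a‖ ≤ 4 * (‖g 1‖ * ‖a‖) := by
  obtain ⟨y, hy0, hy1, hy⟩ := CStarAlgebra.exists_sum_four_nonneg a
  conv_lhs => rw [hy]
  simp only [map_sum, map_smul]
  refine (norm_sum_le _ _).trans ?_
  simp only [norm_smul, norm_pow, Complex.norm_I, one_pow, one_mul]
  refine (Finset.sum_le_sum (g := fun _ => ‖g 1‖ * ‖a‖) fun i _ => ?_).trans (by simp)
  exact (g.norm_apply_le_of_nonneg _ (hy0 i)).trans
    (mul_le_mul_of_nonneg_left (hy1 i) (norm_nonneg _))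

open Filter Topology in
/-- A unital positive map has an invariant positive functional that agrees with a given one on
the fixed points. -/
theorem exists_invariant_positive (T : A →ₚ[ℂ] A) (hT : T 1 = 1) (f : A →ₚ[ℂ] ℂ) :
    ∃ τ : A →ₚ[ℂ] ℂ, (∀ a, τ (T a) = τ a) ∧ ∀ a, T a = a → τ a = f a := by
  -- Since T is unital, all f ∘ Tⁿ have the same value at 1, which makes the norm bound uniform in
  -- n.
  have hg : ∀ n : ℕ, ∃ g : A →ₚ[ℂ] ℂ, g 1 = f 1 ∧ ∀ a, g a = f (T^[n] a) := fun n => by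
    induction n with
    | zero => exact ⟨f, rfl, fun _ => rfl⟩
    | succ n ih =>
      obtain ⟨g, h1, h2⟩ := ih
      refine ⟨g.comp T, ?_, fun a => ?_⟩
      · change g (T 1) = f 1
        rw [hT, h1]
      · rw [Function.iterate_succ_apply, ← h2]; rfl
  choose g g1 hg using hg
  set s : ℕ → A → ℂ := fun n a => ((n : ℂ) + 1)⁻¹ * ∑ i ∈ Finset.range (n + 1), g i a with hs
  have hn : ∀ n : ℕ, ‖((n : ℂ) + 1)⁻¹‖ = ((n : ℝ) + 1)⁻¹ := fun n => by
    rw [norm_inv]; norm_cast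
  have hb : ∀ n a, ‖s n a‖ ≤ 4 * (‖f 1‖ * ‖a‖) := fun n a => by
    rw [hs, norm_mul, hn]
    have h1 : ‖∑ i ∈ Finset.range (n + 1), g i a‖ ≤ ((n : ℝ) + 1) * (4 * (‖f 1‖ * ‖a‖)) := by
      refine (norm_sum_le _ _).trans ((Finset.sum_le_sum
        (g := fun _ => 4 * (‖f 1‖ * ‖a‖)) fun i _ => ?_).trans (by simp))
      rw [← g1 i]; exact (g i).norm_apply_le_four_mul a
    calc ((n : ℝ) + 1)⁻¹ * ‖∑ i ∈ Finset.range (n + 1), g i a‖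
        ≤ ((n : ℝ) + 1)⁻¹ * (((n : ℝ) + 1) * (4 * (‖f 1‖ * ‖a‖))) := by gcongr
      _ = _ := by field_simp
  -- The Cesàro means are pointwise bounded, so they converge along one nonprincipal ultrafilter for
  -- all a at once, and the limits depend linearly on a.
  have hlim : ∀ a, ∃ L, Tendsto (fun n => s n a) (hyperfilter ℕ : Filter ℕ) (𝓝 L) := fun a => by
    obtain ⟨L, -, hL⟩ := (isCompact_closedBall (0 : ℂ) (4 * (‖f 1‖ * ‖a‖))).ultrafilter_le_nhds
      ((hyperfilter ℕ).map fun n => s n a)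
      (by
        rw [Ultrafilter.coe_map, Filter.le_principal_iff, Filter.mem_map]
        exact Filter.Eventually.of_forall fun n => by simpa using hb n a)
    exact ⟨L, hL⟩
  choose L hL using hlim
  have hadd : ∀ a b, L (a + b) = L a + L b := fun a b => by
    refine tendsto_nhds_unique (hL _) (((hL a).add (hL b)).congr fun n => ?_)
    simp only [hs, map_add, Finset.sum_add_distrib, mul_add]
  have hsmul : ∀ (c : ℂ) a, L (c • a) = c * L a := fun c a => by
    refine tendsto_nhds_unique (hL _) (((hL a).const_mul c).congr fun n => ?_)
    simp only [hs, map_smul, smul_eq_mul, ← Finset.mul_sum]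
    ring
  refine ⟨PositiveLinearMap.mk₀ ⟨⟨L, hadd⟩, hsmul⟩ fun a ha => ?_, fun a => ?_, fun a ha => ?_⟩
  · refine ge_of_tendsto' (hL a) fun n => ?_
    refine mul_nonneg ?_ (Finset.sum_nonneg fun i _ => (g i).map_nonneg ha)
    rw [inv_nonneg]
    exact_mod_cast Nat.zero_le (n + 1)
  · change L (T a) = L a
    -- The difference of the means telescopes to two bounded terms divided by n + 1.
    have h0 : Tendsto (fun n => s n (T a) - s n a) atTop (𝓝 0) := by
      have e : ∀ n, s n (T a) - s n a = ((n : ℂ) + 1)⁻¹ * (g (n + 1) a - g 0 a) := fun n => by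
        have h1 : ∀ i, g i (T a) = g (i + 1) a := fun i => by
          rw [hg, hg, Function.iterate_succ_apply]
        simp only [hs, h1]
        rw [← mul_sub, ← Finset.sum_sub_distrib, Finset.sum_range_sub (fun i => g i a)]
      have hlim : Tendsto (fun n : ℕ => ((n : ℝ) + 1)⁻¹ * (8 * (‖f 1‖ * ‖a‖))) atTop (𝓝 0) := by
        have := (tendsto_one_div_add_atTop_nhds_zero_nat (𝕜 := ℝ)).mul_const (8 * (‖f 1‖ * ‖a‖))
        simpa using this
      refine squeeze_zero_norm (fun n => ?_) hlim
      rw [e, norm_mul, hn]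
      refine mul_le_mul_of_nonneg_left ?_ (by positivity)
      have h1 := (g (n + 1)).norm_apply_le_four_mul a
      have h2 := (g 0).norm_apply_le_four_mul a
      rw [g1] at h1 h2
      linarith [norm_sub_le (g (n + 1) a) (g 0 a)]
    have h1 := (hL (T a)).sub (hL a)
    have h2 := tendsto_nhds_unique h1 (h0.mono_left Nat.hyperfilter_le_atTop)
    exact sub_eq_zero.1 h2
  · change L a = f a
    have hi : ∀ i, g i a = f a := fun i => by rw [hg, Function.iterate_fixed ha]
    refine tendsto_nhds_unique (hL a) (tendsto_const_nhds.congr fun n => ?_)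
    have : ((n : ℂ) + 1) ≠ 0 := by exact_mod_cast Nat.succ_ne_zero n
    simp [hs, hi, this]

end positive

/-! ### Density in graph C⋆-algebras -/

section density

variable {V : Type*} {Γ : Digraph V} [Fintype V] [DecidableEq V] [DecidableRel Γ.Adj]

/-- Left multiplication by the generators and their adjoints preserves the span, hence so does the
dense ⋆-algebra they generate; applied to 1, it lands in the span. The p_v are self-adjoint and need
no separate condition. -/
theorem CGraph.mem_closure_span {W : Set (CGraph Γ)} (h1 : 1 ∈ Submodule.span ℂ W)
    (hp : ∀ v, ∀ w ∈ W, p v * w ∈ Submodule.span ℂ W)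
    (hS : ∀ e, ∀ w ∈ W, S e * w ∈ Submodule.span ℂ W)
    (hS' : ∀ e, ∀ w ∈ W, star (S e) * w ∈ Submodule.span ℂ W) (a : CGraph Γ) :
    a ∈ closure (Submodule.span ℂ W : Set (CGraph Γ)) := by
  have hspan : ∀ x : CGraph Γ, (∀ w ∈ W, x * w ∈ Submodule.span ℂ W) →
      ∀ w ∈ Submodule.span ℂ W, x * w ∈ Submodule.span ℂ W := fun x hx w hw => by
    induction hw using Submodule.span_induction with
    | mem w hw => exact hx w hw
    | zero => rw [mul_zero]; exact zero_mem _
    | add a b _ _ ha hb => rw [mul_add]; exact add_mem ha hb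
    | smul c a _ ha => rw [mul_smul_comm]; exact Submodule.smul_mem _ c ha
  have key : ∀ (x : FreeStarAlg (V ⊕ Γ.Edge)), ∀ w ∈ Submodule.span ℂ W,
      (UnivCStar.ofFree x : CGraph Γ) * w ∈ Submodule.span ℂ W := fun x => by
    induction x using FreeStarAlg.induction with
    | h1 c =>
      intro w hw
      rw [AlgHomClass.commutes, ← Algebra.smul_def]
      exact Submodule.smul_mem _ c hw
    | h2 x =>
      have hst : ∀ y : V ⊕ Γ.Edge,
          (FreeStarAlg.letter (y, true) : FreeStarAlg (V ⊕ Γ.Edge)) = star (FreeStarAlg.gen y) :=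
        fun y => by rw [FreeStarAlg.gen, FreeStarAlg.star_letter]; rfl
      rcases x with ⟨v | e, _ | _⟩
      · exact hspan _ (hp v)
      · rw [hst, map_star]
        refine hspan _ fun w hw => ?_
        have := hp v w hw
        rwa [← CGraph.isCKFamily.star_p] at this
      · exact hspan _ (hS e)
      · rw [hst, map_star]
        exact hspan _ (hS' e)
    | h3 a b ha hb => intro w hw; rw [map_mul, mul_assoc]; exact ha _ (hb _ hw)
    | h4 a b ha hb => intro w hw; rw [map_add, add_mul]; exact add_mem (ha _ hw) (hb _ hw)
  refine UnivCStar.denseRange_ofFree.induction_on (p := fun a : CGraph Γ =>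
    a ∈ closure (Submodule.span ℂ W : Set (CGraph Γ))) a isClosed_closure fun x => ?_
  refine subset_closure ?_
  simpa using key x 1 h1

theorem CGraph.clm_ext {W : Set (CGraph Γ)}
    (hW : ∀ a, a ∈ closure (Submodule.span ℂ W : Set (CGraph Γ)))
    {B : Type*} [NormedAddCommGroup B] [NormedSpace ℂ B] {f g : CGraph Γ →L[ℂ] B}
    (h : ∀ w ∈ W, f w = g w) (a : CGraph Γ) : f a = g a := by
  have hc : IsClosed {a | f a = g a} := isClosed_eq f.continuous g.continuous
  refine hc.closure_subset_iff.2 (fun w hw => ?_) (hW a)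
  exact LinearMap.eqOn_span (f := f.toLinearMap) (g := g.toLinearMap) h hw

end density

/-! ### Homogeneous elements and the KMS condition -/

section kms

variable {V : Type*} {Γ : Digraph V} [Fintype V] [DecidableEq V] [DecidableRel Γ.Adj]

/-- Positive functionals as continuous linear maps. -/
def PositiveLinearMap.toCLM {A : Type*} [CStarAlgebra A] [PartialOrder A] [StarOrderedRing A]
    (τ : A →ₚ[ℂ] ℂ) : A →L[ℂ] ℂ := ⟨τ.toLinearMap, map_continuous τ⟩

namespace CGraph

open scoped CStarAlgebra in
theorem continuous_gauge (z : Circle) : Continuous (gauge z : CGraph Γ → CGraph Γ) :=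
  map_continuous (gauge z : CGraph Γ →⋆ₐ[ℂ] CGraph Γ)

theorem gauge_p (z : Circle) (v : V) : gauge z (p v : CGraph Γ) = p v := lift_p _ _ _ v

theorem gauge_S (z : Circle) (e : Γ.Edge) : gauge z (S e) = (z : ℂ) • S e := lift_S _ _ _ e

/-- Elements of degree `k` for the gauge action. -/
def IsHomogeneous (k : ℤ) (a : CGraph Γ) : Prop := ∀ z : Circle, gauge z a = ((z : ℂ) ^ k) • a

theorem IsHomogeneous.mul {j k : ℤ} {a b : CGraph Γ} (ha : IsHomogeneous j a)
    (hb : IsHomogeneous k b) : IsHomogeneous (j + k) (a * b) := fun z => by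
  rw [map_mul, ha, hb, smul_mul_smul_comm, zpow_add₀ z.coe_ne_zero]

theorem IsHomogeneous.star {k : ℤ} {a : CGraph Γ} (ha : IsHomogeneous k a) :
    IsHomogeneous (-k) (star a) := fun z => by
  have : Star.star (z : ℂ) = (z : ℂ)⁻¹ := (Circle.coe_inv_eq_conj z).symm
  rw [map_star, ha, star_smul, star_zpow₀, this, inv_zpow, zpow_neg]

theorem isHomogeneous_one : IsHomogeneous 0 (1 : CGraph Γ) := fun z => by simp

theorem isHomogeneous_p (v : V) : IsHomogeneous 0 (p v : CGraph Γ) := fun z => by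
  rw [gauge_p, zpow_zero, one_smul]

theorem isHomogeneous_S (e : Γ.Edge) : IsHomogeneous 1 (S e) := fun z => by
  rw [gauge_S, zpow_one]

theorem IsHomogeneous.isAnalyticOrbit {k : ℤ} {a : CGraph Γ} (ha : IsHomogeneous k a) :
    IsAnalyticOrbit a fun z => Complex.exp (Complex.I * k * z) • a where
  differentiable := by fun_prop
  eq_gauge t := by
    rw [ha, Circle.coe_exp, ← Complex.exp_int_mul]
    congr 2
    ring

theorem mem_closure_homogeneous (a : CGraph Γ) :
    a ∈ closure (Submodule.span ℂ {b : CGraph Γ | ∃ k, IsHomogeneous k b} : Set (CGraph Γ)) := by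
  refine mem_closure_span (Submodule.subset_span (Set.mem_ofPred.2 ⟨0, isHomogeneous_one⟩)) ?_ ?_ ?_ a
  · rintro v w ⟨k, hk⟩; exact Submodule.subset_span ⟨_, (isHomogeneous_p v).mul hk⟩
  · rintro e w ⟨k, hk⟩; exact Submodule.subset_span ⟨_, (isHomogeneous_S e).mul hk⟩
  · rintro e w ⟨k, hk⟩; exact Submodule.subset_span ⟨_, (isHomogeneous_S e).star.mul hk⟩

end CGraph

open CGraph

/-- Here σ_{iβ}(b) = e^{-kβ} b, so for homogeneous a this is the KMS condition. Density and
continuity extend it to all a, analytic or not. -/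
theorem IsKMS.mul_homogeneous {β : ℝ} {τ : CGraph Γ →ₚ[ℂ] ℂ} (h : IsKMS β τ) {k : ℤ}
    {b : CGraph Γ} (hb : IsHomogeneous k b) (a : CGraph Γ) :
    τ (b * a) = Complex.exp (-(k * β)) * τ (a * b) := by
  refine clm_ext (mem_closure_homogeneous (Γ := Γ))
    (f := τ.toCLM ∘L ContinuousLinearMap.mul ℂ _ b)
    (g := Complex.exp (-(k * β)) • (τ.toCLM ∘L (ContinuousLinearMap.mul ℂ _).flip b)) ?_ a
  rintro w ⟨j, hw⟩
  change τ (b * w) = Complex.exp (-(k * β)) • τ (w * b)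
  rw [h.kms b w _ _ hb.isAnalyticOrbit hw.isAnalyticOrbit, mul_smul_comm, map_smul]
  congr 2
  linear_combination (k * β : ℂ) * Complex.I_sq

theorem IsKMS.mul_S {β : ℝ} {τ : CGraph Γ →ₚ[ℂ] ℂ} (h : IsKMS β τ) (a : CGraph Γ) (e : Γ.Edge) :
    τ (a * S e) = Complex.exp β * τ (S e * a) := by
  rw [h.mul_homogeneous (isHomogeneous_S e), ← mul_assoc, ← Complex.exp_add]
  simp

/-- If the KMS condition holds for multiplication by the generators `S_e`, then the homogeneous
elements for which it holds are dense. -/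
theorem mem_closure_homogeneous_of_mul_S {β : ℝ} {τ : CGraph Γ →ₚ[ℂ] ℂ}
    (h : ∀ a e, τ (a * S e) = Complex.exp β * τ (S e * a)) (a : CGraph Γ) :
    a ∈ closure (Submodule.span ℂ {b : CGraph Γ | ∃ k : ℤ, IsHomogeneous k b ∧
      ∀ a, τ (a * b) = Complex.exp (k * β) * τ (b * a)} : Set (CGraph Γ)) := by
  -- Degrees and exponents add under products, so only the generators need to be checked.
  have hmul : ∀ (j k : ℤ) (b c : CGraph Γ), IsHomogeneous j b → IsHomogeneous k c →
      (∀ a, τ (a * b) = Complex.exp (j * β) * τ (b * a)) →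
      (∀ a, τ (a * c) = Complex.exp (k * β) * τ (c * a)) →
      b * c ∈ Submodule.span ℂ {b : CGraph Γ | ∃ k : ℤ, IsHomogeneous k b ∧
        ∀ a, τ (a * b) = Complex.exp (k * β) * τ (b * a)} := fun j k b c hb hc hb' hc' => by
    refine Submodule.subset_span ⟨_, hb.mul hc, fun a => ?_⟩
    rw [← mul_assoc, hc', ← mul_assoc, hb', ← mul_assoc, ← mul_assoc, ← Complex.exp_add]
    congr 2
    push_cast; ring
  have hS : ∀ (e : Γ.Edge) (a), τ (a * S e) = Complex.exp ((1 : ℤ) * β) * τ (S e * a) :=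
    fun e a => by rw [h]; simp
  -- Adjoint of the hypothesis: τ is hermitian and e^β is real.
  have hS' : ∀ (e : Γ.Edge) (a),
      τ (a * star (S e)) = Complex.exp ((-1 : ℤ) * β) * τ (star (S e) * a) := fun e a => by
    have h1 : τ (star (S e) * a) = Complex.exp β * τ (a * star (S e)) := by
      have h2 := congrArg star (h (star a) e)
      rw [← map_star τ, star_mul, star_star, star_mul', ← map_star τ, star_mul, star_star] at h2
      rw [h2]
      congr 1
      rw [← Complex.ofReal_exp]; exact Complex.conj_ofReal _
    rw [h1, ← mul_assoc, ← Complex.exp_add]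
    simp
  -- p_v is a sum of elements S_e S_e⋆, for which the factors e^β and e^{-β} cancel.
  have hp : ∀ (v : V) (a), τ (a * p v) = Complex.exp ((0 : ℤ) * β) * τ (p v * a) := fun v a => by
    rw [← CGraph.isCKFamily.src v, Finset.mul_sum, Finset.sum_mul, map_sum, map_sum]
    simp only [Int.cast_zero, zero_mul, Complex.exp_zero, one_mul]
    refine Finset.sum_congr rfl fun e _ => ?_
    rw [← mul_assoc, hS', ← mul_assoc, hS, ← mul_assoc, ← Complex.exp_add, mul_assoc]
    simp
  refine mem_closure_span (Submodule.subset_span (Set.mem_ofPred.2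
    ⟨0, isHomogeneous_one, fun a => by simp⟩))
    ?_ ?_ ?_ a
  · rintro v w ⟨k, hk, hk'⟩; exact hmul _ _ _ _ (isHomogeneous_p v) hk (hp v) hk'
  · rintro e w ⟨k, hk, hk'⟩; exact hmul _ _ _ _ (isHomogeneous_S e) hk (hS e) hk'
  · rintro e w ⟨k, hk, hk'⟩; exact hmul _ _ _ _ (isHomogeneous_S e).star hk (hS' e) hk'

/-- Homogeneous elements of nonzero degree are annihilated. -/
theorem eq_zero_of_homogeneous {β : ℝ} (hβ : β ≠ 0) {τ : CGraph Γ →ₚ[ℂ] ℂ} {k : ℤ} (hk : k ≠ 0)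
    {b : CGraph Γ} (hb : ∀ a, τ (a * b) = Complex.exp (k * β) * τ (b * a)) : τ b = 0 := by
  have h1 := hb 1
  rw [one_mul, mul_one] at h1
  have h2 : Complex.exp (k * β) ≠ 1 := fun h => by
    have h3 : Complex.exp ((k * β : ℝ) : ℂ) = 1 := by push_cast; exact h
    rw [← Complex.ofReal_exp] at h3
    have h4 : Real.exp (k * β) = 1 := by exact_mod_cast h3
    rw [Real.exp_eq_one_iff] at h4
    simp [hk, hβ] at h4
  have h3 : (Complex.exp (k * β) - 1) * τ b = 0 := by rw [sub_mul, one_mul, ← h1, sub_self]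
  exact (mul_eq_zero.1 h3).resolve_left (sub_ne_zero.2 h2)

/-- On a dense span of homogeneous elements, τ kills those of nonzero degree and the gauge action
fixes those of degree 0. -/
theorem gauge_invariant_of_mul_S {β : ℝ} (hβ : β ≠ 0) {τ : CGraph Γ →ₚ[ℂ] ℂ}
    (h : ∀ a e, τ (a * S e) = Complex.exp β * τ (S e * a)) (z : Circle) (a : CGraph Γ) :
    τ (gauge z a) = τ a := by
  refine clm_ext (mem_closure_homogeneous_of_mul_S h)
    (f := τ.toCLM ∘L ⟨(gauge z : CGraph Γ →⋆ₐ[ℂ] CGraph Γ).toAlgHom.toLinearMap,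
      continuous_gauge z⟩) (g := τ.toCLM) ?_ a
  rintro b ⟨k, hk, hk'⟩
  change τ (CGraph.gauge z b) = τ b
  rw [hk, map_smul]
  by_cases h0 : k = 0
  · rw [h0, zpow_zero, one_smul]
  · rw [eq_zero_of_homogeneous hβ h0 hk', smul_zero]

/-- Identity theorem: the real points accumulate at 0. -/
theorem eq_on_complex_of_eq_on_real {f g : ℂ → ℂ} (hf : Differentiable ℂ f)
    (hg : Differentiable ℂ g) (h : ∀ t : ℝ, f t = g t) (z : ℂ) : f z = g z := by
  have hf' : AnalyticOnNhd ℂ f Set.univ := fun z _ => hf.analyticAt z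
  have hg' : AnalyticOnNhd ℂ g Set.univ := fun z _ => hg.analyticAt z
  refine congrFun (hf'.eq_of_frequently_eq hg' (z₀ := 0) ?_) z
  have ht : Filter.Tendsto (fun t : ℝ => (t : ℂ)) (nhdsWithin 0 {0}ᶜ) (nhdsWithin 0 {0}ᶜ) := by
    refine tendsto_nhdsWithin_iff.2 ⟨?_, ?_⟩
    · exact (Complex.continuous_ofReal.tendsto' 0 0 (by simp)).mono_left nhdsWithin_le_nhds
    · filter_upwards [self_mem_nhdsWithin] with t ht
      simpa using ht
  exact ht.frequently (Filter.Frequently.of_forall h)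

/-- By density b may be taken homogeneous of degree k with τ(ab) = e^{kβ} τ(ba). Gauge invariance
gives τ(b σ_t(a)) = e^{-ikt} τ(ba) for real t. Both sides extend to entire functions of t, and t =
iβ turns the right side into e^{kβ} τ(ba) = τ(ab). -/
theorem isKMS_of_mul_S {β : ℝ} (hβ : β ≠ 0) {τ : CGraph Γ →ₚ[ℂ] ℂ} (h1 : τ 1 = 1)
    (h : ∀ a e, τ (a * S e) = Complex.exp β * τ (S e * a)) : IsKMS β τ where
  map_one := h1
  kms a b F _ hF _ := by
    refine clm_ext (mem_closure_homogeneous_of_mul_S h) (f := τ.toCLM ∘L ContinuousLinearMap.mul ℂ _ a)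
      (g := τ.toCLM ∘L (ContinuousLinearMap.mul ℂ _).flip (F (Complex.I * β))) ?_ b
    rintro b ⟨k, hk, hk'⟩
    change τ (a * b) = τ (b * F (Complex.I * β))
    have hg : Differentiable ℂ fun z => τ (b * F z) :=
      (τ.toCLM ∘L ContinuousLinearMap.mul ℂ _ b).differentiable.comp hF.differentiable
    have hz := eq_on_complex_of_eq_on_real hg
      (g := fun z => Complex.exp (-(Complex.I * k * z)) * τ (b * a)) (by fun_prop) (fun t => ?_)
      (Complex.I * β)
    · rw [hz, hk']
      congr 2
      linear_combination (k * β : ℂ) * Complex.I_sq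
    · rw [← gauge_invariant_of_mul_S hβ h (Circle.exp t) (b * a), map_mul (CGraph.gauge _), hk, hF.eq_gauge,
        smul_mul_assoc, map_smul, smul_eq_mul, ← mul_assoc, Circle.coe_exp, ← Complex.exp_int_mul,
        ← Complex.exp_add]
      rw [show -(Complex.I * k * t) + k * (t * Complex.I) = (0 : ℂ) by ring, Complex.exp_zero,
        one_mul]

end kms

/-! ### Words and uniqueness of KMS states -/

section words

variable {V : Type*} {Γ : Digraph V} [Fintype V] [DecidableEq V] [DecidableRel Γ.Adj]

theorem IsCKFamily.p_mul_S {A : Type*} [CStarAlgebra A] {p : V → A} {S : Γ.Edge → A}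
    (h : IsCKFamily Γ p S) (v : V) (e : Γ.Edge) :
    p v * S e = if v = e.src then S e else 0 := by
  rw [← h.src, Finset.sum_mul]
  have h1 : ∀ f, S f * star (S f) * S e = if f = e then S e else 0 := fun f => by
    split_ifs with hf
    · rw [hf, h.pisom]
    · rw [mul_assoc, h.star_mul_of_ne hf, mul_zero]
  simp only [h1, Finset.sum_ite_eq', Finset.mem_filter, Finset.mem_univ, true_and,
    eq_comm (a := v)]

theorem IsCKFamily.star_mul {A : Type*} [CStarAlgebra A] {p : V → A} {S : Γ.Edge → A}
    (h : IsCKFamily Γ p S) (e f : Γ.Edge) :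
    star (S e) * S f = if e = f then p e.tgt else 0 := by
  split_ifs with hef
  · rw [← hef, h.tgt]
  · exact h.star_mul_of_ne hef

namespace CGraph

/-- The product of the generators `S_e` along a list of edges. -/
def word (l : List Γ.Edge) : CGraph Γ := (l.map S).prod

theorem word_nil : word ([] : List Γ.Edge) = 1 := rfl

theorem word_cons (e : Γ.Edge) (l : List Γ.Edge) : word (e :: l) = S e * word l := by
  rw [word, List.map_cons, List.prod_cons]; rfl

theorem word_append (l m : List Γ.Edge) : word (l ++ m) = word l * word m := by
  rw [word, List.map_append, List.prod_append]; rfl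

theorem isHomogeneous_word (l : List Γ.Edge) : IsHomogeneous l.length (word l) := by
  induction l with
  | nil => exact isHomogeneous_one
  | cons e l ih =>
    rw [word_cons, List.length_cons, Nat.cast_succ, add_comm]
    exact (isHomogeneous_S e).mul ih

/-- p_v fixes or kills the first letter. Words run over all lists of edges, so that no composability
condition has to be carried along; a list that is not a path gives 0. -/
theorem p_mul_word (v : V) (l : List Γ.Edge) (hl : l ≠ []) :
    (p v * word l = word l ∨ p v * word l = 0) := by
  cases l with
  | nil => exact absurd rfl hl
  | cons e l =>
    rw [word_cons, ← mul_assoc, isCKFamily.p_mul_S]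
    split_ifs
    · exact Or.inl rfl
    · exact Or.inr (zero_mul _)

theorem star_word_mul_cons (e f : Γ.Edge) (l m : List Γ.Edge) :
    star (word (e :: l)) * word (f :: m) =
      if e = f then star (word l) * (p e.tgt * word m) else 0 := by
  rw [word_cons, word_cons, StarMul.star_mul, mul_assoc, ← mul_assoc (star (S e)),
    isCKFamily.star_mul]
  split_ifs
  · rfl
  · rw [zero_mul, mul_zero]

/-- Equal first letters cancel until the first difference, where S_e⋆ S_f = 0. The vertex projection
left by a cancellation is absorbed by the next letter or kills it. -/
theorem star_word_mul_of_ne {l m : List Γ.Edge} (h : l.length = m.length) (hlm : l ≠ m) :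
    star (word l) * word m = 0 := by
  induction l generalizing m with
  | nil => exact absurd (List.length_eq_zero_iff.1 h.symm).symm hlm
  | cons e l ih =>
    cases m with
    | nil => simp at h
    | cons f m =>
      rw [star_word_mul_cons]
      split_ifs with hef
      · have hne : l ≠ m := fun h => hlm (by rw [hef, h])
        have hlen : l.length = m.length := by simpa using h
        have hm : m ≠ [] := fun hm => by
          rw [hm] at hlen hne; exact hne (List.length_eq_zero_iff.1 hlen)
        rcases p_mul_word e.tgt m hm with h1 | h1
        · rw [h1, ih hlen hne]
        · rw [h1, mul_zero]
      · rfl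

/-- The set is everything for the empty word, the terminal vertex for a nonempty path, and empty for
a list that is not a path. -/
theorem star_word_mul_self (l : List Γ.Edge) :
    ∃ s : Finset V, star (word l) * word l = ∑ v ∈ s, p v := by
  induction l with
  | nil => exact ⟨Finset.univ, by rw [word_nil, star_one, mul_one, isCKFamily.p_sum]⟩
  | cons e l ih =>
    rw [star_word_mul_cons, if_pos rfl]
    cases l with
    | nil => exact ⟨{e.tgt}, by rw [word_nil, star_one, mul_one, one_mul, Finset.sum_singleton]⟩
    | cons f l =>
      rcases p_mul_word e.tgt (f :: l) (by simp) with h1 | h1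
      · rw [h1]; exact ih
      · exact ⟨∅, by rw [h1, mul_zero, Finset.sum_empty]⟩

/-- The span is stable under left multiplication: S_e lengthens the left word, S_e⋆ cancels its
first letter or kills it. -/
theorem mem_closure_words (a : CGraph Γ) : a ∈ closure (Submodule.span ℂ (Set.range
    fun x : List Γ.Edge × V × List Γ.Edge => word x.1 * p x.2.1 * star (word x.2.2)) :
      Set (CGraph Γ)) := by
  have h := isCKFamily (Γ := Γ)
  set M := Submodule.span ℂ (Set.range
    fun x : List Γ.Edge × V × List Γ.Edge => word x.1 * p x.2.1 * star (word x.2.2)) with hM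
  have hmem : ∀ l v m, word l * p v * star (word m) ∈ M :=
    fun l v m => Submodule.subset_span ⟨(l, v, m), rfl⟩
  have hp : ∀ v l w m, p v * (word l * p w * star (word m)) ∈ M := fun v l w m => by
    rw [← mul_assoc, ← mul_assoc]
    by_cases hl : l = []
    · rw [hl, word_nil, mul_one, h.p_mul_p]
      split_ifs
      · simpa [word_nil] using hmem [] v m
      · rw [zero_mul]; exact zero_mem _
    · rcases p_mul_word v l hl with h1 | h1
      · rw [h1]; exact hmem l w m
      · rw [h1, zero_mul, zero_mul]; exact zero_mem _
  refine mem_closure_span ?_ ?_ ?_ ?_ a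
  · rw [← h.p_sum]
    exact sum_mem fun v _ => by simpa [word_nil] using hmem [] v []
  · rintro v _ ⟨⟨l, w, m⟩, rfl⟩; exact hp v l w m
  · rintro e _ ⟨⟨l, w, m⟩, rfl⟩
    have := hmem (e :: l) w m
    rwa [word_cons, mul_assoc, mul_assoc, ← mul_assoc (word l)] at this
  · rintro e _ ⟨⟨l, w, m⟩, rfl⟩
    cases l with
    | nil =>
      -- With an empty left word, S_e⋆ passes through p_w and becomes the last letter of the right
      -- word.
      have h1 : star (S e) * p w = if w = e.src then p e.tgt * star (S e) else 0 := by
        have h2 := congrArg star (h.p_mul_S w e)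
        rw [StarMul.star_mul, h.star_p, apply_ite star, star_zero] at h2
        rw [h2]
        have h3 := congrArg star (h.S_mul_p e)
        rw [StarMul.star_mul, h.star_p] at h3
        rw [h3]
      change star (S e) * (word [] * p w * star (word m)) ∈ M
      rw [word_nil, one_mul, ← mul_assoc, h1]
      split_ifs
      · have := hmem [] e.tgt (m ++ [e])
        rwa [word_append, StarMul.star_mul, word_nil, one_mul, word_cons, word_nil, mul_one,
          ← mul_assoc] at this
      · rw [zero_mul]; exact zero_mem _
    | cons f l =>
      change star (S e) * (word (f :: l) * p w * star (word m)) ∈ M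
      rw [word_cons, ← mul_assoc, ← mul_assoc, ← mul_assoc, h.star_mul]
      split_ifs
      · rw [mul_assoc, mul_assoc, ← mul_assoc (word l)]; exact hp _ l w m
      · simp only [zero_mul]; exact zero_mem _

end CGraph

open CGraph

theorem IsKMS.word_mul {β : ℝ} {τ : CGraph Γ →ₚ[ℂ] ℂ} (h : IsKMS β τ) (l : List Γ.Edge)
    (a : CGraph Γ) : τ (word l * a) = Complex.exp (-(l.length * β)) * τ (a * word l) := by
  have := h.mul_homogeneous (isHomogeneous_word l) a
  rwa [Int.cast_natCast] at this

theorem IsKMS.eq_zero_of_isHomogeneous {β : ℝ} (hβ : β ≠ 0) {τ : CGraph Γ →ₚ[ℂ] ℂ}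
    (h : IsKMS β τ) {k : ℤ} (hk : k ≠ 0) {b : CGraph Γ} (hb : IsHomogeneous k b) : τ b = 0 :=
  eq_zero_of_homogeneous hβ hk fun a => by
    rw [h.mul_homogeneous hb, ← mul_assoc (Complex.exp _), ← Complex.exp_add, add_neg_cancel,
      Complex.exp_zero, one_mul]

theorem IsKMS.eq_zero_of_length_ne {β : ℝ} (hβ : β ≠ 0) {τ : CGraph Γ →ₚ[ℂ] ℂ} (h : IsKMS β τ)
    {l m : List Γ.Edge} (hlm : l.length ≠ m.length) (v : V) :
    τ (word l * p v * star (word m)) = 0 := by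
  have hd := ((isHomogeneous_word l).mul (isHomogeneous_p v)).mul (isHomogeneous_word m).star
  exact h.eq_zero_of_isHomogeneous hβ (by omega) hd

/-- KMS states are determined by their values on the vertex projections. -/
theorem IsKMS.ext {β : ℝ} (hβ : β ≠ 0) {τ τ' : CGraph Γ →ₚ[ℂ] ℂ} (h : IsKMS β τ)
    (h' : IsKMS β τ') (hp : ∀ v, τ (p v) = τ' (p v)) : τ = τ' := by
  refine PositiveLinearMap.ext fun a => ?_
  refine clm_ext (mem_closure_words (Γ := Γ)) (f := τ.toCLM) (g := τ'.toCLM) ?_ a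
  rintro _ ⟨⟨l, v, m⟩, rfl⟩
  change τ (word l * p v * star (word m)) = τ' (word l * p v * star (word m))
  by_cases hlm : l.length = m.length
  · rw [mul_assoc, h.word_mul, h'.word_mul]
    congr 1
    by_cases hne : m = l
    · obtain ⟨s, hs⟩ := star_word_mul_self l
      rw [mul_assoc, hne, hs, Finset.mul_sum, map_sum, map_sum]
      refine Finset.sum_congr rfl fun w _ => ?_
      rw [isCKFamily.p_mul_p]
      split_ifs
      · exact hp v
      · rw [map_zero, map_zero]
    · rw [mul_assoc, star_word_mul_of_ne hlm.symm hne, mul_zero, map_zero, map_zero]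
  · rw [h.eq_zero_of_length_ne hβ hlm, h'.eq_zero_of_length_ne hβ hlm]

/-- The values of a KMS state on the vertex projections form an eigenvector of the adjacency
matrix. -/
theorem IsKMS.apply_p {β : ℝ} {τ : CGraph Γ →ₚ[ℂ] ℂ} (h : IsKMS β τ) (v : V) :
    τ (p v) = Complex.exp (-β) * ∑ w with Γ.Adj v w, τ (p w) := by
  have h1 : ∀ e : Γ.Edge, τ (S e * star (S e)) = Complex.exp (-β) * τ (p e.tgt) := fun e => by
    rw [h.mul_homogeneous (isHomogeneous_S e), isCKFamily.tgt]; simp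
  rw [← sum_edge_src v (fun _ w => τ (p w)), Finset.mul_sum]
  conv_lhs => rw [← isCKFamily.src v, map_sum]
  exact Finset.sum_congr rfl fun e _ => h1 e

theorem IsKMS.sum_p {β : ℝ} {τ : CGraph Γ →ₚ[ℂ] ℂ} (h : IsKMS β τ) : ∑ v, τ (p v) = 1 := by
  rw [← map_sum, isCKFamily.p_sum, h.map_one]

/-- Summing the eigenvector equation over all vertices counts every weight d times. As the weights
sum to 1, this says 1 = e^{-β} d. -/
theorem IsKMS.eq_log {β : ℝ} {τ : CGraph Γ →ₚ[ℂ] ℂ} (h : IsKMS β τ) {d : ℕ}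
    (hd : ∀ w, (Finset.univ.filter fun v => Γ.Adj v w).card = d) : β = Real.log d := by
  have h1 : ∑ v, Complex.exp (-β) * ∑ w with Γ.Adj v w, τ (p w) = 1 := by
    rw [← h.sum_p]
    exact Finset.sum_congr rfl fun v _ => (h.apply_p v).symm
  simp_rw [Finset.sum_filter] at h1
  rw [← Finset.mul_sum, Finset.sum_comm] at h1
  have h2 : ∀ w, (∑ v, if Γ.Adj v w then τ (p w) else 0) = d * τ (p w) := fun w => by
    rw [← Finset.sum_filter, Finset.sum_const, hd, nsmul_eq_mul]
  simp_rw [h2] at h1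
  rw [← Finset.mul_sum, h.sum_p, mul_one, Complex.exp_neg, ← Complex.ofReal_exp] at h1
  have h3 : (Real.exp β)⁻¹ * d = 1 := by exact_mod_cast h1
  rw [← Real.log_exp β]
  congr 1
  field_simp at h3
  exact h3.symm

/-! ### Existence of KMS states -/

/-- The map `a ↦ d⁻¹ ∑_e S_e⋆ a S_e`. -/
def transfer (Γ : Digraph V) [DecidableRel Γ.Adj] (d : ℕ) : CGraph Γ →ₚ[ℂ] CGraph Γ :=
  PositiveLinearMap.mk₀
    ((d : ℂ)⁻¹ • ∑ e : Γ.Edge, LinearMap.mulLeft ℂ (star (S e)) ∘ₗ LinearMap.mulRight ℂ (S e))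
    fun a ha => by
      have h1 : 0 ≤ ∑ e : Γ.Edge, star (S e) * a * S e :=
        Finset.sum_nonneg fun e _ => star_left_conjugate_nonneg ha (S e)
      have h2 : (0 : ℝ) ≤ (d : ℝ)⁻¹ := by positivity
      have h3 := smul_nonneg h2 h1
      rw [← Complex.coe_smul] at h3
      simpa [mul_assoc, LinearMap.sum_apply] using h3

theorem transfer_apply (d : ℕ) (a : CGraph Γ) :
    transfer Γ d a = (d : ℂ)⁻¹ • ∑ e : Γ.Edge, star (S e) * a * S e := by
  change ((d : ℂ)⁻¹ • ∑ e : Γ.Edge, LinearMap.mulLeft ℂ (star (S e)) ∘ₗ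
    LinearMap.mulRight ℂ (S e)) a = _
  simp [mul_assoc, LinearMap.sum_apply]

/-- The projection of a set of vertices closed under adjacency is fixed. -/
theorem transfer_sum_p {d : ℕ} (hd0 : d ≠ 0)
    (hd : ∀ w, (Finset.univ.filter fun v => Γ.Adj v w).card = d) (C : Finset V)
    (hC : ∀ v w, Γ.Adj v w → (v ∈ C ↔ w ∈ C)) :
    transfer Γ d (∑ v ∈ C, p v) = ∑ v ∈ C, p v := by
  have h := isCKFamily (Γ := Γ)
  -- S_e⋆ p_v S_e is p_{t(e)} if v = s(e) and 0 otherwise. Closedness of C replaces s(e) ∈ C by t(e)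
  -- ∈ C; then every vertex of C is the target of d edges.
  have h1 : ∀ e : Γ.Edge, star (S e) * (∑ v ∈ C, p v) * S e =
      if e.tgt ∈ C then p e.tgt else 0 := fun e => by
    rw [mul_assoc, Finset.sum_mul]
    simp only [h.p_mul_S, Finset.sum_ite_eq', hC _ _ e.2]
    split_ifs
    · exact h.tgt e
    · exact mul_zero _
  rw [transfer_apply]
  simp_rw [h1]
  rw [sum_edge_tgt (Γ := Γ) (fun _ w => if w ∈ C then (p w : CGraph Γ) else 0)]
  simp only [Finset.sum_const, hd]
  rw [← Finset.smul_sum, ← Nat.cast_smul_eq_nsmul ℂ, smul_smul,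
    inv_mul_cancel₀ (Nat.cast_ne_zero.2 hd0), one_smul, Finset.sum_ite_mem, Finset.univ_inter]

/-- In d τ(S_f a) = ∑_e τ(S_e⋆ S_f a S_e) only e = f survives and gives τ(p_{t(f)} a S_f). If the
projection may be moved to the end, S_f absorbs it. -/
theorem mul_S_of_transfer {d : ℕ} (hd0 : d ≠ 0) {τ : CGraph Γ →ₚ[ℂ] ℂ}
    (h : ∀ a, τ (transfer Γ d a) = τ a) (a : CGraph Γ) (f : Γ.Edge) :
    τ (a * S f) = d * τ (S f * a) := by
  have hck := isCKFamily (Γ := Γ)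
  have hT : ∀ a, d * τ a = ∑ e : Γ.Edge, τ (star (S e) * a * S e) := fun a => by
    conv_lhs => rw [← h a, transfer_apply, map_smul, map_sum, smul_eq_mul, ← mul_assoc]
    rw [mul_inv_cancel₀ (Nat.cast_ne_zero.2 hd0), one_mul]
  -- Both S_e⋆ p_v a S_e and S_e⋆ a p_v S_e equal S_e⋆ a S_e if v = s(e), and 0 otherwise.
  have hp : ∀ v a, τ (p v * a) = τ (a * p v) := fun v a => by
    have h1 : (d : ℂ) * τ (p v * a) = d * τ (a * p v) := by
      rw [hT, hT]
      refine Finset.sum_congr rfl fun e _ => ?_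
      have h2 : star (S e) * p v = if v = e.src then star (S e) else 0 := by
        have h2 := congrArg star (hck.p_mul_S v e)
        rwa [StarMul.star_mul, hck.star_p, apply_ite star, star_zero] at h2
      rw [← mul_assoc, h2, mul_assoc, mul_assoc (star (S e)), mul_assoc a, hck.p_mul_S]
      split_ifs
      · rfl
      · rw [zero_mul, mul_zero, mul_zero]
    exact mul_left_cancel₀ (Nat.cast_ne_zero.2 hd0) h1
  rw [hT, Finset.sum_eq_single f]
  · rw [← mul_assoc, hck.tgt, mul_assoc, hp, mul_assoc, hck.S_mul_p]
  · intro e _ he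
    rw [← mul_assoc, hck.star_mul_of_ne he, zero_mul, zero_mul, map_zero]
  · simp

/-- Averaging f along `transfer` gives an invariant functional and keeps the values at fixed points,
among them the projections of sets closed under adjacency. The set of all vertices shows that the
map is unital. -/
theorem exists_isKMS_of_state {d : ℕ} (hd1 : 1 < d)
    (hd : ∀ w, (Finset.univ.filter fun v => Γ.Adj v w).card = d) (f : CGraph Γ →ₚ[ℂ] ℂ)
    (hf : f 1 = 1) : ∃ τ : CGraph Γ →ₚ[ℂ] ℂ, IsKMS (Real.log d) τ ∧
      ∀ C : Finset V, (∀ v w, Γ.Adj v w → (v ∈ C ↔ w ∈ C)) →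
        τ (∑ v ∈ C, p v) = f (∑ v ∈ C, p v) := by
  have hd0 : d ≠ 0 := by omega
  have hfix := transfer_sum_p hd0 hd
  have h1 : transfer Γ d 1 = 1 := by
    have := hfix Finset.univ (by simp)
    rwa [isCKFamily.p_sum] at this
  obtain ⟨τ, hτ, hτf⟩ := exists_invariant_positive (transfer Γ d) h1 f
  refine ⟨τ, isKMS_of_mul_S ?_ (by rw [hτf 1 h1, hf]) fun a e => ?_,
    fun C hC => hτf _ (hfix C hC)⟩
  · exact (Real.log_pos (by exact_mod_cast hd1)).ne'
  · rw [mul_S_of_transfer hd0 hτ, ← Complex.ofReal_exp,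
      Real.exp_log (by exact_mod_cast Nat.pos_of_ne_zero hd0), Complex.ofReal_natCast]

end words

/-! ### The representation on square-summable functions on infinite paths -/

section pequiv

variable {X Y : Type*}

/-- A partial bijection is injective on its domain, so the nonzero terms are distinct terms of the
squared norm of f. -/
theorem PEquiv.sum_elim_le (σ : X ≃. Y) (f : lp (fun _ : Y => ℂ) 2) (s : Finset X) :
    ∑ x ∈ s, ‖((σ x).elim 0 f : ℂ)‖ ^ (2 : ℝ≥0∞).toReal ≤ ‖f‖ ^ (2 : ℝ≥0∞).toReal := by
  classical
  have h2 : (0 : ℝ) < (2 : ℝ≥0∞).toReal := by norm_num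
  calc ∑ x ∈ s, ‖((σ x).elim 0 f : ℂ)‖ ^ (2 : ℝ≥0∞).toReal
      = ∑ x ∈ s with (σ x).isSome, ‖((σ x).elim 0 f : ℂ)‖ ^ (2 : ℝ≥0∞).toReal := by
        symm
        refine Finset.sum_filter_of_ne fun x _ hx => ?_
        by_contra hn
        rw [Option.not_isSome_iff_eq_none] at hn
        simp [hn] at hx
    _ = ∑ y ∈ s.biUnion fun x => (σ x).toFinset, ‖f y‖ ^ (2 : ℝ≥0∞).toReal := by
        rw [Finset.sum_biUnion]
        · rw [Finset.sum_filter]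
          refine Finset.sum_congr rfl fun x _ => ?_
          cases hx : σ x <;> simp
        · intro x _ x' _ hne
          rw [Function.onFun, Finset.disjoint_left]
          intro y hy hy'
          rw [Option.mem_toFinset] at hy hy'
          exact hne (σ.inj hy hy')
    _ ≤ _ := lp.sum_rpow_le_norm_rpow h2 f _

/-- The partial isometry of square-summable functions defined by a partial bijection. -/
def PEquiv.lpMap (σ : X ≃. Y) : lp (fun _ : Y => ℂ) 2 →L[ℂ] lp (fun _ : X => ℂ) 2 :=
  LinearMap.mkContinuous
    { toFun := fun f => ⟨fun x => (σ x).elim 0 f, memℓp_gen' (σ.sum_elim_le f)⟩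
      map_add' := fun f g => lp.ext <| funext fun x => by
        change (σ x).elim 0 (f + g : lp (fun _ : Y => ℂ) 2) = (σ x).elim 0 f + (σ x).elim 0 g
        cases σ x
        · exact (add_zero 0).symm
        · rfl
      map_smul' := fun c f => lp.ext <| funext fun x => by
        change (σ x).elim 0 (c • f : lp (fun _ : Y => ℂ) 2) = c • (σ x).elim 0 f
        cases σ x
        · exact (smul_zero c).symm
        · rfl } 1 fun f => by
      rw [one_mul]
      exact lp.norm_le_of_forall_sum_le (by norm_num) (norm_nonneg _) (σ.sum_elim_le f)

theorem PEquiv.lpMap_mul (σ τ : X ≃. X) : σ.lpMap * τ.lpMap = (σ.trans τ).lpMap := by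
  ext f x
  change (σ x).elim 0 (τ.lpMap f) = ((σ x).bind τ).elim 0 f
  cases σ x <;> rfl

theorem PEquiv.star_lpMap (σ : X ≃. X) : star σ.lpMap = σ.symm.lpMap := by
  rw [ContinuousLinearMap.star_eq_adjoint]
  symm
  rw [ContinuousLinearMap.eq_adjoint_iff]
  intro f g
  rw [lp.inner_eq_tsum, lp.inner_eq_tsum]
  symm
  -- Both inner products are sums over the pairs (x, y) with σ x = y. For a nonzero term at y, the
  -- matching x exists and is chosen here.
  have hc : ∀ y : Function.support fun y => inner ℂ (σ.symm.lpMap f y) (g y),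
      ∃ x, σ.symm y.1 = some x := fun y => by
    by_contra! hn
    refine y.2 ?_
    change inner ℂ ((σ.symm y.1).elim 0 f) (g y.1) = 0
    rw [Option.eq_none_iff_forall_ne_some.2 hn]
    exact inner_zero_left _
  choose i hi using hc
  have hi' : ∀ y, σ (i y) = some y.1 := fun y => σ.eq_some_iff.1 (hi y)
  refine tsum_eq_tsum_of_ne_zero_bij i (fun y z hyz => ?_) (fun x hx => ?_) fun y => ?_
  · have h1 := hi' y
    rw [hyz, hi' z] at h1
    exact Subtype.ext (Option.some.inj h1).symm
  · cases hs : σ x with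
    | none =>
      refine absurd ?_ hx
      change inner ℂ (f x) ((σ x).elim 0 g) = 0
      rw [hs]
      exact inner_zero_right _
    | some y =>
      have hy : σ.symm y = some x := σ.eq_some_iff.2 hs
      have hm : inner ℂ (σ.symm.lpMap f y) (g y) ≠ 0 := by
        change inner ℂ ((σ.symm y).elim 0 f) (g y) ≠ 0
        rw [hy]
        change inner ℂ (f x) ((σ x).elim 0 g) ≠ 0 at hx
        rwa [hs] at hx
      refine ⟨⟨y, hm⟩, ?_⟩
      have h1 := hi ⟨y, hm⟩
      rw [hy] at h1
      exact (Option.some.inj h1).symm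
  · change inner ℂ (f (i y)) ((σ (i y)).elim 0 g) = inner ℂ ((σ.symm y.1).elim 0 f) (g y.1)
    rw [hi, hi']
    rfl

end pequiv

/-! ### Shifts of infinite paths as a Cuntz–Krieger family -/

section pathRep

variable {V : Type*} (Γ : Digraph V) [Fintype V] [DecidableEq V] [DecidableRel Γ.Adj]

/-- Infinite paths. -/
def InfPath : Type _ := {ω : ℕ → V // ∀ n, Γ.Adj (ω n) (ω (n + 1))}

variable {Γ}

/-- The path with its first edge removed. -/
def InfPath.tail (ω : InfPath Γ) : InfPath Γ := ⟨fun n => ω.1 (n + 1), fun n => ω.2 (n + 1)⟩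

/-- The path with an edge added at the start. -/
def InfPath.cons (e : Γ.Edge) (ω : InfPath Γ) (h : ω.1 0 = e.tgt) : InfPath Γ :=
  ⟨fun n => n.casesOn e.src ω.1, fun n => by
    cases n with
    | zero => change Γ.Adj e.src (ω.1 0); rw [h]; exact e.2
    | succ n => exact ω.2 n⟩

/-- The removal of the edge `e` at the start of a path. -/
def InfPath.shift (e : Γ.Edge) : InfPath Γ ≃. InfPath Γ where
  toFun ω := if ω.1 0 = e.src ∧ ω.1 1 = e.tgt then some ω.tail else none
  invFun ω := if h : ω.1 0 = e.tgt then some (ω.cons e h) else none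
  inv ω ω' := by
    constructor
    · intro h
      by_cases h0 : ω'.1 0 = e.tgt
      · rw [dif_pos h0] at h
        have h1 := Option.some.inj h
        subst h1
        rw [if_pos ⟨rfl, h0⟩]
        rfl
      · rw [dif_neg h0] at h; cases h
    · intro h
      by_cases h0 : ω.1 0 = e.src ∧ ω.1 1 = e.tgt
      · rw [if_pos h0] at h
        have h1 := Option.some.inj h
        subst h1
        rw [dif_pos (show ω.tail.1 0 = e.tgt from h0.2)]
        refine congrArg some (Subtype.ext (funext fun n => ?_))
        cases n with
        | zero => exact h0.1.symm
        | succ n => rfl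
      · rw [if_neg h0] at h; cases h

theorem InfPath.shift_apply (e : Γ.Edge) (ω : InfPath Γ) :
    InfPath.shift e ω = if ω.1 0 = e.src ∧ ω.1 1 = e.tgt then some ω.tail else none := rfl

theorem InfPath.shift_symm_apply (e : Γ.Edge) (ω : InfPath Γ) :
    (InfPath.shift e).symm ω = if h : ω.1 0 = e.tgt then some (ω.cons e h) else none := rfl

/-- The Cuntz–Krieger family of the path representation. -/
theorem isCKFamily_path : IsCKFamily Γ
    (fun v => (PEquiv.ofSet {ω : InfPath Γ | ω.1 0 = v}).lpMap)
    (fun e => (InfPath.shift e).lpMap) := by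
  have hset : ∀ (s : Set (InfPath Γ)) [DecidablePred (· ∈ s)] (f : lp (fun _ : InfPath Γ => ℂ) 2)
      (ω : InfPath Γ), (PEquiv.ofSet s).lpMap f ω = if ω ∈ s then f ω else 0 := fun s _ f ω => by
    change (if ω ∈ s then some ω else none).elim 0 f = _
    split_ifs <;> rfl
  have hmul : ∀ v, (PEquiv.ofSet {ω : InfPath Γ | ω.1 0 = v}).lpMap *
      (PEquiv.ofSet {ω : InfPath Γ | ω.1 0 = v}).lpMap =
        (PEquiv.ofSet {ω : InfPath Γ | ω.1 0 = v}).lpMap := fun v => by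
    ext f ω
    change (PEquiv.ofSet _).lpMap ((PEquiv.ofSet _).lpMap f) ω = _
    rw [hset, hset]
    split_ifs <;> rfl
  have htgt : ∀ e : Γ.Edge, star (InfPath.shift e).lpMap * (InfPath.shift e).lpMap =
      (PEquiv.ofSet {ω : InfPath Γ | ω.1 0 = e.tgt}).lpMap := fun e => by
    rw [PEquiv.star_lpMap, PEquiv.lpMap_mul]
    congr 1
    rw [PEquiv.symm_trans_self]
    congr 1
    ext ω
    change ((InfPath.shift e).symm ω).isSome = true ↔ ω.1 0 = e.tgt
    rw [InfPath.shift_symm_apply]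
    split_ifs with h <;> simp [h]
  have hsrc : ∀ (e : Γ.Edge) f (ω : InfPath Γ),
      ((InfPath.shift e).lpMap * star (InfPath.shift e).lpMap) f ω =
        if ω.1 0 = e.src ∧ ω.1 1 = e.tgt then f ω else 0 := fun e f ω => by
    rw [PEquiv.star_lpMap, PEquiv.lpMap_mul, PEquiv.self_trans_symm, hset]
    refine if_congr ?_ rfl rfl
    change (InfPath.shift e ω).isSome = true ↔ _
    rw [InfPath.shift_apply]
    split_ifs with h <;> simp [h]
  refine ⟨fun v => ?_, hmul, fun v w hvw => ?_, ?_, fun e => ?_, htgt, fun v => ?_⟩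
  · rw [PEquiv.star_lpMap, PEquiv.ofSet_symm]
  · ext f ω
    change (PEquiv.ofSet _).lpMap ((PEquiv.ofSet _).lpMap f) ω = 0
    rw [hset, hset]
    split_ifs with h1 h2
    · exact absurd (h1.symm.trans h2) hvw
    · rfl
    · rfl
  · ext f ω
    rw [sum_apply, lp.coeFn_sum, Finset.sum_apply]
    simp only [hset]
    rw [Finset.sum_eq_single (ω.1 0)]
    · exact if_pos rfl
    · intro v _ hv; exact if_neg fun h => hv h.symm
    · simp
  · exact mul_star_mul_of_idem (htgt e) (hmul _)
  · ext f ω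
    rw [sum_apply, lp.coeFn_sum, Finset.sum_apply, hset]
    simp only [hsrc]
    by_cases h : ω.1 0 = v
    -- S_e S_e⋆ projects onto the paths that start with e. Edges are determined by their end points,
    -- so exactly one edge starts ω.
    · rw [Finset.sum_eq_single (⟨(ω.1 0, ω.1 1), ω.2 0⟩ : Γ.Edge)]
      · rw [if_pos ⟨rfl, rfl⟩]; exact (if_pos h).symm
      · rintro e _ he
        exact if_neg fun h' => he (Subtype.ext (Prod.ext h'.1.symm h'.2.symm))
      · intro hn
        refine absurd ?_ hn
        rw [Finset.mem_filter]
        exact ⟨Finset.mem_univ _, h⟩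
    · rw [Finset.sum_eq_zero]
      · exact (if_neg h).symm
      · intro e he
        exact if_neg fun h' => h (h'.1.trans (Finset.mem_filter.1 he).2)

/-- The vector state of an infinite path. -/
theorem exists_state_of_infPath (ω : InfPath Γ) : ∃ f : CGraph Γ →ₚ[ℂ] ℂ, f 1 = 1 ∧
    ∀ v, f (CGraph.p v) = if ω.1 0 = v then 1 else 0 := by
  classical
  let π : CGraph Γ →⋆ₐ[ℂ] (lp (fun _ : InfPath Γ => ℂ) 2 →L[ℂ] lp (fun _ : InfPath Γ => ℂ) 2) :=
    CGraph.lift _ _ isCKFamily_path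
  let ξ : lp (fun _ : InfPath Γ => ℂ) 2 := lp.single 2 ω 1
  -- ξ is the point mass at ω, so pairing with it evaluates at ω.
  have hξ : ∀ η : lp (fun _ : InfPath Γ => ℂ) 2, inner ℂ ξ η = η ω := fun η => by
    rw [lp.inner_single_left]; simp
  have hξω : ξ ω = 1 := lp.single_apply_self ..
  refine ⟨PositiveLinearMap.mk₀
    { toFun := fun a => inner ℂ ξ (π a ξ)
      map_add' := fun a b => by rw [map_add, add_apply, inner_add_right]
      map_smul' := fun c a => by rw [map_smul, smul_apply, inner_smul_right]; rfl }
    fun a ha => ?_, ?_, fun v => ?_⟩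
  · obtain ⟨b, rfl⟩ := CStarAlgebra.nonneg_iff_eq_star_mul_self.1 ha
    change 0 ≤ inner ℂ ξ (π (star b * b) ξ)
    rw [map_mul, map_star, ContinuousLinearMap.star_eq_adjoint]
    change 0 ≤ inner ℂ ξ (ContinuousLinearMap.adjoint (π b) (π b ξ))
    rw [ContinuousLinearMap.adjoint_inner_right, inner_self_eq_norm_sq_to_K]
    have h0 := Complex.zero_le_real.2 (sq_nonneg ‖π b ξ‖)
    rwa [Complex.ofReal_pow] at h0
  · change inner ℂ ξ (π 1 ξ) = 1
    rw [map_one, hξ]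
    exact hξω
  · change inner ℂ ξ (π (CGraph.p v) ξ) = _
    rw [CGraph.lift_p, hξ]
    change (if ω.1 0 = v then some ω else none).elim 0 ξ = _
    split_ifs
    · exact hξω
    · rfl

end pathRep

/-! ### Invariance of the KMS state with constant weights -/

section invariance

open CGraph

variable {V : Type*} {Γ : Digraph V} [Fintype V] [DecidableEq V] [DecidableRel Γ.Adj]

/-! ### Elementary tensors in the minimal tensor product -/

section tensor

variable {A B : Type*} [CStarAlgebra A] [PartialOrder A] [StarOrderedRing A]
  [CStarAlgebra B] [PartialOrder B] [StarOrderedRing B]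

theorem MinTensor.tmul_mul (a a' : A) (b b' : B) :
    MinTensor.tmul a b * MinTensor.tmul a' b' = MinTensor.tmul (a * a') (b * b') := by
  rw [MinTensor.tmul, MinTensor.tmul, ← map_mul, Algebra.TensorProduct.tmul_mul_tmul]; rfl

theorem MinTensor.star_tmul (a : A) (b : B) :
    star (MinTensor.tmul a b) = MinTensor.tmul (star a) (star b) := by
  rw [MinTensor.tmul, ← map_star, TensorProduct.star_tmul]; rfl

theorem MinTensor.clm_ext {E : Type*} [NormedAddCommGroup E] [NormedSpace ℂ E]
    {f g : MinTensor A B →L[ℂ] E} (h : ∀ a b, f (MinTensor.tmul a b) = g (MinTensor.tmul a b))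
    (X : MinTensor A B) : f X = g X := by
  refine (minSeminorm A B).denseRange_ofAlg.induction_on (p := fun X : MinTensor A B => f X = g X)
    X (isClosed_eq f.continuous g.continuous) fun x => ?_
  change f (MinTensor.ofAlg A B x) = g (MinTensor.ofAlg A B x)
  induction x using TensorProduct.induction_on with
  | zero => simp only [map_zero]
  | tmul a b => exact h a b
  | add x y hx hy => simp only [map_add, hx, hy]

end tensor

/-- The KMS condition for slices. -/
theorem slice_conj {β : ℝ} {τ : CGraph Γ →ₚ[ℂ] ℂ} (h : IsKMS β τ)
    {B : Type*} [CStarAlgebra B] [PartialOrder B] [StarOrderedRing B]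
    (e f : Γ.Edge) (y z : B) (X : MinTensor (CGraph Γ) B) :
    slice τ (MinTensor.tmul (S e) y * X * MinTensor.tmul (star (S f)) z) =
      if e = f then Complex.exp (-β) • (y * slice τ (X * MinTensor.tmul (p e.tgt) 1) * z)
      else 0 := by
  refine MinTensor.clm_ext (f := slice τ ∘L
      (ContinuousLinearMap.mul ℂ _).flip (MinTensor.tmul (star (S f)) z) ∘L
      ContinuousLinearMap.mul ℂ _ (MinTensor.tmul (S e) y))
    (g := if e = f then Complex.exp (-β) • ((ContinuousLinearMap.mul ℂ _).flip z ∘L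
      ContinuousLinearMap.mul ℂ _ y ∘L slice τ ∘L
      (ContinuousLinearMap.mul ℂ _).flip (MinTensor.tmul (p e.tgt) 1)) else 0)
    (fun a b => ?_) X |>.trans ?_
  · change slice τ (MinTensor.tmul (S e) y * MinTensor.tmul a b * MinTensor.tmul (star (S f)) z) = _
    -- Moving S_e to the end by the KMS condition produces S_f⋆ S_e, which is p_{t(e)} or 0.
    rw [MinTensor.tmul_mul, MinTensor.tmul_mul, slice_tmul, mul_assoc (S e),
      h.mul_homogeneous (isHomogeneous_S e), mul_assoc a, isCKFamily.star_mul]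
    by_cases hef : e = f
    · subst hef
      simp only [if_true]
      change _ = Complex.exp (-β) • (y * slice τ (MinTensor.tmul a b *
        MinTensor.tmul (p e.tgt) 1) * z)
      rw [MinTensor.tmul_mul, slice_tmul, mul_one, mul_smul_comm, smul_mul_assoc, smul_smul]
      simp
    · rw [if_neg hef, if_neg (Ne.symm hef), mul_zero, map_zero, mul_zero, zero_smul]; rfl
  · split_ifs <;> rfl

theorem qAction_p (v : V) :
    qAction Γ (p v) = ∑ k, MinTensor.tmul (p k) (QAut.u k v) := lift_p _ _ _ v

theorem qAction_S (e : Γ.Edge) : qAction Γ (S e) =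
    ∑ l, MinTensor.tmul (S l) (QAut.u l.src e.src * QAut.u l.tgt e.tgt) := lift_S _ _ _ e

/-- The span of the elementary tensors whose first factor has degree `k`. -/
def degreeSpan (Γ : Digraph V) [DecidableRel Γ.Adj] (B : Type*) [CStarAlgebra B] [PartialOrder B]
    [StarOrderedRing B] (k : ℤ) : Submodule ℂ (MinTensor (CGraph Γ) B) :=
  Submodule.span ℂ {X | ∃ (a : CGraph Γ) (y : B), IsHomogeneous k a ∧ X = MinTensor.tmul a y}

/-! ### Grading of the tensor product by the gauge degree -/

section degreeSpan

variable {B : Type*} [CStarAlgebra B] [PartialOrder B] [StarOrderedRing B]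

theorem tmul_mem_degreeSpan {k : ℤ} {a : CGraph Γ} (ha : IsHomogeneous k a) (y : B) :
    MinTensor.tmul a y ∈ degreeSpan Γ B k := Submodule.subset_span ⟨a, y, ha, rfl⟩

theorem mul_mem_degreeSpan {j k : ℤ} {X Y : MinTensor (CGraph Γ) B} (hX : X ∈ degreeSpan Γ B j)
    (hY : Y ∈ degreeSpan Γ B k) : X * Y ∈ degreeSpan Γ B (j + k) := by
  have h := Submodule.mul_mem_mul hX hY
  rw [degreeSpan, degreeSpan, Submodule.span_mul_span] at h
  refine Submodule.span_mono ?_ h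
  rintro _ ⟨_, ⟨a, y, ha, rfl⟩, _, ⟨b, z, hb, rfl⟩, rfl⟩
  exact ⟨a * b, y * z, ha.mul hb, MinTensor.tmul_mul ..⟩

theorem star_mem_degreeSpan {k : ℤ} {X : MinTensor (CGraph Γ) B} (hX : X ∈ degreeSpan Γ B k) :
    star X ∈ degreeSpan Γ B (-k) := by
  rw [degreeSpan] at hX
  induction hX using Submodule.span_induction with
  | mem X hX =>
    obtain ⟨a, y, ha, rfl⟩ := hX
    rw [MinTensor.star_tmul]
    exact tmul_mem_degreeSpan ha.star _
  | zero => rw [star_zero]; exact zero_mem _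
  | add X Y _ _ hX hY => rw [star_add]; exact add_mem hX hY
  | smul c X _ hX => rw [star_smul]; exact Submodule.smul_mem _ _ hX

theorem slice_eq_zero_of_mem_degreeSpan {β : ℝ} (hβ : β ≠ 0) {τ : CGraph Γ →ₚ[ℂ] ℂ}
    (h : IsKMS β τ) {k : ℤ} (hk : k ≠ 0) {X : MinTensor (CGraph Γ) B}
    (hX : X ∈ degreeSpan Γ B k) : slice τ X = 0 := by
  rw [degreeSpan] at hX
  induction hX using Submodule.span_induction with
  | mem X hX =>
    obtain ⟨a, y, ha, rfl⟩ := hX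
    rw [slice_tmul, h.eq_zero_of_isHomogeneous hβ hk ha, zero_smul]
  | zero => rw [map_zero]
  | add X Y _ _ hX hY => rw [map_add, hX, hY, add_zero]
  | smul c X _ hX => rw [map_smul, hX, smul_zero]

end degreeSpan

theorem MinTensor.one_def {A B : Type*} [CStarAlgebra A] [PartialOrder A] [StarOrderedRing A]
    [CStarAlgebra B] [PartialOrder B] [StarOrderedRing B] :
    (1 : MinTensor A B) = MinTensor.tmul 1 1 := (map_one (MinTensor.ofAlg A B)).symm

/-- The action respects degrees, since it sends S_e to tensors whose first factors are edge
generators. -/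
theorem qAction_word_mem (l : List Γ.Edge) :
    qAction Γ (word l) ∈ degreeSpan Γ (QAut Γ) l.length := by
  induction l with
  | nil =>
    rw [word_nil, map_one, MinTensor.one_def]
    exact tmul_mem_degreeSpan isHomogeneous_one 1
  | cons e l ih =>
    rw [word_cons, map_mul, List.length_cons, Nat.cast_succ, add_comm]
    refine mul_mem_degreeSpan ?_ ih
    rw [qAction_S]
    exact sum_mem fun f _ => tmul_mem_degreeSpan (isHomogeneous_S f) _

theorem qAction_words_mem (l m : List Γ.Edge) (w : V) :
    qAction Γ (word l * p w * star (word m)) ∈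
      degreeSpan Γ (QAut Γ) (l.length + 0 + -m.length) := by
  rw [map_mul, map_mul, map_star]
  refine mul_mem_degreeSpan (mul_mem_degreeSpan (qAction_word_mem l) ?_)
    (star_mem_degreeSpan (qAction_word_mem m))
  rw [qAction_p]
  exact sum_mem fun f _ => tmul_mem_degreeSpan (isHomogeneous_p f) _

/-- As i is adjacent to t, the product u_{vi} u_{mt} vanishes unless v is adjacent to m. So the
restriction on m can be dropped, and the column of t sums to 1. -/
theorem IsMagic.sum_adj_mul {B : Type*} [CStarAlgebra B] {u : V → V → B} (h : IsMagic Γ u)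
    {i j t v : V} (hit : Γ.Adj i t) :
    ∑ m with Γ.Adj v m, u v i * u m t * u v j = if i = j then u v i else 0 := by
  have : ∑ m with Γ.Adj v m, u v i * u m t * u v j = ∑ m, u v i * u m t * u v j := by
    refine Finset.sum_subset (Finset.filter_subset _ _) fun m _ hm => ?_
    rw [h.mul_eq_zero_left hit (by simpa using hm), zero_mul]
  rw [this, ← Finset.sum_mul, ← Finset.mul_sum, h.col, mul_one, h.row_mul]

theorem IsMagic.sum_mul_mul {B : Type*} [CStarAlgebra B] {u : V → V → B} (h : IsMagic Γ u)
    (c : V → ℂ) (t i j : V) :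
    u t i * (∑ s, c s • u t s) * u t j = if i = j then c i • u t i else 0 := by
  simp only [Finset.mul_sum, mul_smul_comm, smul_mul_assoc, h.row_mul, smul_ite, smul_zero, Finset.sum_ite_eq, Finset.mem_univ, if_true]

/-- The inductive step. After expanding α(S_e) and α(S_f)⋆, `slice_conj` leaves the pairs with g =
g', and p_v ⊗ 1 selects source v. The hypothesis on a enters between u_{t(g)t(e)} and u_{t(g)t(f)},
where row orthogonality keeps the single term s = t(e) and forces t(e) = t(f). Summing over g then
forces s(e) = s(f) by `IsMagic.sum_adj_mul`. -/
theorem slice_qAction_conj {β : ℝ} {τ : CGraph Γ →ₚ[ℂ] ℂ} (h : IsKMS β τ) {a : CGraph Γ}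
    (ha : ∀ v, slice τ (qAction Γ a * MinTensor.tmul (p v) 1) = ∑ s, τ (p s * a) • QAut.u v s)
    (e f : Γ.Edge) (v : V) :
    slice τ (qAction Γ (S e * a * star (S f)) * MinTensor.tmul (p v) 1) =
      ∑ s, τ (p s * (S e * a * star (S f))) • QAut.u v s := by
  have hu := QAut.isMagic (Γ := Γ)
  have hck := isCKFamily (Γ := Γ)
  have hR : ∑ s, τ (p s * (S e * a * star (S f))) • QAut.u (Γ := Γ) v s =
      if e = f then (Complex.exp (-β) * τ (p e.tgt * a)) • QAut.u v e.src else 0 := by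
    have h1 : ∀ s, τ (p s * (S e * a * star (S f))) • QAut.u (Γ := Γ) v s =
        if s = e.src then τ (S e * a * star (S f)) • QAut.u v s else 0 := fun s => by
      rw [← mul_assoc, ← mul_assoc, hck.p_mul_S]
      split_ifs
      · rfl
      · rw [zero_mul, zero_mul, map_zero, zero_smul]
    simp only [h1, Finset.sum_ite_eq', Finset.mem_univ, if_true]
    rw [mul_assoc, h.mul_homogeneous (isHomogeneous_S e), mul_assoc, hck.star_mul,
      h.mul_homogeneous (isHomogeneous_p e.tgt)]
    by_cases hef : e = f
    · subst hef; simp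
    · rw [if_neg hef, if_neg (Ne.symm hef), mul_zero, map_zero, mul_zero, zero_smul]
  have hp : ∀ g : Γ.Edge, star (S g) * p v = if v = g.src then star (S g) else 0 := fun g => by
    have h2 := congrArg star (hck.p_mul_S v g)
    rwa [StarMul.star_mul, hck.star_p, apply_ite star, star_zero] at h2
  have hL : ∀ g g' : Γ.Edge,
      slice τ (MinTensor.tmul (S g) (QAut.u g.src e.src * QAut.u g.tgt e.tgt) * qAction Γ a *
        MinTensor.tmul (star (S g')) (star (QAut.u g'.src f.src * QAut.u g'.tgt f.tgt)) *
        MinTensor.tmul (p v) 1) =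
      if g = g' then if g.src = v then Complex.exp (-β) • if e.tgt = f.tgt then
        τ (p e.tgt * a) • (QAut.u g.src e.src * QAut.u g.tgt e.tgt * QAut.u g.src f.src) else 0
        else 0 else 0 := fun g g' => by
    rw [mul_assoc, MinTensor.tmul_mul, mul_one, hp]
    by_cases hv : v = g'.src
    · rw [if_pos hv, slice_conj h]
      by_cases hg : g = g'
      · subst hg
        rw [if_pos rfl, if_pos rfl, if_pos hv.symm, ha, StarMul.star_mul, hu.star_u, hu.star_u]
        congr 1
        rw [mul_assoc (QAut.u g.src e.src), ← mul_assoc, mul_assoc (QAut.u g.src e.src),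
          hu.sum_mul_mul]
        split_ifs
        · rw [mul_smul_comm, smul_mul_assoc]
        · rw [mul_zero, zero_mul]
      · rw [if_neg hg, if_neg hg]
    · have h0 : (MinTensor.tmul (0 : CGraph Γ) (star (QAut.u g'.src f.src * QAut.u g'.tgt f.tgt)) :
          MinTensor (CGraph Γ) (QAut Γ)) = 0 := by
        rw [MinTensor.tmul, TensorProduct.zero_tmul, map_zero]
      rw [if_neg hv, h0, mul_zero, map_zero]
      by_cases hg : g = g'
      · rw [if_pos hg, if_neg fun h2 => hv (h2.symm.trans (congrArg Digraph.Edge.src hg))]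
      · rw [if_neg hg]
  rw [hR, map_mul (qAction Γ), map_mul (qAction Γ), map_star, qAction_S, qAction_S, star_sum]
  simp only [MinTensor.star_tmul, Finset.sum_mul, Finset.mul_sum, map_sum, hL,
    Finset.sum_ite_eq', Finset.mem_univ, if_true]
  rw [← Finset.sum_filter]
  by_cases ht : e.tgt = f.tgt
  · simp only [if_pos ht]
    rw [← Finset.smul_sum, ← Finset.smul_sum, sum_edge_src v (fun a b =>
      QAut.u (Γ := Γ) a e.src * QAut.u b e.tgt * QAut.u a f.src), hu.sum_adj_mul e.2]
    by_cases hs : e.src = f.src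
    · have hef : e = f := Subtype.ext (Prod.ext hs ht)
      rw [if_pos hs, if_pos hef, smul_smul]
    · have hef : e ≠ f := fun hef => hs (congrArg Digraph.Edge.src hef)
      rw [if_neg hs, if_neg hef, smul_zero, smul_zero]
  · have hef : e ≠ f := fun hef => ht (congrArg Digraph.Edge.tgt hef)
    simp only [if_neg ht, if_neg hef, smul_zero, Finset.sum_const_zero]

/-- Induction on the common length; for different lengths both sides vanish by degree. Constancy of
the weights enters only at a = p_w, where the two sides are τ(p_v) u_{vw} and τ(p_w) u_{vw}. -/
theorem slice_qAction_words {β : ℝ} (hβ : β ≠ 0) {τ : CGraph Γ →ₚ[ℂ] ℂ} (h : IsKMS β τ)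
    (hc : ∀ v w, τ (p v) = τ (p w)) (l m : List Γ.Edge) (w v : V) :
    slice τ (qAction Γ (word l * p w * star (word m)) * MinTensor.tmul (p v) 1) =
      ∑ s, τ (p s * (word l * p w * star (word m))) • QAut.u v s := by
  by_cases hlm : l.length = m.length
  · induction l generalizing m v with
    | nil =>
      have hm : m = [] := List.length_eq_zero_iff.1 hlm.symm
      subst hm
      simp only [word_nil, star_one, mul_one, one_mul, isCKFamily.p_mul_p, qAction_p,
        Finset.sum_mul, map_sum, MinTensor.tmul_mul, slice_tmul, apply_ite τ, map_zero, ite_smul,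
        zero_smul, Finset.sum_ite_eq', Finset.mem_univ, if_true]
      rw [hc v w]
    | cons e l ih =>
      cases m with
      | nil => simp at hlm
      | cons f m =>
        have h1 : word (e :: l) * p w * star (word (f :: m)) =
            S e * (word l * p w * star (word m)) * star (S f) := by
          rw [word_cons, word_cons, StarMul.star_mul]
          simp only [mul_assoc]
        rw [h1]
        exact slice_qAction_conj h (fun v => ih m v (by simpa using hlm)) e f v
  · have hk : (l.length + 0 + -m.length : ℤ) ≠ 0 := by omega
    have hw := ((isHomogeneous_word l).mul (isHomogeneous_p w)).mul (isHomogeneous_word m).star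
    have h1 := mul_mem_degreeSpan (qAction_words_mem l m w)
      (tmul_mem_degreeSpan (isHomogeneous_p v) (1 : QAut Γ))
    rw [slice_eq_zero_of_mem_degreeSpan hβ h (by rwa [add_zero]) h1]
    refine (Finset.sum_eq_zero fun s _ => ?_).symm
    have h2 := (isHomogeneous_p s).mul hw
    rw [h.eq_zero_of_isHomogeneous hβ (by rwa [zero_add]) h2, zero_smul]

/-- A KMS state with equal weights on the vertex projections is invariant under the quantum
automorphism group. -/
theorem IsKMS.qAutInvariant {β : ℝ} (hβ : β ≠ 0) {τ : CGraph Γ →ₚ[ℂ] ℂ} (h : IsKMS β τ)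
    (hc : ∀ v w, τ (p v) = τ (p w)) : QAutInvariant τ := fun a => by
  have hcont : Continuous (qAction Γ) := by
    open scoped CStarAlgebra in exact map_continuous (qAction Γ)
  refine clm_ext (mem_closure_words (Γ := Γ))
    (f := slice τ ∘L (⟨(qAction Γ).toAlgHom.toLinearMap, hcont⟩ :
      CGraph Γ →L[ℂ] MinTensor (CGraph Γ) (QAut Γ)))
    (g := τ.toCLM.smulRight (1 : QAut Γ)) ?_ a
  rintro _ ⟨⟨l, w, m⟩, rfl⟩
  change slice τ (qAction Γ (word l * p w * star (word m))) =
    τ (word l * p w * star (word m)) • (1 : QAut Γ)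
  set b := word l * p w * star (word m) with hb
  -- Inserting this sum turns the localised formula into ∑_v ∑_s τ(p_s b) u_{vs}, and the columns of
  -- u sum to 1.
  have h1 : (1 : MinTensor (CGraph Γ) (QAut Γ)) = ∑ v, MinTensor.tmul (p v) 1 := by
    rw [MinTensor.one_def]
    simp only [MinTensor.tmul, ← map_sum, ← TensorProduct.sum_tmul, isCKFamily.p_sum]
  rw [← mul_one (qAction Γ b), h1, Finset.mul_sum, map_sum]
  simp_rw [hb, slice_qAction_words hβ h hc, ← hb]
  rw [Finset.sum_comm]
  simp_rw [← Finset.smul_sum, QAut.isMagic.col]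
  rw [← Finset.sum_smul, ← map_sum, ← Finset.sum_mul, isCKFamily.p_sum, one_mul]

end invariance

/-! ### The quantum isomorphism of the magic square -/

section magicSquare

open LBCS

/-- The assignment of a vertex, extended by `0` to all variables. -/
def LBCS.Vertex.extend {n m : ℕ} {F : LBCS n m} (v : F.Vertex) (i : Fin n) : ZMod 2 :=
  if h : i ∈ F.supp v.1 then v.2.1 ⟨i, h⟩ else 0

theorem LBCS.Vertex.extend_of_mem {n m : ℕ} {F : LBCS n m} (v : F.Vertex) {i : Fin n}
    (h : i ∈ F.supp v.1) : v.extend i = v.2.1 ⟨i, h⟩ := dif_pos h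

theorem LBCS.Vertex.sum_extend {n m : ℕ} {F : LBCS n m} (v : F.Vertex) :
    ∑ i ∈ F.supp v.1, v.extend i = F.rhs v.1 := by
  rw [← v.2.2, ← Finset.sum_coe_sort]
  exact Finset.sum_congr rfl fun i _ => v.extend_of_mem i.2

theorem LBCS.graph_adj_iff {n m : ℕ} {F : LBCS n m} (v w : F.Vertex) :
    F.graph.Adj v w ↔ ∃ i ∈ F.supp v.1, i ∈ F.supp w.1 ∧ v.extend i ≠ w.extend i := by
  constructor
  · rintro ⟨i, h, h', hne⟩
    exact ⟨i, h, h', by rwa [v.extend_of_mem h, w.extend_of_mem h']⟩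
  · rintro ⟨i, h, h', hne⟩
    exact ⟨i, h, h', by rwa [v.extend_of_mem h, w.extend_of_mem h'] at hne⟩

/-- The sign character of `𝔽₂`. -/
def parity (x : ZMod 2) : ℤ := if x = 0 then 1 else -1

theorem parity_add : ∀ x y, parity (x + y) = parity x * parity y := by decide

theorem parity_mul_self : ∀ x, parity x * parity x = 1 := by decide

theorem parity_ne : ∀ x y, x ≠ y → parity x = -parity y := by decide

/-- The Mermin–Peres square of observables, written as tensor products of Pauli matrices. -/
def squareOperator : Fin 9 → Matrix (Fin 4) (Fin 4) ℤ :=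
  ![!![0, 0, 1, 0; 0, 0, 0, 1; 1, 0, 0, 0; 0, 1, 0, 0],
    !![0, 1, 0, 0; 1, 0, 0, 0; 0, 0, 0, 1; 0, 0, 1, 0],
    !![0, 0, 0, 1; 0, 0, 1, 0; 0, 1, 0, 0; 1, 0, 0, 0],
    !![1, 0, 0, 0; 0, -1, 0, 0; 0, 0, 1, 0; 0, 0, 0, -1],
    !![1, 0, 0, 0; 0, 1, 0, 0; 0, 0, -1, 0; 0, 0, 0, -1],
    !![1, 0, 0, 0; 0, -1, 0, 0; 0, 0, -1, 0; 0, 0, 0, 1],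
    !![0, 0, 1, 0; 0, 0, 0, -1; 1, 0, 0, 0; 0, -1, 0, 0],
    !![0, 1, 0, 0; 1, 0, 0, 0; 0, 0, 0, -1; 0, 0, -1, 0],
    !![0, 0, 0, -1; 0, 0, 1, 0; 0, 1, 0, 0; -1, 0, 0, 0]]

theorem squareOperator_transpose : ∀ i, (squareOperator i).transpose = squareOperator i := by
  decide +kernel

theorem squareOperator_mul_self : ∀ i, squareOperator i * squareOperator i = 1 := by
  decide +kernel

/-- The three observables of an equation commute and multiply to the sign of its right side, so the
product of two is the third up to this sign. All entries are integers, even those of Y ⊗ Y, so this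
is a finite computation. -/
theorem squareOperator_mul : ∀ l, ∀ i ∈ magicSquare.supp l, ∃ j k,
    magicSquare.supp l = {i, j, k} ∧ i ≠ j ∧ i ≠ k ∧ j ≠ k ∧
      squareOperator j * squareOperator i = parity (magicSquare.rhs l) • squareOperator k ∧
      squareOperator k * squareOperator i = parity (magicSquare.rhs l) • squareOperator j := by
  decide +kernel

/-- Four times the joint spectral projection of the observables in an equation. -/
def squareProj (l : Fin 6) (x : Fin 9 → ZMod 2) : Matrix (Fin 4) (Fin 4) ℤ :=
  1 + ∑ i ∈ magicSquare.supp l, parity (x i) • squareOperator i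

theorem squareProj_transpose (l : Fin 6) (x : Fin 9 → ZMod 2) :
    (squareProj l x).transpose = squareProj l x := by
  rw [squareProj, Matrix.transpose_add, Matrix.transpose_one, Matrix.transpose_sum]
  simp only [Matrix.transpose_smul, squareOperator_transpose]

/-- Right multiplication by the i-th observable exchanges 1 with the i-th term and the two other
terms with each other, up to the sign of x_i, because the signs of a solution multiply to that of
the right side. -/
theorem squareProj_mul_operator {l : Fin 6} {x : Fin 9 → ZMod 2}
    (hx : ∑ i ∈ magicSquare.supp l, x i = magicSquare.rhs l) {i : Fin 9}
    (hi : i ∈ magicSquare.supp l) :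
    squareProj l x * squareOperator i = parity (x i) • squareProj l x := by
  obtain ⟨j, k, hs, hij, hik, hjk, h1, h2⟩ := squareOperator_mul l i hi
  have hsum : ∀ {M : Type} [AddCommMonoid M] (f : Fin 9 → M),
      ∑ i ∈ magicSquare.supp l, f i = f i + (f j + f k) := fun f => by
    rw [hs, Finset.sum_insert (by simp [hij, hik]), Finset.sum_insert (by simp [hjk]),
      Finset.sum_singleton]
  rw [hsum] at hx
  have e := congrArg parity hx
  rw [parity_add, parity_add] at e
  have ei := parity_mul_self (x i)
  have ej := parity_mul_self (x j)
  have ek := parity_mul_self (x k)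
  rw [squareProj, hsum]
  simp only [add_mul, one_mul, smul_mul_assoc, squareOperator_mul_self, h1, h2, smul_add,
    smul_smul, ei, ← e]
  rw [show parity (x j) * (parity (x i) * (parity (x j) * parity (x k))) =
      parity (x i) * parity (x k) by linear_combination (parity (x i) * parity (x k)) * ej,
    show parity (x k) * (parity (x i) * (parity (x j) * parity (x k))) =
      parity (x i) * parity (x j) by linear_combination (parity (x i) * parity (x j)) * ek,
    one_smul]
  abel

theorem card_magicSquare_supp : ∀ l, (magicSquare.supp l).card = 3 := by decide

/-- The right factor has four terms, 1 and three signed observables, each of which acts as the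
identity on the left factor. -/
theorem squareProj_mul_self {l : Fin 6} {x : Fin 9 → ZMod 2}
    (hx : ∑ i ∈ magicSquare.supp l, x i = magicSquare.rhs l) :
    squareProj l x * squareProj l x = (4 : ℤ) • squareProj l x := by
  conv_lhs => rw [squareProj.eq_def l x, mul_add, ← squareProj.eq_def, mul_one, Finset.mul_sum]
  rw [Finset.sum_congr rfl (g := fun _ => squareProj l x) fun i hi => by
    rw [mul_smul_comm, squareProj_mul_operator hx hi, smul_smul, parity_mul_self, one_smul],
    Finset.sum_const, card_magicSquare_supp]
  module

/-- With P, P' the two factors and A the shared observable, P A P' is P P' times the sign of x_i and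
also times the opposite sign. -/
theorem squareProj_mul_eq_zero {l l' : Fin 6} {x x' : Fin 9 → ZMod 2}
    (hx : ∑ i ∈ magicSquare.supp l, x i = magicSquare.rhs l)
    (hx' : ∑ i ∈ magicSquare.supp l', x' i = magicSquare.rhs l') {i : Fin 9}
    (hi : i ∈ magicSquare.supp l) (hi' : i ∈ magicSquare.supp l') (hne : x i ≠ x' i) :
    squareProj l x * squareProj l' x' = 0 := by
  have h1 := squareProj_mul_operator hx hi
  have h2 := congrArg Matrix.transpose (squareProj_mul_operator hx' hi')
  rw [Matrix.transpose_mul, Matrix.transpose_smul, squareProj_transpose,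
    squareOperator_transpose] at h2
  have h3 : parity (x i) • (squareProj l x * squareProj l' x') =
      -(parity (x i) • (squareProj l x * squareProj l' x')) := by
    conv_lhs => rw [← smul_mul_assoc, ← h1, mul_assoc, h2, mul_smul_comm]
    rw [parity_ne _ _ hne, neg_smul, neg_neg]
  have h4 : parity (x i) • (squareProj l x * squareProj l' x') = 0 := by
    ext a b
    have := congrFun (congrFun h3 a) b
    rw [Matrix.neg_apply] at this
    rw [Matrix.zero_apply]
    linarith
  have h5 := congrArg (parity (x i) • ·) h4
  simpa only [smul_smul, parity_mul_self, one_smul, smul_zero] using h5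

/-- Four times the entries of the magic unitary that relates the two graphs. -/
def squareBlock (v : magicSquare.Vertex) (w : magicSquare.homogeneous.Vertex) :
    Matrix (Fin 4) (Fin 4) ℤ :=
  if v.1 = w.1 then squareProj v.1 fun i => v.extend i + w.extend i else 0

theorem sum_extend_add {v : magicSquare.Vertex} {w : magicSquare.homogeneous.Vertex}
    (h : v.1 = w.1) :
    ∑ i ∈ magicSquare.supp v.1, (v.extend i + w.extend i) = magicSquare.rhs v.1 := by
  rw [Finset.sum_add_distrib, v.sum_extend]
  have := w.sum_extend
  rw [← h] at this
  exact (congrArg (magicSquare.rhs v.1 + ·) this).trans (add_zero _)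

theorem squareBlock_transpose (v w) : (squareBlock v w).transpose = squareBlock v w := by
  rw [squareBlock]
  split_ifs
  · exact squareProj_transpose _ _
  · rfl

theorem squareBlock_mul_self (v w) :
    squareBlock v w * squareBlock v w = (4 : ℤ) • squareBlock v w := by
  rw [squareBlock]
  split_ifs with h
  · exact squareProj_mul_self (sum_extend_add h)
  · simp

/-- If the sums of assignments agreed at all shared variables, v and v' would differ exactly where w
and w' do, and the adjacencies would coincide. So the two joint spectral projections conflict at
some observable. -/
theorem squareBlock_mul_eq_zero {v v' w w'}
    (h : ¬(magicSquare.graph.Adj v v' ↔ magicSquare.homogeneous.graph.Adj w w')) :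
    squareBlock v w * squareBlock v' w' = 0 := by
  rw [squareBlock, squareBlock]
  split_ifs with hv hv'
  · have key : ∃ i ∈ magicSquare.supp v.1, i ∈ magicSquare.supp v'.1 ∧
        v.extend i + w.extend i ≠ v'.extend i + w'.extend i := by
      rw [graph_adj_iff, graph_adj_iff] at h
      change ¬(_ ↔ ∃ i ∈ magicSquare.supp w.1, i ∈ magicSquare.supp w'.1 ∧ _) at h
      rw [← hv, ← hv'] at h
      by_contra! hn
      refine h ⟨?_, ?_⟩ <;> rintro ⟨i, h1, h2, h3⟩ <;> refine ⟨i, h1, h2, fun h4 => h3 ?_⟩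
      · have := hn i h1 h2
        rwa [h4, add_left_inj] at this
      · have := hn i h1 h2
        rwa [h4, add_right_inj] at this
    obtain ⟨i, h1, h2, h3⟩ := key
    exact squareProj_mul_eq_zero (sum_extend_add hv) (sum_extend_add hv') h1 h2 h3
  all_goals simp

/-- Each equation has four solutions, and among them each of its variables takes both values equally
often. -/
theorem sum_parity_homogeneous : ∀ l, (∑ w : magicSquare.homogeneous.Vertex,
      if l = w.1 then (1 : ℤ) else 0) = 4 ∧
    ∀ i ∈ magicSquare.supp l, (∑ w : magicSquare.homogeneous.Vertex,
      if l = w.1 then parity (w.extend i) else 0) = 0 := by decide +kernel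

theorem sum_parity_magicSquare : ∀ l, (∑ v : magicSquare.Vertex,
      if v.1 = l then (1 : ℤ) else 0) = 4 ∧
    ∀ i ∈ magicSquare.supp l, (∑ v : magicSquare.Vertex,
      if v.1 = l then parity (v.extend i) else 0) = 0 := by decide +kernel

/-- Serves rows and columns alike: c holds the signs of the fixed assignment and y is the running
one. The terms with observables cancel and the four units remain. -/
theorem sum_squareProj {ι : Type} [Fintype ι] (P : ι → Prop) [DecidablePred P] (l : Fin 6)
    (c : Fin 9 → ℤ) (y : ι → Fin 9 → ZMod 2) (x : ι → Fin 9 → ZMod 2)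
    (hx : ∀ w i, parity (x w i) = c i * parity (y w i))
    (h1 : ∑ w, (if P w then (1 : ℤ) else 0) = 4)
    (h2 : ∀ i ∈ magicSquare.supp l, ∑ w, (if P w then parity (y w i) else 0) = 0) :
    ∑ w, (if P w then squareProj l (x w) else 0) = (4 : ℤ) • 1 := by
  have e : ∀ w, (if P w then squareProj l (x w) else 0) = (if P w then (1 : ℤ) else 0) • 1 +
      ∑ i ∈ magicSquare.supp l, (c i * if P w then parity (y w i) else 0) • squareOperator i :=
    fun w => by
      split_ifs
      · simp only [squareProj, hx, one_smul]
      · simp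
  simp_rw [e]
  rw [Finset.sum_add_distrib, ← Finset.sum_smul, h1, Finset.sum_comm]
  refine add_eq_left.2 (Finset.sum_eq_zero fun i hi => ?_)
  rw [← Finset.sum_smul, ← Finset.mul_sum, h2 i hi, mul_zero, zero_smul]

theorem squareBlock_row (v : magicSquare.Vertex) : ∑ w, squareBlock v w = (4 : ℤ) • 1 :=
  sum_squareProj (fun w : magicSquare.homogeneous.Vertex => v.1 = w.1) v.1 (fun i => parity (v.extend i))
    (fun w i => w.extend i) _
    (fun _ _ => parity_add _ _) (sum_parity_homogeneous v.1).1 (sum_parity_homogeneous v.1).2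

theorem squareBlock_col (w) : ∑ v, squareBlock v w = (4 : ℤ) • 1 := by
  have h : ∀ v, squareBlock v w =
      if v.1 = w.1 then squareProj w.1 fun i => v.extend i + w.extend i else 0 := fun v => by
    rw [squareBlock]
    split_ifs with h
    · rw [h]
    · rfl
  simp_rw [h]
  exact sum_squareProj (fun v : magicSquare.Vertex => v.1 = w.1) w.1
    (fun i => parity (w.extend i)) (fun v i => v.extend i) _
    (fun _ _ => by rw [parity_add, mul_comm]) (sum_parity_magicSquare w.1).1
    (sum_parity_magicSquare w.1).2

/-- The embedding of integer matrices into a C⋆-algebra. -/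
def intMatrixHom : Matrix (Fin 4) (Fin 4) ℤ →+* CStarMatrix (Fin 4) (Fin 4) ℂ :=
  (CStarMatrix.ofMatrixRingEquiv : Matrix (Fin 4) (Fin 4) ℂ ≃+* _).toRingHom.comp
    (Int.castRingHom ℂ).mapMatrix

theorem star_intMatrixHom (M : Matrix (Fin 4) (Fin 4) ℤ) :
    star (intMatrixHom M) = intMatrixHom M.transpose := by
  ext i j
  exact map_intCast (starRingEnd ℂ) (M j i)

/-- Orthogonality for incompatible pairs implies commutation with the adjacency matrix. -/
theorem sum_adjEntry_of_orthogonal {V : Type*} {Γ : Digraph V} [Fintype V] [DecidableRel Γ.Adj]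
    {B : Type*} [Ring B] [Algebra ℂ B] {u : V → V → B} (hrow : ∀ i, ∑ j, u i j = 1)
    (hcol : ∀ j, ∑ i, u i j = 1)
    (h : ∀ i i' j j', ¬(Γ.Adj i i' ↔ Γ.Adj j j') → u i j * u i' j' = 0) (i j : V) :
    ∑ k, adjEntry Γ k j • u i k = ∑ k, adjEntry Γ i k • u k j := by
  have h1 : ∀ k m, adjEntry Γ k j • (u i k * u m j) = adjEntry Γ i m • (u i k * u m j) :=
    fun k m => by
      by_cases hk : Γ.Adj i m ↔ Γ.Adj k j
      · rw [adjEntry, adjEntry, if_congr hk rfl rfl]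
      · rw [h _ _ _ _ hk, smul_zero, smul_zero]
  -- A column sum is inserted on one side and a row sum on the other; the double sums then agree
  -- term by term.
  calc ∑ k, adjEntry Γ k j • u i k = ∑ k, ∑ m, adjEntry Γ k j • (u i k * u m j) := by
        refine Finset.sum_congr rfl fun k _ => ?_
        rw [← Finset.smul_sum, ← Finset.mul_sum, hcol, mul_one]
    _ = ∑ m, ∑ k, adjEntry Γ i m • (u i k * u m j) := by
        rw [Finset.sum_comm]
        simp_rw [h1]
    _ = _ := by
        refine Finset.sum_congr rfl fun m _ => ?_
        rw [← Finset.smul_sum, ← Finset.sum_mul, hrow, one_mul]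

/-- The magic unitary that exchanges the two graphs, multiplied by `4`. -/
def squareMagic : magicSquare.Vertex ⊕ magicSquare.homogeneous.Vertex →
    magicSquare.Vertex ⊕ magicSquare.homogeneous.Vertex → Matrix (Fin 4) (Fin 4) ℤ
  | .inl v, .inr w => squareBlock v w
  | .inr w, .inl v => squareBlock v w
  | .inl _, .inl _ => 0
  | .inr _, .inr _ => 0

/-- A nonzero factor needs indices from different components. If i and i' also lie in different
components, neither pair is adjacent, contrary to h. The two cases left are statements about
`squareBlock`. -/
theorem squareMagic_mul_eq_zero {i i' j j'}
    (h : ¬(magicSquareDigraph.Adj i i' ↔ magicSquareDigraph.Adj j j')) :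
    squareMagic i j * squareMagic i' j' = 0 := by
  have hl : ∀ v w, magicSquareDigraph.Adj (.inl v) (.inl w) ↔ magicSquare.graph.Adj v w :=
    fun _ _ => Iff.rfl
  have hr : ∀ v w, magicSquareDigraph.Adj (.inr v) (.inr w) ↔
    magicSquare.homogeneous.graph.Adj v w := fun _ _ => Iff.rfl
  have hlr : ∀ v w, magicSquareDigraph.Adj (.inl v) (.inr w) ↔ False := fun _ _ => by
    simp [magicSquareDigraph, SimpleGraph.directed]
  have hrl : ∀ v w, magicSquareDigraph.Adj (.inr v) (.inl w) ↔ False := fun _ _ => by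
    simp [magicSquareDigraph, SimpleGraph.directed]
  rcases i with v | w <;> rcases j with v₁ | w₁ <;> rcases i' with v₂ | w₂ <;>
    rcases j' with v₃ | w₃ <;> simp only [squareMagic, mul_zero, zero_mul] <;>
    simp only [hl, hr, hlr, hrl, not_true_eq_false] at h
  · exact squareBlock_mul_eq_zero h
  · exact squareBlock_mul_eq_zero fun h' => h h'.symm

/-- The scalar 1/4 undoes the factor 4 that keeps the blocks integral. -/
theorem isMagic_squareMagic : IsMagic magicSquareDigraph
    (fun i j => (4 : ℂ)⁻¹ • intMatrixHom (squareMagic i j)) := by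
  have h4 : (4 : ℂ)⁻¹ • intMatrixHom ((4 : ℤ) • 1) = 1 := by
    rw [map_zsmul, map_one, ← Int.cast_smul_eq_zsmul ℂ, smul_smul]
    norm_num
  have hrow : ∀ i, ∑ j, (4 : ℂ)⁻¹ • intMatrixHom (squareMagic i j) = 1 := fun i => by
    rw [← Finset.smul_sum, ← map_sum, Fintype.sum_sum_type]
    rcases i with v | w
    · simp only [squareMagic, Finset.sum_const_zero, zero_add, squareBlock_row, h4]
    · simp only [squareMagic, Finset.sum_const_zero, add_zero, squareBlock_col, h4]
  have hcol : ∀ j, ∑ i, (4 : ℂ)⁻¹ • intMatrixHom (squareMagic i j) = 1 := fun j => by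
    rw [← Finset.smul_sum, ← map_sum, Fintype.sum_sum_type]
    rcases j with v | w
    · simp only [squareMagic, Finset.sum_const_zero, zero_add, squareBlock_row, h4]
    · simp only [squareMagic, Finset.sum_const_zero, add_zero, squareBlock_col, h4]
  have htr : ∀ i j, (squareMagic i j).transpose = squareMagic i j := fun i j => by
    rcases i with v | w <;> rcases j with v' | w' <;>
      simp only [squareMagic, squareBlock_transpose, Matrix.transpose_zero]
  have hmul : ∀ i j, squareMagic i j * squareMagic i j = (4 : ℤ) • squareMagic i j := fun i j => by
    rcases i with v | w <;> rcases j with v' | w' <;>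
      simp only [squareMagic, squareBlock_mul_self, mul_zero, smul_zero]
  refine ⟨fun i j => ?_, fun i j => ?_, hrow, hcol,
    sum_adjEntry_of_orthogonal hrow hcol fun i i' j j' h => ?_⟩
  · rw [star_smul, star_intMatrixHom, htr]
    congr 1
    simp
  · rw [smul_mul_smul_comm, ← map_mul, hmul, map_zsmul, ← Int.cast_smul_eq_zsmul ℂ, smul_smul]
    norm_num
  · rw [smul_mul_smul_comm, ← map_mul, squareMagic_mul_eq_zero h, map_zero, smul_zero]

end magicSquare

/-! ### Representations of the quantum automorphism group -/

namespace QAut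

variable {V : Type*} {Γ : Digraph V} [Fintype V] [DecidableEq V] [DecidableRel Γ.Adj]

/-- The universal property of the quantum automorphism group. -/
theorem exists_hom {B : Type*} [CStarAlgebra B] {u : V → V → B} (h : IsMagic Γ u) :
    ∃ φ : QAut Γ →⋆ₐ[ℂ] B, ∀ i j, φ (QAut.u i j) = u i j := by
  have hg : ∀ i j, FreeStarAlg.lift (fun x : V × V => u x.1 x.2) (FreeStarAlg.gen (i, j)) = u i j :=
    fun i j => FreeStarAlg.lift_gen _ _
  refine ⟨UnivCStar.lift (fun x => u x.1 x.2) fun r hr => ?_,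
    fun i j => UnivCStar.lift_gen _ _ _⟩
  cases hr with
  | star_u i j => rw [map_sub, map_star, hg, h.star_u, sub_self]
  | u_mul i j => rw [map_sub, map_mul, hg, h.u_mul, sub_self]
  | row i => simp only [map_sub, map_sum, map_one, hg, h.row, sub_self]
  | col j => simp only [map_sub, map_sum, map_one, hg, h.col, sub_self]
  | comm i j => simp only [map_sub, map_sum, map_smul, hg, h.comm, sub_self]

end QAut

/-! ### Values on paths -/

section paths

open CGraph

variable {V : Type*} {Γ : Digraph V} [Fintype V] [DecidableEq V] [DecidableRel Γ.Adj]

/-- Puts paths of length 0 on the same footing as the others: the empty word is 1, and a first edge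
absorbs the projection of its source. -/
theorem CGraph.path_eq (μ : DiPath Γ) : path μ = p μ.start * word μ.edges := by
  obtain ⟨v, l, h, hc⟩ := μ
  cases l with
  | nil => exact (mul_one _).symm
  | cons e l =>
    change word (e :: l) = p v * word (e :: l)
    rw [word_cons, ← mul_assoc, isCKFamily.p_mul_S, if_pos (h e rfl).symm]

theorem CGraph.path_eq_word (μ : DiPath Γ) (h : μ.edges ≠ []) : path μ = word μ.edges := by
  obtain ⟨v, l, hh, hc⟩ := μ
  cases l with
  | nil => exact absurd rfl h
  | cons e l => rfl

theorem CGraph.star_word_mul_self_of_isChain {l : List Γ.Edge} (hl : l ≠ [])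
    (hc : l.IsChain fun e f => e.tgt = f.src) : ∃ v, star (word l) * word l = p v := by
  induction l with
  | nil => exact absurd rfl hl
  | cons e l ih =>
    rw [star_word_mul_cons, if_pos rfl]
    cases l with
    | nil => exact ⟨e.tgt, by rw [word_nil, star_one, mul_one, one_mul]⟩
    | cons f l =>
      rw [List.isChain_cons_cons] at hc
      have h1 : p e.tgt * word (f :: l) = word (f :: l) := by
        rw [word_cons, ← mul_assoc, isCKFamily.p_mul_S, if_pos hc.1]
      rw [h1]
      exact ih (by simp) hc.2

theorem CGraph.star_path_mul_self (μ : DiPath Γ) : ∃ v, star (path μ) * path μ = p v := by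
  by_cases h : μ.edges = []
  · refine ⟨μ.start, ?_⟩
    rw [path_eq, h, word_nil, mul_one, isCKFamily.star_p, isCKFamily.p_mul]
  · rw [path_eq_word μ h]
    exact star_word_mul_self_of_isChain h μ.chain

/-- Different starting vertices give orthogonal projections. For the same starting vertex the edge
lists differ, and equal length makes both nonempty, so the statement on words applies. -/
theorem CGraph.star_path_mul_of_ne {μ ν : DiPath Γ} (hlen : μ.length = ν.length) (h : μ ≠ ν) :
    star (path μ) * path ν = 0 := by
  by_cases hs : μ.start = ν.start
  · have hne : μ.edges ≠ ν.edges := fun he => h (by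
      obtain ⟨v, l, h1, h2⟩ := μ
      obtain ⟨w, m, h3, h4⟩ := ν
      simp only at hs he
      subst hs he
      rfl)
    have hμ : μ.edges ≠ [] := fun h0 => hne (by
      rw [h0]
      rw [DiPath.length, DiPath.length, h0] at hlen
      exact (List.length_eq_zero_iff.1 hlen.symm).symm)
    have hν : ν.edges ≠ [] := fun h0 => hμ (by
      rw [DiPath.length, DiPath.length, h0] at hlen
      exact List.length_eq_zero_iff.1 hlen)
    rw [path_eq_word μ hμ, path_eq_word ν hν]
    exact star_word_mul_of_ne hlen hne
  · rw [path_eq, path_eq, StarMul.star_mul, isCKFamily.star_p, mul_assoc, ← mul_assoc (p _),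
      isCKFamily.p_orth _ _ hs, zero_mul, mul_zero]

theorem CGraph.isHomogeneous_path (μ : DiPath Γ) : IsHomogeneous μ.length (path μ) := by
  rw [path_eq, ← zero_add (μ.length : ℤ)]
  exact (isHomogeneous_p _).mul (isHomogeneous_word _)

theorem IsKMS.path_mul_star_of_ne {β : ℝ} (hβ : β ≠ 0) {τ : CGraph Γ →ₚ[ℂ] ℂ} (h : IsKMS β τ)
    {μ ν : DiPath Γ} (hne : μ ≠ ν) : τ (path μ * star (path ν)) = 0 := by
  by_cases hlen : μ.length = ν.length
  · rw [h.mul_homogeneous (isHomogeneous_path μ), star_path_mul_of_ne hlen.symm hne.symm, map_zero,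
      mul_zero]
  · exact h.eq_zero_of_isHomogeneous hβ (k := μ.length + -ν.length) (by omega)
      ((isHomogeneous_path μ).mul (isHomogeneous_path ν).star)

theorem IsKMS.path_mul_star_self {β : ℝ} {τ : CGraph Γ →ₚ[ℂ] ℂ} (h : IsKMS β τ) (μ : DiPath Γ) :
    ∃ v, τ (path μ * star (path μ)) = Complex.exp (-(μ.length * β)) * τ (p v) := by
  obtain ⟨v, hv⟩ := star_path_mul_self μ
  refine ⟨v, ?_⟩
  rw [h.mul_homogeneous (isHomogeneous_path μ), hv, Int.cast_natCast]

/-! ### Weights of KMS states -/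

/-- Harmonic functions on a regular graph are constant along edges. -/
theorem SimpleGraph.eq_of_adj_of_harmonic (G : SimpleGraph V) [DecidableRel G.Adj] {d : ℕ}
    (hd : ∀ v, (Finset.univ.filter fun w => G.Adj v w).card = d) {x : V → ℝ}
    (hx : ∀ v, d * x v = ∑ w with G.Adj v w, x w) {v w : V} (h : G.Adj v w) : x v = x w := by
  -- Harmonicity puts x in the kernel of the Laplacian, whose quadratic form is the sum of (x_v -
  -- x_w)² over the edges.
  refine (G.lapMatrix_mulVec_eq_zero_iff_forall_adj (x := x)).1 (funext fun v => ?_) v w h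
  rw [SimpleGraph.lapMatrix_mulVec_apply, ← SimpleGraph.card_neighborFinset_eq_degree,
    SimpleGraph.neighborFinset_eq_filter, hd, hx, sub_self]
  rfl

/-- At e^β = d the eigenvector equation says that the weights are harmonic; this is used for real
and imaginary parts separately. -/
theorem IsKMS.apply_p_eq_of_adj {τ : CGraph Γ →ₚ[ℂ] ℂ} {d : ℕ} (hd0 : d ≠ 0)
    (h : IsKMS (Real.log d) τ) (hsymm : ∀ v w, Γ.Adj v w → Γ.Adj w v) (hloop : ∀ v, ¬ Γ.Adj v v)
    (hd : ∀ w, (Finset.univ.filter fun v => Γ.Adj v w).card = d) {v w : V} (hvw : Γ.Adj v w) :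
    τ (p v) = τ (p w) := by
  have key : ∀ v, d * τ (p v) = ∑ w with Γ.Adj v w, τ (p w) := fun v => by
    have hd' : (d : ℂ) ≠ 0 := Nat.cast_ne_zero.2 hd0
    rw [h.apply_p v, ← mul_assoc, Complex.exp_neg, ← Complex.ofReal_exp,
      Real.exp_log (by exact_mod_cast Nat.pos_of_ne_zero hd0), Complex.ofReal_natCast,
      mul_inv_cancel₀ hd', one_mul]
  let G : SimpleGraph V := ⟨Γ.Adj, ⟨fun v w => hsymm v w⟩, ⟨hloop⟩⟩
  let _ : DecidableRel G.Adj := inferInstanceAs (DecidableRel Γ.Adj)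
  have hG : ∀ v, (Finset.univ.filter fun w => G.Adj v w).card = d := fun v => by
    rw [← hd v]
    congr 1
    ext w
    simp only [Finset.mem_filter, Finset.mem_univ, true_and]
    exact ⟨hsymm v w, hsymm w v⟩
  refine Complex.ext (G.eq_of_adj_of_harmonic hG (x := fun v => (τ (p v)).re) (fun v => ?_) hvw)
    (G.eq_of_adj_of_harmonic hG (x := fun v => (τ (p v)).im) (fun v => ?_) hvw)
  · have := congrArg Complex.re (key v)
    simpa using this
  · have := congrArg Complex.im (key v)
    simpa using this

/-- KMS states whose weights are preserved by an automorphism are invariant under it. -/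
theorem IsKMS.autAction_eq {β : ℝ} (hβ : β ≠ 0) {τ : CGraph Γ →ₚ[ℂ] ℂ} (h : IsKMS β τ)
    (g : Γ.Adj ≃r Γ.Adj) (hg : ∀ v, τ (p (g v)) = τ (p v)) (a : CGraph Γ) :
    τ (autAction g a) = τ a := by
  let τ' : CGraph Γ →ₚ[ℂ] ℂ := PositiveLinearMap.mk₀
    (τ.toLinearMap ∘ₗ (autAction g : CGraph Γ →⋆ₐ[ℂ] CGraph Γ).toAlgHom.toLinearMap) fun a ha => by
      obtain ⟨b, rfl⟩ := CStarAlgebra.nonneg_iff_eq_star_mul_self.1 ha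
      change 0 ≤ τ (autAction g (star b * b))
      rw [map_mul (autAction g), map_star]
      exact τ.map_nonneg (star_mul_self_nonneg _)
  have hτ' : ∀ a, τ' a = τ (autAction g a) := fun _ => rfl
  have hS : ∀ e, autAction g (S e) = S (edgeMap g e) := fun e => lift_S _ _ _ e
  have hp : ∀ v, autAction g (p v) = p (g v) := fun v => lift_p _ _ _ v
  -- The automorphism permutes the S_e, so the KMS condition on generators passes to the composite.
  have hk : IsKMS β τ' := isKMS_of_mul_S hβ
    (by rw [hτ', _root_.map_one (autAction g), h.map_one]) fun a e => by
    rw [hτ', hτ', map_mul (autAction g), map_mul (autAction g), hS, h.mul_S]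
  rw [← hτ', hk.ext hβ h fun v => by rw [hτ', hp, hg]]

end paths

/-! ### The magic square graph -/

section magicSquareGraph

open LBCS CGraph

/-- The neighbours are the 3 other solutions of the same equation and, for each of the 3 equations
sharing a variable with it, the 2 solutions that disagree there: 3 + 3 · 2 = 9. -/
theorem card_adj_magicSquareDigraph :
    ∀ w, (Finset.univ.filter fun v => magicSquareDigraph.Adj v w).card = 9 := by decide +kernel

/-- A strong form of connectedness. The case v = w gives a neighbour along which a path can go back
and forth. -/
theorem exists_adj_adj_magicSquare : ∀ v w : magicSquare.Vertex,
    ∃ u, magicSquare.graph.Adj v u ∧ magicSquare.graph.Adj u w := by decide +kernel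

theorem exists_adj_adj_homogeneous : ∀ v w : magicSquare.homogeneous.Vertex,
    ∃ u, magicSquare.homogeneous.graph.Adj v u ∧ magicSquare.homogeneous.graph.Adj u w := by
  decide +kernel

/-- The rows and the columns both add up to the sum of all variables, but their right sides add up
to 0 and 1. -/
theorem magicSquare_unsatisfiable : ∀ x : Fin 9 → ZMod 2,
    ¬ ∀ l, ∑ i ∈ magicSquare.supp l, x i = magicSquare.rhs l := by decide +kernel

/-- Consequently, pairwise nonadjacent vertices belong to different equations. -/
theorem LBCS.adj_of_fst_eq {n m : ℕ} {F : LBCS n m} {v w : F.Vertex} (h : v.1 = w.1)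
    (hne : v ≠ w) : F.graph.Adj v w := by
  obtain ⟨l, f, hf⟩ := v
  obtain ⟨k, f', hf'⟩ := w
  simp only at h
  subst h
  have hff : f ≠ f' := fun h => hne (by subst h; rfl)
  obtain ⟨i, hi⟩ := Function.ne_iff.1 hff
  exact ⟨i.1, i.2, i.2, hi⟩

/-- A system with as many pairwise consistent vertices as equations is satisfiable. -/
theorem LBCS.exists_solution {n m : ℕ} {F : LBCS n m} (f : Fin m → F.Vertex)
    (hf : Function.Injective f) (hadj : ∀ l k, ¬ F.graph.Adj (f l) (f k)) :
    ∃ x : Fin n → ZMod 2, ∀ l, ∑ i ∈ F.supp l, x i = F.rhs l := by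
  classical
  have hinj : Function.Injective fun l => (f l).1 := fun l k h => by
    by_contra hne
    exact hadj l k (adj_of_fst_eq h (hf.ne hne))
  have hsurj : ∀ l, ∃ k, (f k).1 = l := Finite.surjective_of_injective hinj
  -- A variable may take its value from any vertex that assigns one, since the vertices are pairwise
  -- consistent; 0 is for variables in no equation.
  refine ⟨fun i => if h : ∃ k, i ∈ F.supp (f k).1 then (f h.choose).extend i else 0, fun l => ?_⟩
  obtain ⟨k, rfl⟩ := hsurj l
  rw [← (f k).sum_extend]
  refine Finset.sum_congr rfl fun i hi => ?_
  have h : ∃ k, i ∈ F.supp (f k).1 := ⟨k, hi⟩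
  refine (dif_pos h).trans ?_
  by_contra hne
  exact hadj h.choose k ((graph_adj_iff _ _).2 ⟨i, h.choose_spec, hi, hne⟩)

theorem magicSquareDigraph_adj_inl_inl {v w} :
    magicSquareDigraph.Adj (.inl v) (.inl w) ↔ magicSquare.graph.Adj v w := Iff.rfl

theorem magicSquareDigraph_adj_inr_inr {v w} :
    magicSquareDigraph.Adj (.inr v) (.inr w) ↔ magicSquare.homogeneous.graph.Adj v w := Iff.rfl

theorem isLeft_eq_of_adj {v w} (h : magicSquareDigraph.Adj v w) : v.isLeft = w.isLeft := by
  rcases v with v | v <;> rcases w with w | w <;>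
    simp_all [magicSquareDigraph, SimpleGraph.directed]

/-- The components are preserved by automorphisms. -/
theorem isLeft_automorphism (g : magicSquareDigraph.Adj ≃r magicSquareDigraph.Adj) (v) :
    (g v).isLeft = v.isLeft := by
  have key : ∀ (g : magicSquareDigraph.Adj ≃r magicSquareDigraph.Adj) w,
      (g (.inr w)).isLeft = false := fun g w => by
    by_contra hl
    rw [Bool.not_eq_false] at hl
    -- Any two homogeneous vertices have a common neighbour, so g moves the whole component once it
    -- moves one vertex.
    have hall : ∀ w', ∃ v, g (.inr w') = .inl v := fun w' => by
      obtain ⟨u, h1, h2⟩ := exists_adj_adj_homogeneous w w'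
      have h1' := isLeft_eq_of_adj (g.map_rel_iff.2 (magicSquareDigraph_adj_inr_inr.2 h1))
      have h2' := isLeft_eq_of_adj (g.map_rel_iff.2 (magicSquareDigraph_adj_inr_inr.2 h2))
      exact Sum.isLeft_iff.1 (by rw [← h2', ← h1', hl])
    choose f hf using hall
    -- The six zero assignments are pairwise consistent, so their images are pairwise nonadjacent
    -- and glue to a solution of the magic square.
    let z : Fin 6 → magicSquare.homogeneous.Vertex :=
      fun l => ⟨l, 0, Finset.sum_const_zero⟩
    have hz : Function.Injective fun l => f (z l) := fun l k h => by
      have h1 := hf (z l)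
      rw [show f (z l) = f (z k) from h, ← hf (z k)] at h1
      have h2 := Sum.inr_injective (g.injective h1)
      exact congrArg Sigma.fst h2
    obtain ⟨x, hx⟩ := exists_solution (fun l => f (z l)) hz fun l k h => by
      rw [← magicSquareDigraph_adj_inl_inl, ← hf, ← hf, g.map_rel_iff] at h
      obtain ⟨i, _, _, hne⟩ := magicSquareDigraph_adj_inr_inr.1 h
      exact hne rfl
    exact magicSquare_unsatisfiable x hx
  rcases v with v | w
  · cases hv : g (.inl v) with
    | inl v' => rfl
    | inr w =>
      have h1 : g.symm (.inr w) = .inl v := by rw [← hv, g.symm_apply_apply]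
      have h2 := key g.symm w
      rw [h1] at h2
      exact absurd h2 (by simp)
  · exact key g w

/-- The weights of a KMS state are constant on the two components. -/
theorem IsKMS.apply_p_eq_of_isLeft {τ : CGraph magicSquareDigraph →ₚ[ℂ] ℂ}
    (h : IsKMS (Real.log 9) τ) {v w} (hvw : v.isLeft = w.isLeft) : τ (p v) = τ (p w) := by
  have hadj : ∀ {v w}, magicSquareDigraph.Adj v w → τ (p v) = τ (p w) := fun {v w} hvw => by
    refine IsKMS.apply_p_eq_of_adj (d := 9) (by norm_num) (by exact_mod_cast h)
      (fun v w h => ?_) (fun v h => ?_) card_adj_magicSquareDigraph hvw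
    · exact SimpleGraph.Adj.symm
        (G := magicSquare.graph ⊕g magicSquare.homogeneous.graph) h
    · exact SimpleGraph.irrefl (magicSquare.graph ⊕g magicSquare.homogeneous.graph) h
  rcases v with v | v <;> rcases w with w | w
  · obtain ⟨u, h1, h2⟩ := exists_adj_adj_magicSquare v w
    exact (hadj (magicSquareDigraph_adj_inl_inl.2 h1)).trans
      (hadj (magicSquareDigraph_adj_inl_inl.2 h2))
  · simp at hvw
  · simp at hvw
  · obtain ⟨u, h1, h2⟩ := exists_adj_adj_homogeneous v w
    exact (hadj (magicSquareDigraph_adj_inr_inr.2 h1)).trans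
      (hadj (magicSquareDigraph_adj_inr_inr.2 h2))

/-- Six equations with four solutions each. -/
theorem card_magicSquare_vertex : Fintype.card magicSquare.Vertex = 24 := by decide +kernel

theorem card_homogeneous_vertex : Fintype.card magicSquare.homogeneous.Vertex = 24 := by
  decide +kernel

/-- Invariance under the quantum automorphism group equalizes the weights. -/
theorem QAutInvariant.apply_p_eq {τ : CGraph magicSquareDigraph →ₚ[ℂ] ℂ} (hq : QAutInvariant τ)
    (h : IsKMS (Real.log 9) τ) (v w) : τ (p v) = τ (p w) := by
  obtain ⟨φ, hφ⟩ := QAut.exists_hom isMagic_squareMagic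
  have key : ∀ v w, τ (p (.inl v)) = τ (p (.inr w)) := fun v w => by
    -- In the matrix representation the sum runs over the opposite component only, where the weight
    -- is a constant c. The blocks sum to four times the unit, so the identity reads c · 1 = τ(p_v)
    -- · 1.
    have h1 := congrArg φ (hq (p (.inl v)))
    rw [qAction_p, map_sum, map_sum, map_smul, map_one, Fintype.sum_sum_type] at h1
    simp only [slice_tmul, map_smul, hφ, squareMagic, map_zero, smul_zero, Finset.sum_const_zero,
      zero_add] at h1
    obtain ⟨c, hc⟩ : ∃ c, c = τ (p (.inr w)) := ⟨_, rfl⟩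
    have hr : ∀ w', τ (p (.inr w')) = c := fun w' => by
      rw [hc]; exact h.apply_p_eq_of_isLeft rfl
    simp_rw [hr] at h1
    rw [← Finset.smul_sum, ← Finset.smul_sum, ← map_sum, squareBlock_row, map_zsmul, map_one,
      ← Int.cast_smul_eq_zsmul ℂ, smul_smul, smul_smul] at h1
    have h2 := congrFun (congrFun (congrArg CStarMatrix.ofMatrix.symm h1) 0) 0
    change _ * (1 : ℂ) = _ * (1 : ℂ) at h2
    rw [mul_one, mul_one] at h2
    rw [← h2, ← hc]
    push_cast
    ring
  let v₀ : magicSquare.Vertex := ⟨0, 0, Finset.sum_const_zero⟩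
  let w₀ : magicSquare.homogeneous.Vertex := ⟨0, 0, Finset.sum_const_zero⟩
  have h0 : ∀ v, τ (p v) = τ (p (.inl v₀)) := fun v => by
    rcases v with v | v
    · exact h.apply_p_eq_of_isLeft rfl
    · exact (key v₀ v).symm
  rw [h0 v, h0 w]

end magicSquareGraph

/-! ### KMS states of the magic square graph with prescribed mass -/

section states

variable {V : Type*} {Γ : Digraph V} [Fintype V] [DecidableEq V] [DecidableRel Γ.Adj]

/-- The infinite path that goes back and forth between two vertices. -/
def InfPath.alternating {v w : V} (h : Γ.Adj v w) (h' : Γ.Adj w v) : InfPath Γ :=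
  ⟨fun n => if Even n then v else w, fun n => by
    beta_reduce
    by_cases hn : Even n
    · rw [if_pos hn, if_neg (by rwa [Nat.even_add_one, not_not])]; exact h
    · rw [if_neg hn, if_pos (by rwa [Nat.even_add_one])]; exact h'⟩

/-- The vector state of a path starting at v has mass 1 at v and 0 at the other vertices; going back
and forth along an edge is such a path. -/
theorem exists_state_of_adj {v : V} (hv : ∃ w, Γ.Adj v w ∧ Γ.Adj w v) :
    ∃ f : CGraph Γ →ₚ[ℂ] ℂ, f 1 = 1 ∧ ∀ C : Finset V,
      f (∑ w ∈ C, CGraph.p w) = if v ∈ C then 1 else 0 := by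
  obtain ⟨w, h, h'⟩ := hv
  obtain ⟨f, h1, hf⟩ := exists_state_of_infPath (InfPath.alternating h h')
  refine ⟨f, h1, fun C => ?_⟩
  simp_rw [map_sum, hf]
  exact Finset.sum_ite_eq C v fun _ => (1 : ℂ)

end states

open LBCS in
/-- KMS states with prescribed mass of the first component. -/
theorem exists_isKMS_magicSquare {s : ℝ} (h0 : 0 ≤ s) (h1 : s ≤ 1) :
    ∃ τ : CGraph magicSquareDigraph →ₚ[ℂ] ℂ, IsKMS (Real.log 9) τ ∧
      τ (∑ v with v.isLeft, CGraph.p v) = s := by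
  let v₀ : magicSquare.Vertex := ⟨0, 0, Finset.sum_const_zero⟩
  let w₀ : magicSquare.homogeneous.Vertex := ⟨0, 0, Finset.sum_const_zero⟩
  obtain ⟨f, f1, hf⟩ := exists_state_of_adj (Γ := magicSquareDigraph) (v := .inl v₀) (by
    obtain ⟨u, h, h'⟩ := exists_adj_adj_magicSquare v₀ v₀
    exact ⟨.inl u, h, h'⟩)
  obtain ⟨g, g1, hg⟩ := exists_state_of_adj (Γ := magicSquareDigraph) (v := .inr w₀) (by
    obtain ⟨u, h, h'⟩ := exists_adj_adj_homogeneous w₀ w₀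
    exact ⟨.inr u, h, h'⟩)
  -- Averaging preserves the masses of the components, so it is enough that the initial state has
  -- mass s on the first one.
  let k : CGraph magicSquareDigraph →ₚ[ℂ] ℂ := PositiveLinearMap.mk₀
    ((s : ℂ) • f.toLinearMap + ((1 - s : ℝ) : ℂ) • g.toLinearMap) fun a ha =>
      add_nonneg (mul_nonneg (Complex.zero_le_real.2 h0) (f.map_nonneg ha))
        (mul_nonneg (Complex.zero_le_real.2 (sub_nonneg.2 h1)) (g.map_nonneg ha))
  have hk : ∀ a, k a = s * f a + ((1 - s : ℝ) : ℂ) * g a := fun _ => rfl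
  obtain ⟨τ, hτ, hτC⟩ := exists_isKMS_of_state (d := 9) (by norm_num) card_adj_magicSquareDigraph k
    (by rw [hk, f1, g1]; push_cast; ring)
  refine ⟨τ, by exact_mod_cast hτ, ?_⟩
  rw [hτC _ fun v w h => by simp [isLeft_eq_of_adj h], hk, hf, hg, if_pos (by simp),
    if_neg (by simp)]
  simp

theorem IsKMS.sum_inl {τ : CGraph magicSquareDigraph →ₚ[ℂ] ℂ} (h : IsKMS (Real.log 9) τ)
    (v₀ : LBCS.magicSquare.Vertex) :
    ∑ v, τ (CGraph.p (.inl v)) = 24 * τ (CGraph.p (.inl v₀)) := by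
  have h1 : ∀ v : LBCS.magicSquare.Vertex, τ (CGraph.p (.inl v)) = τ (CGraph.p (.inl v₀)) :=
    fun v => h.apply_p_eq_of_isLeft rfl
  rw [Finset.sum_congr rfl fun v _ => h1 v, Finset.sum_const, Finset.card_univ,
    card_magicSquare_vertex, nsmul_eq_mul]
  rfl

theorem IsKMS.sum_inr {τ : CGraph magicSquareDigraph →ₚ[ℂ] ℂ} (h : IsKMS (Real.log 9) τ)
    (w₀ : LBCS.magicSquare.homogeneous.Vertex) :
    ∑ w, τ (CGraph.p (.inr w)) = 24 * τ (CGraph.p (.inr w₀)) := by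
  have h1 : ∀ w : LBCS.magicSquare.homogeneous.Vertex,
      τ (CGraph.p (.inr w)) = τ (CGraph.p (.inr w₀)) := fun w => h.apply_p_eq_of_isLeft rfl
  rw [Finset.sum_congr rfl fun w _ => h1 w, Finset.sum_const, Finset.card_univ,
    card_homogeneous_vertex, nsmul_eq_mul]
  rfl

theorem IsKMS.sum_isLeft {τ : CGraph magicSquareDigraph →ₚ[ℂ] ℂ} (h : IsKMS (Real.log 9) τ)
    (v₀ : LBCS.magicSquare.Vertex) :
    τ (∑ v with v.isLeft, CGraph.p v) = 24 * τ (CGraph.p (.inl v₀)) := by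
  rw [map_sum, Finset.sum_filter, Fintype.sum_sum_type]
  simp only [Sum.isLeft_inl, Sum.isLeft_inr, if_true, Bool.false_eq_true, if_false,
    Finset.sum_const_zero, add_zero]
  exact h.sum_inl v₀

theorem IsKMS.sum_eq_one {τ : CGraph magicSquareDigraph →ₚ[ℂ] ℂ} (h : IsKMS (Real.log 9) τ)
    (v₀ : LBCS.magicSquare.Vertex) (w₀ : LBCS.magicSquare.homogeneous.Vertex) :
    24 * τ (CGraph.p (.inl v₀)) + 24 * τ (CGraph.p (.inr w₀)) = 1 := by
  rw [← h.sum_inl, ← h.sum_inr, ← Fintype.sum_sum_type fun v => τ (CGraph.p v), h.sum_p]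

/-- KMS states with equal weights have weights `1 / 48`. -/
theorem IsKMS.apply_p_eq_const {τ : CGraph magicSquareDigraph →ₚ[ℂ] ℂ} (h : IsKMS (Real.log 9) τ)
    (hc : ∀ v w, τ (CGraph.p v) = τ (CGraph.p w)) (v) : τ (CGraph.p v) = 1 / 48 := by
  have h1 := h.sum_eq_one ⟨0, 0, Finset.sum_const_zero⟩ ⟨0, 0, Finset.sum_const_zero⟩
  rw [hc _ v, hc (.inr _) v] at h1
  linear_combination h1 / 48

end

/-! ### The inverse temperature, the invariant KMS state and the family of all KMS states -/

theorem mainTheorem2 :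
    (∀ (β : ℝ) (τ : CGraph magicSquareDigraph →ₚ[ℂ] ℂ), IsKMS β τ → β = Real.log 9) ∧
    (∃ τ : CGraph magicSquareDigraph →ₚ[ℂ] ℂ,
      IsKMS (Real.log 9) τ ∧ QAutInvariant τ ∧
      (∀ μ ν : DiPath magicSquareDigraph,
        (μ = ν → τ (CGraph.path μ * star (CGraph.path ν)) = 1 / (48 * 9 ^ μ.length)) ∧
        (μ ≠ ν → τ (CGraph.path μ * star (CGraph.path ν)) = 0)) ∧
      ∀ (β : ℝ) (τ' : CGraph magicSquareDigraph →ₚ[ℂ] ℂ), IsKMS β τ' → QAutInvariant τ' → τ' = τ) ∧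
    {τ : CGraph magicSquareDigraph →ₚ[ℂ] ℂ | IsKMS (Real.log 9) τ}.Infinite ∧
    (∀ (β : ℝ) (τ : CGraph magicSquareDigraph →ₚ[ℂ] ℂ), IsKMS β τ → AutInvariant τ) := by
  have hlog : Real.log 9 ≠ 0 := (Real.log_pos (by norm_num)).ne'
  have hβ : ∀ (β : ℝ) (τ : CGraph magicSquareDigraph →ₚ[ℂ] ℂ), IsKMS β τ → β = Real.log 9 :=
    fun β τ h => by simpa using h.eq_log card_adj_magicSquareDigraph
  refine ⟨hβ, ?_, ?_, fun β τ h g a => ?_⟩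
  -- The components have 24 vertices each, so mass 1/2 is what makes all weights equal.
  · obtain ⟨τ, hτ, hs⟩ := exists_isKMS_magicSquare (s := 1 / 2) (by norm_num) (by norm_num)
    have hc : ∀ v w, τ (CGraph.p v) = τ (CGraph.p w) := by
      have key : ∀ v w, τ (CGraph.p (.inl v)) = τ (CGraph.p (.inr w)) := fun v w => by
        have h1 := hτ.sum_eq_one v w
        rw [hτ.sum_isLeft v] at hs
        push_cast at hs
        linear_combination hs / 12 - h1 / 24
      rintro (v | v) (w | w)
      · exact hτ.apply_p_eq_of_isLeft rfl
      · exact key v w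
      · exact (key w v).symm
      · exact hτ.apply_p_eq_of_isLeft rfl
    refine ⟨τ, hτ, hτ.qAutInvariant hlog hc, fun μ ν => ⟨?_, hτ.path_mul_star_of_ne hlog⟩,
      fun β τ' h' hq => ?_⟩
    · rintro rfl
      obtain ⟨v, hv⟩ := hτ.path_mul_star_self μ
      have he : Complex.exp (-(μ.length * Real.log 9)) = ((9 : ℂ) ^ μ.length)⁻¹ := by
        rw [Complex.exp_neg, Complex.exp_nat_mul, ← Complex.ofReal_exp,
          Real.exp_log (by norm_num)]
        norm_num
      rw [hv, hτ.apply_p_eq_const hc, he]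
      field_simp
    · obtain rfl := hβ β τ' h'
      have hc' := hq.apply_p_eq h'
      exact h'.ext hlog hτ fun v => by rw [h'.apply_p_eq_const hc', hτ.apply_p_eq_const hc]
  -- The masses 1/(n + 1) of the first component are pairwise distinct and lie in [0, 1].
  · have hex : ∀ n : ℕ, ∃ τ : CGraph magicSquareDigraph →ₚ[ℂ] ℂ, IsKMS (Real.log 9) τ ∧
        τ (∑ v with v.isLeft, CGraph.p v) = ((1 / ((n : ℝ) + 1) : ℝ) : ℂ) := fun n =>
      exists_isKMS_magicSquare (by positivity)
        (by rw [div_le_one (by positivity)]; linarith [Nat.cast_nonneg (α := ℝ) n])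
    choose f hf hfn using hex
    refine Set.infinite_of_injective_forall_mem (f := f) (fun m n hmn => ?_) hf
    have h1 := hfn m
    rw [hmn, hfn n, Complex.ofReal_inj, one_div, one_div, inv_inj, add_left_inj] at h1
    exact_mod_cast h1.symm
  · obtain rfl := hβ β τ h
    exact h.autAction_eq hlog g (fun v => h.apply_p_eq_of_isLeft (isLeft_automorphism g v)) a
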